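/- All Hilbert spaces are finite-dimensional and complex, and $\log$ is to base two. $S(\rho)=-\mathrm{tr}(\rho\log\rho)$, $S(A|B,\rho_{AB})=S(\rho_{AB})-S(\rho_B)$ and $F(\rho,\sigma)=\|\sqrt\rho\sqrt\sigma\|_1^2$. For $n\ge 1$, $\phi_n$ denotes a maximally entangled state of Schmidt rank $n$. **Definitions.** Let $d_A=\dim\mathcal H_A$ and let $\mathcal H_{B'}$ be a copy of $\mathcal H_A$ under the control of $B$. For an integer $1\le L\le d_A$, an *$L$-merging* for states on $\mathcal H_A\otimes\mathcal H_B$ is a channel $$\mathcal M(\rho)=\sum_{k=0}^{\lfloor d_A/L\rfloor}(a_k\otimes u_k)\,\rho\,(a_k\otimes u_k)^*$$ where, with $\dim\mathcal K_A=\dim\mathcal K_B=L$, the $a_k:\mathcal H_A\to\mathcal K_A$ are partial isometries with pairwise orthogonal initial subspaces, of rank $L$ for $k\ge 1$ and of rank $d_A-L\lfloor d_A/L\rfloor$ for $k=0$, and the $u_k:\mathcal H_B\to\mathcal K_B\otimes\mathcal H_{B'}\otimes\mathcal H_B$ are isometries. For a state $\rho_{AB}$ with purification $\psi_{ABE}$,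 its merging fidelity is $F_m(\rho_{AB},\mathcal M)=F\big((\mathcal M\otimes \mathrm{id}_E)(\psi_{ABE}),\ \phi_L\otimes\psi_{B'BE}\big)$, where $\phi_L$ lives on $\mathcal K_A\otimes\mathcal K_B$ and $\psi_{B'BE}$ is $\psi_{ABE}$ with the $A$-part relocated to $B'$; it does not depend on the choice of the purification. A channel $\mathcal M$ is an *$A\to B$ one-way LOCC with $D$ measurement outcomes* if $\mathcal M=\sum_{k=1}^{D}\mathcal A_k\otimes\mathcal B_k$, where $\mathcal A_1,\dots,\mathcal A_D$ are completely positive maps on $A$'s side whose sum is trace preserving, and $\mathcal B_1,\dots,\mathcal B_D$ are channels on $B$'s side. ($D$ is the number of different classical messages sent from $A$ to $B$.) Let $\{\rho_{AB,i}\}_{i=1}^N$, $N\ge1$, be a finite set of states on $\mathcal H_A\otimes\mathcal H_B$. An *$L$-merging protocol* for this set consists, for each block length $l\ge1$, of positive integers $K_l,L_l,D_l$ and an $L_l$-merging $\mathcal M_l$ for states on $(\mathcal K^0_{A}\otimes\mathcal H_A^{\otimes l})\otimes(\mathcal K^0_{B}\otimes\mathcal H_B^{\otimes l})$, $\dim\mathcal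 K^0_A=\dim\mathcal K^0_B=K_l$, that is also an $A\to B$ one-way LOCC with $D_l$ measurement outcomes, such that $$\min_{1\le i\le N}F_m\big(\phi_{K_l}\otimes\rho_{AB,i}^{\otimes l},\ \mathcal M_l\big)\longrightarrow 1\qquad(l\to\infty)$$ and $K_l,L_l\le 2^{lC}$ for all $l\ge 1$ and some constant $C>0$. Its *entanglement rate* is $\limsup_{l\to\infty}\frac1l\log\frac{K_l}{L_l}$ and its *classical communication rate* is $\limsup_{l\to\infty}\frac1l\log D_l$. **Theorem (classical cost of $L$-merging).** For every finite non-empty set $\{\rho_{AB,i}\}_{i=1}^N$ of states on $\mathcal H_A\otimes\mathcal H_B$ and every $\delta>0$, the smallest classical communication rate of an $L$-merging protocol for this set with entanglement rate $$R_q=\max_{1\le i\le N}S(A|B,\rho_{AB,i})+\delta$$ is $$R_c=\max_{1\le i\le N}S(\rho_{A,i})+\max_{1\le i\le N}S(A|B,\rho_{AB,i})+\delta .$$ That is, every such protocol has classical communication rate at least $R_c$, and some such protocol has classical communication rate exactly $R_c$. -/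

import Mathlib

/-!
Finite-dimensional quantum systems are given by finite index types: the Hilbert space of a system
`X` is `ℂ^X`, operators on it are matrices `Matrix X X ℂ`, the tensor product of the spaces of `X`
and `Y` is the space of `X × Y`, and the `l`-fold tensor power of the space of `X` is the space of
`Fin l → X`.  All logarithms of the rates and entropies are to base two.
-/

namespace StateMerging

noncomputable section

open scoped ComplexOrder MatrixOrder Kronecker
open Filter Topology

/-! ### States, entropies, fidelity -/

/-- A state: a positive semidefinite operator of trace one. -/
def IsState {X : Type*} [Fintype X] (ρ : Matrix X X ℂ) : Prop :=
  ρ.PosSemidef ∧ ρ.trace = 1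

/-- The rank-one operator `|v⟩⟨v|`. -/
def pureState {X : Type*} (v : X → ℂ) : Matrix X X ℂ :=
  Matrix.vecMulVec v (star v)

/-- Partial trace over the second tensor factor. -/
def traceSnd {X Y : Type*} [Fintype Y] (ρ : Matrix (X × Y) (X × Y) ℂ) : Matrix X X ℂ :=
  Matrix.of fun x x' => ∑ y, ρ (x, y) (x', y)

/-- Partial trace over the first tensor factor. -/
def traceFst {X Y : Type*} [Fintype X] (ρ : Matrix (X × Y) (X × Y) ℂ) : Matrix Y Y ℂ :=
  Matrix.of fun y y' => ∑ x, ρ (x, y) (x, y')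

/-- The von Neumann entropy `S(ρ) = - tr (ρ log₂ ρ)`. -/
def entropy {X : Type*} [Fintype X] [DecidableEq X] (ρ : Matrix X X ℂ) : ℝ :=
  -(ρ * cfc (Real.logb 2) ρ).trace.re

/-- The conditional von Neumann entropy `S(A|B, ρ) = S(ρ_AB) - S(ρ_B)`. -/
def condEntropy {A B : Type*} [Fintype A] [DecidableEq A] [Fintype B] [DecidableEq B]
    (ρ : Matrix (A × B) (A × B) ℂ) : ℝ :=
  entropy ρ - entropy (traceFst ρ)

/-- The trace norm `‖X‖₁ = tr √(X* X)`. -/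
def traceNorm {X : Type*} [Fintype X] [DecidableEq X] (T : Matrix X X ℂ) : ℝ :=
  (CFC.sqrt (T.conjTranspose * T)).trace.re

/-- The fidelity `F(ρ, σ) = ‖√ρ √σ‖₁²`. -/
def fidelity {X : Type*} [Fintype X] [DecidableEq X] (ρ σ : Matrix X X ℂ) : ℝ :=
  traceNorm (CFC.sqrt ρ * CFC.sqrt σ) ^ 2

/-- The state vector `ψ` of `ABE` is a purification of the state `ρ` of `AB`. -/
def IsPurification {X E : Type*} [Fintype E] (ψ : X × E → ℂ) (ρ : Matrix X X ℂ) : Prop :=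
  traceSnd (pureState ψ) = ρ

/-- The maximally entangled state vector of Schmidt rank `n`. -/
def maxEnt (n : ℕ) : Fin n × Fin n → ℂ :=
  fun p => if p.1 = p.2 then (((Real.sqrt n)⁻¹ : ℝ) : ℂ) else 0

/-! ### Channels and one-way LOCC channels -/

/-- Linear maps from the operators on `X` to the operators on `Y`. -/
abbrev SuperOp (X Y : Type*) := Matrix X X ℂ →ₗ[ℂ] Matrix Y Y ℂ

/-- The map `Φ ⊗ id_E`. -/
def tensorId {X Y : Type*} (Φ : SuperOp X Y) (E : Type*) : SuperOp (X × E) (Y × E) where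
  toFun T := Matrix.of fun p q => Φ (Matrix.of fun x x' => T (x, p.2) (x', q.2)) p.1 q.1
  map_add' S T := by
    ext p q
    exact congrFun (congrFun (map_add Φ (Matrix.of fun x x' => S (x, p.2) (x', q.2))
      (Matrix.of fun x x' => T (x, p.2) (x', q.2))) p.1) q.1
  map_smul' c T := by
    ext p q
    exact congrFun (congrFun (map_smul Φ c (Matrix.of fun x x' => T (x, p.2) (x', q.2))) p.1) q.1

/-- The map `id_E ⊗ Φ`. -/
def idTensor {X Y : Type*} (E : Type*) (Φ : SuperOp X Y) : SuperOp (E × X) (E × Y) where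
  toFun T := Matrix.of fun p q => Φ (Matrix.of fun x x' => T (p.1, x) (q.1, x')) p.2 q.2
  map_add' S T := by
    ext p q
    exact congrFun (congrFun (map_add Φ (Matrix.of fun x x' => S (p.1, x) (q.1, x'))
      (Matrix.of fun x x' => T (p.1, x) (q.1, x'))) p.2) q.2
  map_smul' c T := by
    ext p q
    exact congrFun (congrFun (map_smul Φ c (Matrix.of fun x x' => T (p.1, x) (q.1, x'))) p.2) q.2

/-- The tensor product `Φ ⊗ Ψ` of two linear maps. -/
def tensor {A A' B B' : Type*} (Φ : SuperOp A A') (Ψ : SuperOp B B') :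
    SuperOp (A × B) (A' × B') :=
  (tensorId Φ B').comp (idTensor A Ψ)

/-- Complete positivity: `Φ ⊗ id_n` preserves positive semidefiniteness for every `n`. -/
def IsCP {X Y : Type*} (Φ : SuperOp X Y) : Prop :=
  ∀ (n : ℕ) (T : Matrix (X × Fin n) (X × Fin n) ℂ),
    T.PosSemidef → (tensorId Φ (Fin n) T).PosSemidef

/-- Trace preservation. -/
def IsTP {X Y : Type*} [Fintype X] [Fintype Y] (Φ : SuperOp X Y) : Prop :=
  ∀ T : Matrix X X ℂ, (Φ T).trace = T.trace

/-- A channel: a completely positive and trace preserving map. -/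
def IsChannel {X Y : Type*} [Fintype X] [Fintype Y] (Φ : SuperOp X Y) : Prop :=
  IsCP Φ ∧ IsTP Φ

/-- An instrument with `D` outcomes: completely positive maps whose sum is a channel. -/
def IsInstrument {X Y : Type*} [Fintype X] [Fintype Y] {D : ℕ} (𝒜 : Fin D → SuperOp X Y) : Prop :=
  (∀ k, IsCP (𝒜 k)) ∧ IsTP (∑ k, 𝒜 k)

/-- `M` is an `A → B` one-way LOCC channel in which `A` distinguishes `D` measurement outcomes, i.e.
it can be carried out with `D` different classical messages from `A` to `B`:
`M = ∑_{k=1}^D 𝒜_k ⊗ ℬ_k` with an instrument `𝒜` on `A`'s side and channels `ℬ_k` on `B`'s side. -/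
def IsOneWayLOCC {A A' B B' : Type*} [Fintype A] [Fintype A'] [Fintype B] [Fintype B']
    (D : ℕ) (M : SuperOp (A × B) (A' × B')) : Prop :=
  ∃ (𝒜 : Fin D → SuperOp A A') (ℬ : Fin D → SuperOp B B'),
    IsInstrument 𝒜 ∧ (∀ k, IsChannel (ℬ k)) ∧ M = ∑ k, tensor (𝒜 k) (ℬ k)

/-! ### L-mergings -/

/-- The operators of an `L`-instrument on `A`: with `D = ⌊d_A / L⌋`, a family `a_0, …, a_D` of
partial isometries into an `L`-dimensional space with pairwise orthogonal initial subspaces, where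
`a_1, …, a_D` have rank `L` and `a_0` has rank `d_A - L D < L`. -/
structure IsLInstrument {A : Type*} [Fintype A] (L : ℕ)
    (a : Fin (Fintype.card A / L + 1) → Matrix (Fin L) A ℂ) : Prop where
  partialIsometry : ∀ k, a k * (a k).conjTranspose * a k = a k
  orthogonal : ∀ j k, j ≠ k → a j * (a k).conjTranspose = 0
  rank_zero : (a 0).rank = Fintype.card A - L * (Fintype.card A / L)
  rank_eq : ∀ k, k ≠ 0 → (a k).rank = L

/-- An `L`-merging for states on `AB`: a map from the operators on `AB` to the operators on
`K_A ⊗ (K_B ⊗ H_{B'} ⊗ H_B)`, where `dim K_A = dim K_B = L` and the receiver's system `B'` is a copy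
of `A`, of the form `M(ρ) = ∑_{k=0}^D (a_k ⊗ u_k) ρ (a_k ⊗ u_k)*` with an `L`-instrument
`{a_k}` and isometries `u_k : H_B → K_B ⊗ H_{B'} ⊗ H_B`. -/
def IsLMerging {A B : Type*} [Fintype A] [DecidableEq A] [Fintype B] [DecidableEq B]
    (L : ℕ) (M : SuperOp (A × B) (Fin L × (Fin L × (A × B)))) : Prop :=
  0 < L ∧ L ≤ Fintype.card A ∧
  ∃ (a : Fin (Fintype.card A / L + 1) → Matrix (Fin L) A ℂ)
    (u : Fin (Fintype.card A / L + 1) → Matrix (Fin L × (A × B)) B ℂ),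
    IsLInstrument L a ∧
    (∀ k, (u k).conjTranspose * u k = 1) ∧
    ∀ ρ, M ρ = ∑ k, (a k ⊗ₖ u k) * ρ * (a k ⊗ₖ u k).conjTranspose

/-- The state vector `φ_L ⊗ ψ_{B'BE}`, where `φ_L` is maximally entangled between `A` and `B` and
`ψ_{B'BE}` is `ψ_{ABE}` with the `A`-part relocated to `B'`. -/
def targetVec {A B E : Type*} (L : ℕ) (ψ : (A × B) × E → ℂ) :
    (Fin L × (Fin L × (A × B))) × E → ℂ :=
  fun x => maxEnt L (x.1.1, x.1.2.1) * ψ (x.1.2.2, x.2)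

/-- The merging fidelity `F((M ⊗ id_E)(ψ_{ABE}), φ_L ⊗ ψ_{B'BE})`. -/
def mergingFidelity {A B E : Type*} [Fintype A] [DecidableEq A] [Fintype B] [DecidableEq B]
    [Fintype E] [DecidableEq E] (L : ℕ) (M : SuperOp (A × B) (Fin L × (Fin L × (A × B))))
    (ψ : (A × B) × E → ℂ) : ℝ :=
  fidelity (tensorId M E (pureState ψ)) (pureState (targetVec L ψ))

/-- The state vector `φ_K ⊗ ψ_{ABE}^{⊗ l}`: `l` copies of `ψ` together with a maximally entangled
state of Schmidt rank `K` shared by `A` and `B`, grouped as (system of `A`, system of `B`, `E^l`). -/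
def sourceVec {A B E : Type*} (K l : ℕ) (ψ : (A × B) × E → ℂ) :
    ((Fin K × (Fin l → A)) × (Fin K × (Fin l → B))) × (Fin l → E) → ℂ :=
  fun x => maxEnt K (x.1.1.1, x.1.2.1) * ∏ i, ψ ((x.1.1.2 i, x.1.2.2 i), x.2 i)

/-- A sequence of merging procedures for the states purified by `ψ i`, where `A` and `B` are
restricted to `L`-mergings together with additional pure input entanglement.  For block length `l`,
the procedure is an `L_l`-merging `M_l` for states on `(K_A ⊗ H_A^{⊗l}) ⊗ (K_B ⊗ H_B^{⊗l})`,
`dim K_A = dim K_B = K_l`, which is applied to `φ_{K_l} ⊗ ψ_i^{⊗l}` and in which `A` distinguishes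
`D_l` measurement outcomes; the Schmidt ranks grow at most exponentially, and the worst-case merging
fidelity converges to one. -/
structure IsLMergingProtocol {ι A B E : Type*} [Fintype A] [DecidableEq A] [Fintype B]
    [DecidableEq B] [Fintype E] [DecidableEq E] (ψ : ι → (A × B) × E → ℂ) (K L D : ℕ → ℕ)
    (M : ∀ l : ℕ, SuperOp ((Fin (K l) × (Fin l → A)) × (Fin (K l) × (Fin l → B)))
      (Fin (L l) × (Fin (L l) × ((Fin (K l) × (Fin l → A)) × (Fin (K l) × (Fin l → B)))))) :
    Prop where
  K_pos : ∀ l, 0 < l → 0 < K l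
  isLMerging : ∀ l, 0 < l → IsLMerging (L l) (M l)
  isOneWayLOCC : ∀ l, 0 < l → IsOneWayLOCC (D l) (M l)
  growth : ∃ C : ℝ, 0 < C ∧ ∀ l : ℕ, 0 < l →
    (K l : ℝ) ≤ 2 ^ ((l : ℝ) * C) ∧ (L l : ℝ) ≤ 2 ^ ((l : ℝ) * C)
  fidelity_tendsto :
    Tendsto (fun l => ⨅ i, mergingFidelity (L l) (M l) (sourceVec (K l) l (ψ i))) atTop (𝓝 1)

/-- The entanglement rate `limsup (1/l) log (K_l / L_l)`. -/
def entanglementRate (K L : ℕ → ℕ) : EReal :=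
  limsup (fun l : ℕ => ((1 / (l : ℝ) * Real.logb 2 ((K l : ℝ) / (L l : ℝ)) : ℝ) : EReal)) atTop

/-- The classical communication rate `limsup (1/l) log D_l`. -/
def classicalRate (D : ℕ → ℕ) : EReal :=
  limsup (fun l : ℕ => ((1 / (l : ℝ) * Real.logb 2 (D l : ℝ) : ℝ) : EReal)) atTop

end

end StateMerging

/-!
For `K`-dimensional input entanglement, an `L`-merging with `D` messages and the state `ψ^{⊗ l}`,
the figure of merit is `D L / K` compared with `2 ^ (l S(A))`.  Since the target is pure, the merging
fidelity of `∑ k, (a k ⊗ u k) · (a k ⊗ u k)*` is the sum of the squared amplitudes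
`⟨φ_L ⊗ ψ| a k ⊗ u k |ψ⟩`, and both halves of the theorem are estimates of such sums.

*Converse.*  If a merging is also of the form `∑ 𝒜 k ⊗ ℬ k`, then extremality of the maps
`T ↦ u T u*` among the channels forces each `u j`, up to a phase, to be the Kraus operator of one of
the `D` channels `ℬ k` (`exists_message`).  Hence the terms fall into `D` classes with a common `u`.
Within a class, the `a j` are orthogonal in the Hilbert–Schmidt inner product and have squared norm
at most `L`, so that Bessel's inequality bounds the class by `L` times the largest squared Schmidt
coefficient of the input between `A` and `BE`.  Up to a small part of the vector, this coefficient
is at most `2 ^ (-l (S(A) - ε)) / K`, by the asymptotic equipartition property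
(`IsState.exists_typicalSubspace`).  Thus the fidelity is at most about
`2 D L / K * 2 ^ (-l (S(A) - ε))` (`mergingFidelity_le`), and a protocol needs
`(1/l) log D ≥ (1/l) log (K / L) + S(A)` asymptotically (`le_classicalRate`), for each of the states.

*Achievability.*  Let `A` measure only within a subspace of dimension `n = K v` that contains the
typical subspaces of all the marginals at `A`, where `v` is at most about `2 ^ (l max S(A))`; this
takes `n / L + 1` messages, the last of which covers everything else.  The blocks of `L` vectors are
rows of a discrete Fourier transform of the subspace, with random phases on the columns and in a
random order.  On average they decouple `A` from `E` in the Hilbert–Schmidt norm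
(`sum_hsSq_scramble_le`), and the dimension of a typical subspace of `E` turns this into a bound in
trace norm of the order of `(L / K) * 2 ^ (l (S(AB) - S(B)))`, which vanishes when the entanglement
rate exceeds the conditional entropy.  A quantitative form of Uhlmann's theorem
(`exists_isometry_trace_ge`) then supplies `B`'s isometries.  For one merging to serve all the
states, the decoupling and Uhlmann's theorem are applied to a single vector whose components are the
given states, and whose label is kept together with `E` (`exists_merging_fidelity_ge`): the real
parts of the amplitudes of all the states then have a sum that is nearly as large as possible.  With
`K / L` of the order of `2 ^ (l (max S(A|B) + δ))`, the number of messages is of the order of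
`2 ^ (l (max S(A) + max S(A|B) + δ))`.
-/

namespace StateMerging

open scoped ComplexOrder MatrixOrder Kronecker
open Filter Topology Matrix

/-! ### The Hilbert–Schmidt norm and the operator norm -/

section HilbertSchmidt

variable {m n p : Type*} [Fintype m] [Fintype n] [Fintype p]

/-- The squared Hilbert–Schmidt norm of a rectangular matrix. -/
noncomputable def hsSq (M : Matrix m n ℂ) : ℝ := ∑ i, ∑ j, ‖M i j‖ ^ 2

lemma hsSq_nonneg (M : Matrix m n ℂ) : 0 ≤ hsSq M :=
  Finset.sum_nonneg fun _ _ => Finset.sum_nonneg fun _ _ => sq_nonneg _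

lemma hsSq_conjTranspose (M : Matrix m n ℂ) : hsSq Mᴴ = hsSq M := by
  unfold hsSq
  rw [Finset.sum_comm]
  simp [Matrix.conjTranspose_apply]

lemma trace_mul_conjTranspose_self (M : Matrix m n ℂ) : (M * Mᴴ).trace = (hsSq M : ℂ) := by
  simp only [Matrix.trace, Matrix.diag_apply, Matrix.mul_apply, Matrix.conjTranspose_apply, hsSq]
  push_cast
  refine Finset.sum_congr rfl fun i _ => Finset.sum_congr rfl fun j _ => ?_
  rw [RCLike.star_def, Complex.mul_conj, Complex.normSq_eq_norm_sq]
  push_cast; rfl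

lemma trace_conjTranspose_mul_self (M : Matrix m n ℂ) : (Mᴴ * M).trace = (hsSq M : ℂ) := by
  rw [Matrix.trace_mul_comm, trace_mul_conjTranspose_self]

lemma hsSq_smul (c : ℂ) (M : Matrix m n ℂ) : hsSq (c • M) = ‖c‖ ^ 2 * hsSq M := by
  simp [hsSq, mul_pow, Finset.mul_sum]

lemma norm_trace_conjTranspose_mul_sq_le (A B : Matrix m n ℂ) :
    ‖(Aᴴ * B).trace‖ ^ 2 ≤ hsSq A * hsSq B := by
  have h1 : ‖(Aᴴ * B).trace‖ ≤ ∑ q : n × m, ‖A q.2 q.1‖ * ‖B q.2 q.1‖ := by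
    simp only [Matrix.trace, Matrix.diag_apply, Matrix.mul_apply, Matrix.conjTranspose_apply]
    rw [← Finset.univ_product_univ, Finset.sum_product]
    refine (norm_sum_le _ _).trans (Finset.sum_le_sum fun i _ => (norm_sum_le _ _).trans ?_)
    exact Finset.sum_le_sum fun j _ => by simp
  have h2 := Finset.sum_mul_sq_le_sq_mul_sq Finset.univ (fun q : n × m => ‖A q.2 q.1‖)
    (fun q => ‖B q.2 q.1‖)
  have h3 : ∀ C : Matrix m n ℂ, ∑ q : n × m, ‖C q.2 q.1‖ ^ 2 = hsSq C := by
    intro C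
    rw [← Finset.univ_product_univ, Finset.sum_product, Finset.sum_comm]; rfl
  rw [h3, h3] at h2
  exact (pow_le_pow_left₀ (norm_nonneg _) h1 2).trans h2

lemma norm_trace_conjTranspose_mul_le (A B : Matrix m n ℂ) :
    ‖(Aᴴ * B).trace‖ ≤ √(hsSq A) * √(hsSq B) := by
  rw [← Real.sqrt_mul (hsSq_nonneg A)]
  exact Real.le_sqrt_of_sq_le (norm_trace_conjTranspose_mul_sq_le A B)

lemma norm_trace_mul_le (A : Matrix m n ℂ) (B : Matrix n m ℂ) :
    ‖(A * B).trace‖ ≤ √(hsSq A) * √(hsSq B) := by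
  have := norm_trace_conjTranspose_mul_le Aᴴ B
  rwa [Matrix.conjTranspose_conjTranspose, hsSq_conjTranspose] at this

lemma hsSq_add_le (A B : Matrix m n ℂ) : hsSq (A + B) ≤ 2 * hsSq A + 2 * hsSq B := by
  simp only [hsSq, Finset.mul_sum, ← Finset.sum_add_distrib]
  refine Finset.sum_le_sum fun i _ => Finset.sum_le_sum fun j _ => ?_
  have := norm_add_le (A i j) (B i j)
  rw [Matrix.add_apply]
  nlinarith [sq_nonneg (‖A i j‖ - ‖B i j‖), norm_nonneg (A i j + B i j)]

open scoped Matrix.Norms.L2Operator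

lemma hsSq_mul_le [DecidableEq n] (A : Matrix m n ℂ) (B : Matrix n p ℂ) :
    hsSq (A * B) ≤ ‖A‖ ^ 2 * hsSq B := by
  unfold hsSq
  rw [Finset.sum_comm, Finset.sum_comm (γ := n), Finset.mul_sum]
  refine Finset.sum_le_sum fun j _ => ?_
  have h := Matrix.l2_opNorm_mulVec A (WithLp.toLp 2 fun k => B k j)
  have h2 := pow_le_pow_left₀ (norm_nonneg _) h 2
  rw [mul_pow, EuclideanSpace.norm_sq_eq, EuclideanSpace.norm_sq_eq] at h2
  exact h2

lemma hsSq_mul_le' [DecidableEq n] [DecidableEq p] (A : Matrix m n ℂ) (B : Matrix n p ℂ) :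
    hsSq (A * B) ≤ hsSq A * ‖B‖ ^ 2 := by
  rw [← hsSq_conjTranspose, Matrix.conjTranspose_mul, ← hsSq_conjTranspose A,
    ← Matrix.l2_opNorm_conjTranspose B, mul_comm (hsSq _)]
  exact hsSq_mul_le _ _

lemma l2_opNorm_one_le [DecidableEq n] : ‖(1 : Matrix n n ℂ)‖ ≤ 1 := by
  rw [← Matrix.diagonal_one, Matrix.l2_opNorm_diagonal]
  exact (pi_norm_le_iff_of_nonneg zero_le_one).2 fun i => by simp

lemma l2_opNorm_le_one_of_isometry [DecidableEq n] {V : Matrix m n ℂ} (h : Vᴴ * V = 1) :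
    ‖V‖ ≤ 1 := by
  have h1 := Matrix.l2_opNorm_conjTranspose_mul_self V
  rw [h] at h1
  nlinarith [l2_opNorm_one_le (n := n), norm_nonneg V]

lemma l2_opNorm_le_one_of_proj [DecidableEq n] {V : Matrix m n ℂ}
    (h : Vᴴ * V * (Vᴴ * V) = Vᴴ * V) : ‖V‖ ≤ 1 := by
  have h1 := Matrix.l2_opNorm_conjTranspose_mul_self V
  have h2 := Matrix.l2_opNorm_conjTranspose_mul_self (Vᴴ * V)
  rw [Matrix.conjTranspose_mul, Matrix.conjTranspose_conjTranspose, h, h1] at h2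
  have h3 : ‖V‖ * ‖V‖ ≤ 1 := by
    by_contra hc
    push Not at hc
    nlinarith [norm_nonneg V]
  nlinarith [norm_nonneg V]

lemma hsSq_mul_le_of_contraction [DecidableEq n] {A : Matrix m n ℂ} (hA : ‖A‖ ≤ 1)
    (B : Matrix n p ℂ) : hsSq (A * B) ≤ hsSq B := by
  have := hsSq_mul_le A B
  have h2 : ‖A‖ ^ 2 ≤ 1 := pow_le_one₀ (norm_nonneg _) hA
  nlinarith [hsSq_nonneg B]

lemma hsSq_mul_le_of_contraction' [DecidableEq n] [DecidableEq p] (A : Matrix m n ℂ)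
    {B : Matrix n p ℂ} (hB : ‖B‖ ≤ 1) : hsSq (A * B) ≤ hsSq A := by
  have := hsSq_mul_le' A B
  have h2 : ‖B‖ ^ 2 ≤ 1 := pow_le_one₀ (norm_nonneg _) hB
  nlinarith [hsSq_nonneg A]

lemma hsSq_isometry_mul [DecidableEq n] {V : Matrix m n ℂ} (h : Vᴴ * V = 1) (B : Matrix n p ℂ) :
    hsSq (V * B) = hsSq B := by
  have : ((hsSq (V * B) : ℝ) : ℂ) = hsSq B := by
    rw [← trace_conjTranspose_mul_self, ← trace_conjTranspose_mul_self, Matrix.conjTranspose_mul,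
      Matrix.mul_assoc, ← Matrix.mul_assoc Vᴴ, h, Matrix.one_mul]
  exact_mod_cast this

lemma l2_opNorm_kronecker_one_le {q : Type*} [Fintype q] [DecidableEq n] [DecidableEq q]
    [DecidableEq m] (A : Matrix m n ℂ) : ‖A ⊗ₖ (1 : Matrix q q ℂ)‖ ≤ ‖A‖ := by
  rw [Matrix.l2_opNorm_def]
  refine ContinuousLinearMap.opNorm_le_bound _ (norm_nonneg _) fun x => ?_
  refine le_of_sq_le_sq ?_ (by positivity)
  let X : Matrix n q ℂ := Matrix.of fun i j => x (i, j)
  have h := hsSq_mul_le A X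
  have h1 : hsSq X = ‖x‖ ^ 2 := by
    rw [EuclideanSpace.norm_sq_eq, ← Finset.univ_product_univ, Finset.sum_product]; rfl
  rw [mul_pow, ← h1]
  refine le_trans (le_of_eq ?_) h
  rw [EuclideanSpace.norm_sq_eq, ← Finset.univ_product_univ, Finset.sum_product]
  refine Finset.sum_congr rfl fun i _ => Finset.sum_congr rfl fun j _ => ?_
  congr 2
  change ((A ⊗ₖ (1 : Matrix q q ℂ)) *ᵥ x.ofLp) (i, j) = _
  simp only [Matrix.mulVec, dotProduct, Matrix.kroneckerMap_apply, Matrix.mul_apply, X,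
    Matrix.of_apply]
  rw [← Finset.univ_product_univ, Finset.sum_product]
  refine Finset.sum_congr rfl fun k _ => ?_
  simp [Matrix.one_apply]

lemma l2_opNorm_one_kronecker_le {q : Type*} [Fintype q] [DecidableEq n] [DecidableEq q]
    [DecidableEq m] (A : Matrix m n ℂ) : ‖(1 : Matrix q q ℂ) ⊗ₖ A‖ ≤ ‖A‖ := by
  rw [Matrix.l2_opNorm_def]
  refine ContinuousLinearMap.opNorm_le_bound _ (norm_nonneg _) fun x => ?_
  refine le_of_sq_le_sq ?_ (by positivity)
  let X : Matrix n q ℂ := Matrix.of fun i j => x (j, i)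
  have h := hsSq_mul_le A X
  have h1 : hsSq X = ‖x‖ ^ 2 := by
    rw [EuclideanSpace.norm_sq_eq, ← Finset.univ_product_univ, Finset.sum_product_right]; rfl
  rw [mul_pow, ← h1]
  refine le_trans (le_of_eq ?_) h
  rw [EuclideanSpace.norm_sq_eq, ← Finset.univ_product_univ, Finset.sum_product_right]
  refine Finset.sum_congr rfl fun i _ => Finset.sum_congr rfl fun j _ => ?_
  congr 2
  change (((1 : Matrix q q ℂ) ⊗ₖ A) *ᵥ x.ofLp) (j, i) = _
  simp only [Matrix.mulVec, dotProduct, Matrix.kroneckerMap_apply, Matrix.mul_apply, X,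
    Matrix.of_apply]
  rw [← Finset.univ_product_univ, Finset.sum_product_right]
  refine Finset.sum_congr rfl fun k _ => ?_
  simp [Matrix.one_apply]

end HilbertSchmidt

/-! ### Merging fidelity as a sum of squared amplitudes -/

section Fidelity

variable {X Y E : Type*}

/-- The coefficient matrix of a vector of a bipartite system. -/
def toMat (v : X × E → ℂ) : Matrix X E ℂ := Matrix.of fun x e => v (x, e)

lemma trace_pureState [Fintype X] (v : X → ℂ) :
    (pureState v).trace = ((∑ x, ‖v x‖ ^ 2 : ℝ) : ℂ) := by
  simp only [Matrix.trace, Matrix.diag_apply, pureState, Matrix.vecMulVec_apply]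
  push_cast
  refine Finset.sum_congr rfl fun x _ => ?_
  rw [Pi.star_apply, RCLike.star_def, Complex.mul_conj, Complex.normSq_eq_norm_sq]
  push_cast; rfl

lemma posSemidef_pureState [Finite X] (v : X → ℂ) : (pureState v).PosSemidef :=
  Matrix.posSemidef_vecMulVec_self_star v

lemma pureState_mul_pureState [Fintype X] (t : X → ℂ) (ht : star t ⬝ᵥ t = 1) :
    pureState t * pureState t = pureState t := by
  rw [pureState, Matrix.vecMulVec_mul_vecMulVec, ht, one_smul]

/-- The fidelity with a pure state is the expectation of the corresponding projector. -/
lemma fidelity_pureState [Fintype X] [DecidableEq X] {ρ : Matrix X X ℂ} (hρ : ρ.PosSemidef)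
    {t : X → ℂ} (ht : star t ⬝ᵥ t = 1) :
    fidelity ρ (pureState t) = (star t ⬝ᵥ ρ *ᵥ t).re := by
  have hs : CFC.sqrt (pureState t) = pureState t :=
    CFC.sqrt_unique (pureState_mul_pureState t ht)
      (Matrix.nonneg_iff_posSemidef.2 (posSemidef_pureState t))
  have hρ0 : (0 : Matrix X X ℂ) ≤ ρ := Matrix.nonneg_iff_posSemidef.2 hρ
  set c : ℂ := star t ⬝ᵥ ρ *ᵥ t with hc
  have hc0 : 0 ≤ c := hρ.dotProduct_mulVec_nonneg t
  have hcre : c = (c.re : ℂ) := by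
    rw [Complex.nonneg_iff] at hc0
    exact Complex.ext rfl (by simp [← hc0.2])
  have hcre0 : 0 ≤ c.re := (Complex.nonneg_iff.1 hc0).1
  have hmid : (CFC.sqrt ρ * pureState t)ᴴ * (CFC.sqrt ρ * pureState t)
      = ((√c.re : ℝ) : ℂ) • pureState t * (((√c.re : ℝ) : ℂ) • pureState t) := by
    have hsa : (CFC.sqrt ρ)ᴴ = CFC.sqrt ρ :=
      (Matrix.nonneg_iff_posSemidef.1 (CFC.sqrt_nonneg ρ)).isHermitian
    rw [Matrix.conjTranspose_mul, hsa, (posSemidef_pureState t).isHermitian.eq,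
      Matrix.mul_assoc, ← Matrix.mul_assoc (CFC.sqrt ρ), CFC.sqrt_mul_sqrt_self ρ hρ0,
      Matrix.smul_mul, Matrix.mul_smul, smul_smul, pureState_mul_pureState t ht,
      ← Complex.ofReal_mul, Real.mul_self_sqrt hcre0, ← hcre]
    rw [pureState, Matrix.mul_vecMulVec, Matrix.vecMulVec_mul_vecMulVec, ← hc]
    ext i j
    simp [Matrix.vecMulVec_apply]
    ring
  have hpos : (0 : Matrix X X ℂ) ≤ ((√c.re : ℝ) : ℂ) • pureState t := by
    refine Matrix.nonneg_iff_posSemidef.2 ((posSemidef_pureState t).smul ?_)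
    exact_mod_cast Real.sqrt_nonneg _
  unfold fidelity traceNorm
  rw [hs, hmid, CFC.sqrt_mul_self _ hpos, Matrix.trace_smul]
  have htr : (pureState t).trace = 1 := by
    rw [pureState, Matrix.trace_vecMulVec, dotProduct_comm, ht]
  rw [htr, smul_eq_mul, mul_one, Complex.ofReal_re, Real.sq_sqrt hcre0]

/-- The map `T ↦ V T V*`. -/
noncomputable def conjMap [Fintype X] (V : Matrix Y X ℂ) : SuperOp X Y where
  toFun T := V * T * Vᴴ
  map_add' S T := by rw [Matrix.mul_add, Matrix.add_mul]
  map_smul' c T := by simp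

lemma conjMap_apply [Fintype X] (V : Matrix Y X ℂ) (T : Matrix X X ℂ) :
    conjMap V T = V * T * Vᴴ := rfl

lemma tensorId_sum {κ : Type*} (s : Finset κ) (Φ : κ → SuperOp X Y) (T : Matrix (X × E) (X × E) ℂ) :
    tensorId (∑ k ∈ s, Φ k) E T = ∑ k ∈ s, tensorId (Φ k) E T := by
  ext p q
  simp [tensorId, Matrix.sum_apply]

lemma tensorId_conjMap [Fintype X] [Fintype E] [DecidableEq E] (V : Matrix Y X ℂ)
    (T : Matrix (X × E) (X × E) ℂ) :
    tensorId (conjMap V) E T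
      = (V ⊗ₖ (1 : Matrix E E ℂ)) * T * (V ⊗ₖ (1 : Matrix E E ℂ))ᴴ := by
  ext p q
  simp only [tensorId, conjMap, LinearMap.coe_mk, AddHom.coe_mk, Matrix.of_apply, Matrix.mul_apply,
    Matrix.conjTranspose_apply, Matrix.kroneckerMap_apply, Fintype.sum_prod_type,
    Matrix.one_apply]
  simp [apply_ite (starRingEnd ℂ)]

lemma kronecker_one_mul_pureState [Fintype X] [Fintype E] [DecidableEq E] (V : Matrix Y X ℂ)
    (ψ : X × E → ℂ) :
    (V ⊗ₖ (1 : Matrix E E ℂ)) * pureState ψ * (V ⊗ₖ (1 : Matrix E E ℂ))ᴴ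
      = pureState (fun p => (V * toMat ψ) p.1 p.2) := by
  have h : (V ⊗ₖ (1 : Matrix E E ℂ)) *ᵥ ψ = fun p => (V * toMat ψ) p.1 p.2 := by
    ext p
    simp [Matrix.mulVec, dotProduct, Matrix.mul_apply, Fintype.sum_prod_type, Matrix.one_apply,
      toMat]
  rw [pureState, Matrix.mul_vecMulVec, Matrix.vecMulVec_mul, ← Matrix.star_mulVec, h]
  rfl

/-- The amplitude `⟨φ| V ⊗ 1 |ψ⟩`. -/
noncomputable def amplitude [Fintype X] [Fintype Y] [Fintype E] (V : Matrix Y X ℂ) (ψ : X × E → ℂ)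
    (φ : Y × E → ℂ) : ℂ := ((toMat φ)ᴴ * (V * toMat ψ)).trace

lemma star_dotProduct_pureState [Fintype X] (t v : X → ℂ) :
    star t ⬝ᵥ pureState v *ᵥ t = ((‖star t ⬝ᵥ v‖ ^ 2 : ℝ) : ℂ) := by
  rw [pureState, Matrix.vecMulVec_mulVec]
  have : star v ⬝ᵥ t = star (star t ⬝ᵥ v) := by
    rw [Matrix.star_dotProduct]
  rw [this]
  simp only [dotProduct_smul, MulOpposite.smul_eq_mul_unop, MulOpposite.unop_op]
  rw [RCLike.star_def, Complex.mul_conj, Complex.normSq_eq_norm_sq]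

lemma amplitude_eq_dotProduct [Fintype X] [Fintype Y] [Fintype E] (V : Matrix Y X ℂ)
    (ψ : X × E → ℂ) (φ : Y × E → ℂ) :
    amplitude V ψ φ = star φ ⬝ᵥ fun p : Y × E => (V * toMat ψ) p.1 p.2 := by
  simp only [amplitude, Matrix.trace, Matrix.diag_apply, dotProduct, Fintype.sum_prod_type,
    Matrix.mul_apply (M := (toMat φ)ᴴ), Matrix.conjTranspose_apply]
  rw [Finset.sum_comm]
  rfl

lemma hsSq_toMat [Fintype X] [Fintype E] (v : X × E → ℂ) :
    hsSq (toMat v) = ∑ x, ‖v x‖ ^ 2 := by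
  rw [Fintype.sum_prod_type]; rfl

lemma star_dotProduct_self [Fintype X] (v : X → ℂ) :
    star v ⬝ᵥ v = ((∑ x, ‖v x‖ ^ 2 : ℝ) : ℂ) := by
  rw [← trace_pureState, pureState, Matrix.trace_vecMulVec, dotProduct_comm]

lemma fidelity_sum_conjMap [Fintype X] [Fintype Y] [DecidableEq Y] [Fintype E] [DecidableEq E]
    {κ : Type*} [Fintype κ] (V : κ → Matrix Y X ℂ) (ψ : X × E → ℂ) {φ : Y × E → ℂ}
    (hφ : ∑ x, ‖φ x‖ ^ 2 = 1) :
    fidelity (tensorId (∑ k, conjMap (V k)) E (pureState ψ)) (pureState φ)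
      = ∑ k, ‖amplitude (V k) ψ φ‖ ^ 2 := by
  have h : tensorId (∑ k, conjMap (V k)) E (pureState ψ)
      = ∑ k, pureState (fun p => (V k * toMat ψ) p.1 p.2) := by
    rw [tensorId_sum]
    exact Finset.sum_congr rfl fun k _ => by
      rw [tensorId_conjMap, kronecker_one_mul_pureState]
  rw [h, fidelity_pureState (Matrix.posSemidef_sum _ fun k _ => posSemidef_pureState _)
    (by rw [star_dotProduct_self, hφ]; norm_num)]
  rw [Matrix.sum_mulVec, dotProduct_sum, Complex.re_sum]
  refine Finset.sum_congr rfl fun k _ => ?_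
  rw [star_dotProduct_pureState, Complex.ofReal_re, amplitude_eq_dotProduct]

end Fidelity

section Target

variable {A B E : Type*} [Fintype A] [Fintype B] [Fintype E]

lemma sum_sq_maxEnt {n : ℕ} (hn : 0 < n) : ∑ p, ‖maxEnt n p‖ ^ 2 = 1 := by
  rw [Fintype.sum_prod_type]
  have : ∀ x y : Fin n, ‖maxEnt n (x, y)‖ ^ 2 = if x = y then (n : ℝ)⁻¹ else 0 := by
    intro x y
    unfold maxEnt
    split_ifs
    · rw [Complex.norm_real, Real.norm_eq_abs, sq_abs, inv_pow, Real.sq_sqrt (Nat.cast_nonneg n)]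
    · simp
  simp [this]
  field_simp

lemma sum_sq_targetVec {L : ℕ} (hL : 0 < L) (ψ : (A × B) × E → ℂ) :
    ∑ x, ‖targetVec L ψ x‖ ^ 2 = ∑ x, ‖ψ x‖ ^ 2 := by
  have h : ∀ x, ‖targetVec L ψ x‖ ^ 2 = ‖maxEnt L (x.1.1, x.1.2.1)‖ ^ 2 * ‖ψ (x.1.2.2, x.2)‖ ^ 2 := by
    intro x; rw [targetVec, norm_mul, mul_pow]
  simp_rw [h]
  let e : (Fin L × (Fin L × (A × B))) × E ≃ (Fin L × Fin L) × ((A × B) × E) :=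
    { toFun := fun x => ((x.1.1, x.1.2.1), (x.1.2.2, x.2))
      invFun := fun y => ((y.1.1, (y.1.2, y.2.1)), y.2.2)
      left_inv := fun _ => rfl
      right_inv := fun _ => rfl }
  rw [← e.symm.sum_comp, Fintype.sum_prod_type]
  simp only [e, Equiv.coe_fn_symm_mk]
  simp_rw [← Finset.mul_sum]
  rw [← Finset.sum_mul, sum_sq_maxEnt hL, one_mul]

lemma mergingFidelity_eq [DecidableEq A] [DecidableEq B] [DecidableEq E] {L : ℕ} (hL : 0 < L)
    {κ : Type*} [Fintype κ] (a : κ → Matrix (Fin L) A ℂ) (u : κ → Matrix (Fin L × (A × B)) B ℂ)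
    {ψ : (A × B) × E → ℂ} (hψ : ∑ x, ‖ψ x‖ ^ 2 = 1) :
    mergingFidelity L (∑ k, conjMap (a k ⊗ₖ u k)) ψ
      = ∑ k, ‖amplitude (a k ⊗ₖ u k) ψ (targetVec L ψ)‖ ^ 2 :=
  fidelity_sum_conjMap _ ψ (by rw [sum_sq_targetVec hL, hψ])

end Target

/-! ### Messages determine the decoding isometries -/

section Messages

variable {A A' B B' : Type*}

lemma IsCP.posSemidef {X Y : Type*} {Φ : SuperOp X Y} (h : IsCP Φ) {T : Matrix X X ℂ}
    (hT : T.PosSemidef) : (Φ T).PosSemidef :=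
  (h 1 (T.submatrix Prod.fst Prod.fst) (hT.submatrix _)).submatrix fun y => (y, 0)

lemma tensor_kronecker (Φ : SuperOp A A') (Ψ : SuperOp B B') (X : Matrix A A ℂ)
    (Y : Matrix B B ℂ) : tensor Φ Ψ (X ⊗ₖ Y) = Φ X ⊗ₖ Ψ Y := by
  ext p q
  have h1 : ∀ a a' : A, (Ψ (Matrix.of fun y y' => (X ⊗ₖ Y) (a, y) (a', y'))) = X a a' • Ψ Y := by
    intro a a'
    rw [← map_smul]
    rfl
  have h2 : (Matrix.of fun a a' : A =>
      (Ψ (Matrix.of fun y y' => (X ⊗ₖ Y) (a, y) (a', y'))) p.2 q.2) = Ψ Y p.2 q.2 • X := by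
    ext a a'
    rw [Matrix.of_apply, h1]
    simp [mul_comm]
  change Φ (Matrix.of fun a a' : A =>
      (Ψ (Matrix.of fun y y' => (X ⊗ₖ Y) (a, y) (a', y'))) p.2 q.2) p.1 q.1 = _
  rw [h2, map_smul]
  simp [mul_comm]

lemma traceFst_kronecker [Fintype A] (X : Matrix A A ℂ) (Y : Matrix B B ℂ) :
    traceFst (X ⊗ₖ Y) = X.trace • Y := by
  ext i j
  simp [traceFst, Matrix.trace, Finset.sum_mul]

/-- Pure states span the space of all operators, by polarization. -/
lemma superOp_ext_pureState [Fintype B] [DecidableEq B] {Φ Ψ : SuperOp B B'}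
    (h : ∀ y, Φ (pureState y) = Ψ (pureState y)) : Φ = Ψ := by
  have key : ∀ x y : B → ℂ, Φ (Matrix.vecMulVec x (star y)) = Ψ (Matrix.vecMulVec x (star y)) := by
    intro x y
    have e : Matrix.vecMulVec x (star y) = (1 / 2 : ℂ) •
        ((pureState (x + y) - pureState x - pureState y)
          + Complex.I • (pureState (x + Complex.I • y) - pureState x - pureState y)) := by
      ext i j
      simp [pureState, Matrix.vecMulVec_apply]
      linear_combination (x i * (starRingEnd ℂ) (y j) - y i * starRingEnd ℂ (x j)
        + Complex.I * y i * starRingEnd ℂ (y j)) * (1 / 2 : ℂ) * Complex.I_sq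
    rw [e]
    simp only [map_smul, map_add, map_sub, h]
  refine Matrix.ext_linearMap ℂ fun i j => LinearMap.ext fun c => ?_
  have := key (c • Pi.single i 1) (Pi.single j 1)
  have e : Matrix.vecMulVec (c • Pi.single i (1 : ℂ)) (star (Pi.single j 1)) = Matrix.single i j c := by
    ext k l
    simp [Matrix.vecMulVec_apply, Matrix.single_apply, Pi.single_apply]
    aesop
  rw [e] at this
  exact this

/-- A positive operator dominated by a multiple of a rank-one projector is a multiple of it. -/
lemma eq_smul_pureState_of_le [Fintype B] [DecidableEq B] {R : Matrix B B ℂ} (hR : R.PosSemidef)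
    {c : ℂ} {v : B → ℂ}
    (h : (c • pureState v - R).PosSemidef) : ∃ s : ℂ, R = s • pureState v := by
  have hker : ∀ x : B → ℂ, star v ⬝ᵥ x = 0 → R *ᵥ x = 0 := by
    intro x hx
    rw [← hR.dotProduct_mulVec_zero_iff]
    have h1 := h.dotProduct_mulVec_nonneg x
    have h2 := hR.dotProduct_mulVec_nonneg x
    rw [Matrix.sub_mulVec, Matrix.smul_mulVec, pureState, Matrix.vecMulVec_mulVec, hx] at h1
    simp only [MulOpposite.op_zero, zero_smul, smul_zero, zero_sub, dotProduct_neg] at h1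
    exact le_antisymm (neg_nonneg.1 h1) h2
  by_cases hv : v = 0
  · refine ⟨0, ?_⟩
    subst hv
    rw [zero_smul]
    ext i j
    have := congrFun (hker (Pi.single j 1) (by simp)) i
    simpa using this
  have hn : star v ⬝ᵥ v ≠ 0 := fun h0 => hv (dotProduct_star_self_eq_zero.1 h0)
  set n := star v ⬝ᵥ v with hn'
  have hRx : ∀ i j, R i j = n⁻¹ * star (v j) * (R *ᵥ v) i := by
    intro i j
    have h0 := hker (Pi.single j 1 - (n⁻¹ * star (v j)) • v) (by
      rw [dotProduct_sub, dotProduct_smul, ← hn']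
      simp
      field_simp
      simp)
    rw [Matrix.mulVec_sub, Matrix.mulVec_smul, sub_eq_zero] at h0
    have := congrFun h0 i
    simpa using this
  have hvR : ∀ i, (R *ᵥ v) i = n⁻¹ * (star (R *ᵥ v) ⬝ᵥ v) * v i * star n * star n⁻¹ := by
    intro i
    have hstar : star n = n := (Matrix.star_dotProduct v v).symm
    rw [star_inv₀, hstar]
    have : ∀ j, R i j = n⁻¹ * v i * star ((R *ᵥ v) j) := by
      intro j
      have h3 := congrFun (congrFun hR.isHermitian i) j
      rw [Matrix.conjTranspose_apply, hRx j i] at h3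
      rw [← h3, star_mul', star_mul', star_star, star_inv₀, hstar]
    conv_lhs => rw [Matrix.mulVec, dotProduct]
    simp_rw [this]
    simp only [dotProduct, Pi.star_apply, Finset.mul_sum, Finset.sum_mul]
    refine Finset.sum_congr rfl fun j _ => ?_
    field_simp
  refine ⟨n⁻¹ * n⁻¹ * (star (R *ᵥ v) ⬝ᵥ v) * star n * star n⁻¹, ?_⟩
  ext i j
  rw [hRx, hvR]
  simp [pureState, Matrix.vecMulVec_apply]
  ring

lemma mul_pureState_mul_conjTranspose [Fintype B] (u : Matrix B' B ℂ) (y : B → ℂ) :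
    u * pureState y * uᴴ = pureState (u *ᵥ y) := by
  rw [pureState, Matrix.mul_vecMulVec, Matrix.vecMulVec_mul, ← Matrix.star_mulVec]
  rfl

/-- A conjugation by an isometry is an extreme channel: a channel that occurs with positive weight in
a positive combination equal to it coincides with it. -/
lemma channel_eq_conjMap_of_combination [Fintype B] [Fintype B'] [DecidableEq B] [DecidableEq B']
    {κ : Type*} [Fintype κ] {ℬ : κ → SuperOp B B'} (hℬ : ∀ k, IsChannel (ℬ k)) {u : Matrix B' B ℂ}
    (hu : uᴴ * u = 1) {w : κ → ℂ} (hw : ∀ k, 0 ≤ w k) {c : ℂ}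
    (h : ∀ Y, ∑ k, w k • ℬ k Y = c • (u * Y * uᴴ)) {k : κ} (hk : w k ≠ 0) :
    ℬ k = conjMap u := by
  classical
  refine superOp_ext_pureState fun y => ?_
  have hpos : (ℬ k (pureState y)).PosSemidef := (hℬ k).1.posSemidef (posSemidef_pureState y)
  have h1 := h (pureState y)
  rw [mul_pureState_mul_conjTranspose, ← Finset.add_sum_erase _ _ (Finset.mem_univ k)] at h1
  have h2 : (((w k)⁻¹ * c) • pureState (u *ᵥ y) - ℬ k (pureState y)).PosSemidef := by
    have : ((w k)⁻¹ * c) • pureState (u *ᵥ y) - ℬ k (pureState y)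
        = (w k)⁻¹ • ∑ x ∈ Finset.univ.erase k, w x • ℬ x (pureState y) := by
      rw [mul_smul, ← h1, smul_add, smul_smul, inv_mul_cancel₀ hk, one_smul, add_sub_cancel_left]
    rw [this]
    refine Matrix.PosSemidef.smul (Matrix.posSemidef_sum _ fun x _ => ?_) (inv_nonneg.2 (hw k))
    exact ((hℬ x).1.posSemidef (posSemidef_pureState y)).smul (hw x)
  obtain ⟨s, hs⟩ := eq_smul_pureState_of_le hpos h2
  have htr := (hℬ k).2 (pureState y)
  have htr2 : (pureState (u *ᵥ y)).trace = (pureState y).trace := by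
    rw [← mul_pureState_mul_conjTranspose, Matrix.trace_mul_comm, ← Matrix.mul_assoc, hu,
      Matrix.one_mul]
  rw [conjMap_apply, mul_pureState_mul_conjTranspose, hs]
  rw [hs, Matrix.trace_smul, htr2, smul_eq_mul] at htr
  by_cases h0 : (pureState y).trace = 0
  · have hz : pureState (u *ᵥ y) = 0 := by
      rw [← (posSemidef_pureState _).trace_eq_zero_iff, htr2, h0]
    rw [hz, smul_zero]
  · have : s = 1 := by
      field_simp at htr
      exact htr
    rw [this, one_smul]

lemma exists_phase_of_conjMap_eq [Fintype B] [Fintype B'] [Nonempty B] {u v : Matrix B' B ℂ}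
    [DecidableEq B]
    (hu : uᴴ * u = 1) (h : conjMap u = conjMap v) : ∃ θ : ℂ, ‖θ‖ = 1 ∧ u = θ • v := by
  have hent : ∀ x b x' b', u x b * star (u x' b') = v x b * star (v x' b') := by
    intro x b x' b'
    have := congrFun (congrFun (LinearMap.congr_fun h (Matrix.single b b' 1)) x) x'
    simpa [conjMap_apply, Matrix.mul_apply, Matrix.single_apply, Finset.sum_ite, 
      Finset.filter_eq, ite_and, Finset.sum_ite_eq] using this
  have hex : ∃ x b, u x b ≠ 0 := by
    by_contra hc
    push Not at hc
    obtain ⟨b⟩ := ‹Nonempty B›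
    have := congrFun (congrFun hu b) b
    simp [Matrix.mul_apply, hc] at this
  obtain ⟨x, b, hxb⟩ := hex
  have hsq : ‖u x b‖ = ‖v x b‖ := by
    have := congrArg norm (hent x b x b)
    rw [norm_mul, norm_mul, norm_star, norm_star] at this
    nlinarith [norm_nonneg (u x b), norm_nonneg (v x b), norm_pos_iff.2 hxb]
  have hs : star (u x b) ≠ 0 := by simpa using hxb
  refine ⟨star (v x b) / star (u x b), ?_, ?_⟩
  · rw [norm_div, norm_star, norm_star, hsq, div_self]
    rw [← hsq]; exact norm_ne_zero_iff.2 hxb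
  · ext x' b'
    have := hent x' b' x b
    rw [Matrix.smul_apply, smul_eq_mul]
    field_simp
    linear_combination this

lemma exists_message [Fintype A] [Fintype A'] [Fintype B] [Fintype B'] [DecidableEq B] [Nonempty B]
    [DecidableEq B'] {κ : Type*} [Fintype κ]
    {a : κ → Matrix A' A ℂ} {u : κ → Matrix B' B ℂ}
    (hort : ∀ j k, j ≠ k → a j * (a k)ᴴ = 0)
    (hiso : ∀ k, a k * (a k)ᴴ * a k = a k)
    (hu : ∀ k, (u k)ᴴ * u k = 1) {D : ℕ} {𝒜 : Fin D → SuperOp A A'} {ℬ : Fin D → SuperOp B B'}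
    (h𝒜 : IsInstrument 𝒜) (hℬ : ∀ k, IsChannel (ℬ k)) {M : SuperOp (A × B) (A' × B')}
    (hM : ∀ ρ, M ρ = ∑ k, (a k ⊗ₖ u k) * ρ * (a k ⊗ₖ u k)ᴴ)
    (hM' : M = ∑ k, tensor (𝒜 k) (ℬ k)) (j : κ) (hj : a j ≠ 0) :
    ∃ k, ℬ k = conjMap (u j) := by
  classical
  have hX : ((a j)ᴴ * a j).PosSemidef := Matrix.posSemidef_conjTranspose_mul_self _
  have h1 : ∀ Y, ∑ k, (𝒜 k ((a j)ᴴ * a j)).trace • ℬ k Y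
      = (hsSq (a j) : ℂ) • (u j * Y * (u j)ᴴ) := by
    intro Y
    have e1 : M (((a j)ᴴ * a j) ⊗ₖ Y)
        = (a j * (a j)ᴴ) ⊗ₖ (u j * Y * (u j)ᴴ) := by
      rw [hM, Finset.sum_eq_single j]
      · rw [Matrix.conjTranspose_kronecker, ← Matrix.mul_kronecker_mul, ← Matrix.mul_kronecker_mul,
          ← Matrix.mul_assoc, hiso]
      · intro k _ hk
        rw [Matrix.conjTranspose_kronecker, ← Matrix.mul_kronecker_mul, ← Matrix.mul_kronecker_mul,
          ← Matrix.mul_assoc (a k), hort k j hk]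
        simp
      · simp
    have e2 := congrArg traceFst e1
    rw [hM', traceFst_kronecker, trace_mul_conjTranspose_self] at e2
    rw [← e2]
    ext p q
    simp only [LinearMap.sum_apply, tensor_kronecker, Matrix.sum_apply, traceFst, Matrix.of_apply,
      Matrix.smul_apply, Matrix.kroneckerMap_apply, smul_eq_mul]
    rw [Finset.sum_comm]
    refine Finset.sum_congr rfl fun k _ => ?_
    rw [Matrix.trace, Finset.sum_mul]; rfl
  have hpos : ∀ k, 0 ≤ (𝒜 k ((a j)ᴴ * a j)).trace := fun k =>
    ((h𝒜.1 k).posSemidef hX).trace_nonneg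
  have hex : ∃ k, (𝒜 k ((a j)ᴴ * a j)).trace ≠ 0 := by
    by_contra hc
    push Not at hc
    have := h1 1
    simp only [hc, zero_smul, Finset.sum_const_zero, Matrix.mul_one] at this
    have h3 := congrArg Matrix.trace this
    rw [Matrix.trace_smul, Matrix.trace_mul_comm, hu, Matrix.trace_one, Matrix.trace_zero,
      smul_eq_mul, eq_comm, mul_eq_zero] at h3
    rcases h3 with h3 | h3
    · refine hj ?_
      rw [← Matrix.trace_mul_conjTranspose_self_eq_zero_iff, trace_mul_conjTranspose_self, h3]
    · simp at h3
  obtain ⟨k, hk⟩ := hex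
  exact ⟨k, channel_eq_conjMap_of_combination hℬ (hu j) hpos h1 hk⟩

end Messages

/-! ### The one-shot converse bound -/

section Converse

open scoped Matrix.Norms.L2Operator

/-- The coefficient matrix of a vector of a tripartite system for the cut `A | BE`. -/
def toMatA {A B E : Type*} (ψ : (A × B) × E → ℂ) : Matrix A (B × E) ℂ :=
  Matrix.of fun a p => ψ ((a, p.1), p.2)

/-- Bessel's inequality for the Hilbert–Schmidt inner product. -/
lemma sum_sq_trace_mul_le {A A' κ : Type*} [Fintype A] [Fintype A']
    (s : Finset κ) {a : κ → Matrix A' A ℂ} (hort : ∀ j k, j ≠ k → a j * (a k)ᴴ = 0) {L : ℝ}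
    (hL0 : 0 ≤ L)
    (hL : ∀ k, hsSq (a k) ≤ L) (R : Matrix A A' ℂ) :
    ∑ j ∈ s, ‖(a j * R).trace‖ ^ 2 ≤ L * hsSq R := by
  classical
  set g : κ → ℂ := fun j => (a j * R).trace with hg
  set S := ∑ j ∈ s, ‖g j‖ ^ 2 with hS
  have hS0 : 0 ≤ S := Finset.sum_nonneg fun _ _ => sq_nonneg _
  set Z : Matrix A' A ℂ := ∑ j ∈ s, star (g j) • a j with hZ
  have hZR : (Z * R).trace = (S : ℂ) := by
    rw [hZ, Matrix.sum_mul, Matrix.trace_sum, hS]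
    push_cast
    refine Finset.sum_congr rfl fun j _ => ?_
    rw [Matrix.smul_mul, Matrix.trace_smul, smul_eq_mul, RCLike.star_def, mul_comm]
    change g j * _ = _
    rw [Complex.mul_conj, Complex.normSq_eq_norm_sq]
    push_cast; rfl
  have hZZ : hsSq Z ≤ L * S := by
    have : ((hsSq Z : ℝ) : ℂ) = ((∑ j ∈ s, ‖g j‖ ^ 2 * hsSq (a j) : ℝ) : ℂ) := by
      rw [← trace_mul_conjTranspose_self, hZ, Matrix.sum_mul, Matrix.trace_sum]
      push_cast
      refine Finset.sum_congr rfl fun j hj => ?_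
      rw [Matrix.conjTranspose_sum, Matrix.mul_sum, Finset.sum_eq_single j]
      · rw [Matrix.conjTranspose_smul, Matrix.smul_mul, Matrix.mul_smul, smul_smul,
          Matrix.trace_smul, trace_mul_conjTranspose_self, smul_eq_mul, star_star, RCLike.star_def,
          mul_comm (starRingEnd ℂ (g j)) (g j), Complex.mul_conj, Complex.normSq_eq_norm_sq]
        push_cast; rfl
      · intro k _ hk
        rw [Matrix.conjTranspose_smul, Matrix.smul_mul, Matrix.mul_smul, hort j k hk.symm]
        simp
      · exact fun h => absurd hj h
    rw [Complex.ofReal_inj.1 this, hS, Finset.mul_sum]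
    exact Finset.sum_le_sum fun j _ => by
      rw [mul_comm L]; exact mul_le_mul_of_nonneg_left (hL j) (sq_nonneg _)
  have h1 := norm_trace_conjTranspose_mul_sq_le Zᴴ R
  rw [Matrix.conjTranspose_conjTranspose, hsSq_conjTranspose, hZR, Complex.norm_real,
    Real.norm_eq_abs, sq_abs] at h1
  have h2 : S * S ≤ S * (L * hsSq R) := by nlinarith [hsSq_nonneg R]
  rcases hS0.eq_or_lt with h0 | h0
  · rw [← h0]
    exact mul_nonneg hL0 (hsSq_nonneg R)
  · exact le_of_mul_le_mul_left h2 h0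

lemma hsSq_toMatA {A B E : Type*} [Fintype A] [Fintype B] [Fintype E] (ψ : (A × B) × E → ℂ) :
    hsSq (toMatA ψ) = ∑ x, ‖ψ x‖ ^ 2 := by
  simp only [hsSq, toMatA, Fintype.sum_prod_type, Matrix.of_apply]

/-- The vector `(1 ⊗ u* ⊗ 1) t`. -/
noncomputable def pullback {A' B B' E : Type*} [Fintype B'] (u : Matrix B' B ℂ)
    (t : (A' × B') × E → ℂ) : (A' × B) × E → ℂ :=
  fun p => ∑ x, star (u x p.1.2) * t ((p.1.1, x), p.2)

lemma sum_sq_pullback_le {A' B B' E : Type*} [Fintype A'] [Fintype B] [DecidableEq B] [Fintype B']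
    [DecidableEq B'] [Fintype E]
    {u : Matrix B' B ℂ} (hu : uᴴ * u = 1) (t : (A' × B') × E → ℂ) :
    ∑ x, ‖pullback u t x‖ ^ 2 ≤ ∑ x, ‖t x‖ ^ 2 := by
  have h := hsSq_mul_le_of_contraction (A := uᴴ)
    (by rw [Matrix.l2_opNorm_conjTranspose]; exact l2_opNorm_le_one_of_isometry hu)
    (Matrix.of fun (x : B') (p : A' × E) => t ((p.1, x), p.2))
  have e1 : hsSq (uᴴ * (Matrix.of fun (x : B') (p : A' × E) => t ((p.1, x), p.2)))
      = ∑ x, ‖pullback u t x‖ ^ 2 := by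
    simp only [hsSq, pullback, Fintype.sum_prod_type, Matrix.mul_apply, Matrix.of_apply,
      Matrix.conjTranspose_apply]
    rw [Finset.sum_comm]
  have e2 : hsSq (Matrix.of fun (x : B') (p : A' × E) => t ((p.1, x), p.2))
      = ∑ x, ‖t x‖ ^ 2 := by
    simp only [hsSq, Fintype.sum_prod_type, Matrix.of_apply]
    rw [Finset.sum_comm]
  rwa [e1, e2] at h

lemma amplitude_kronecker_eq_trace {A A' B B' E : Type*} [Fintype A] [Fintype A'] [Fintype B]
    [Fintype B'] [Fintype E] (a : Matrix A' A ℂ) (u : Matrix B' B ℂ) (ψ : (A × B) × E → ℂ)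
    (t : (A' × B') × E → ℂ) :
    amplitude (a ⊗ₖ u) ψ t = (a * (toMatA ψ * (toMatA (pullback u t))ᴴ)).trace := by
  simp only [amplitude, Matrix.trace, Matrix.diag_apply, Matrix.mul_apply,
    Matrix.conjTranspose_apply, toMat, toMatA, pullback, Matrix.of_apply,
    Matrix.kroneckerMap_apply, Fintype.sum_prod_type, star_sum, star_mul', star_star,
    Finset.mul_sum]
  rw [Finset.sum_comm]
  refine Finset.sum_congr rfl fun l _ => ?_
  calc _ = ∑ x, ∑ e, ∑ i, ∑ b, star (t ((l, x), e)) * (a l i * u x b * ψ ((i, b), e)) :=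
        Finset.sum_comm
    _ = ∑ e, ∑ x, ∑ i, ∑ b, star (t ((l, x), e)) * (a l i * u x b * ψ ((i, b), e)) :=
        Finset.sum_comm
    _ = ∑ e, ∑ i, ∑ x, ∑ b, star (t ((l, x), e)) * (a l i * u x b * ψ ((i, b), e)) :=
        Finset.sum_congr rfl fun e _ => Finset.sum_comm
    _ = ∑ i, ∑ e, ∑ x, ∑ b, star (t ((l, x), e)) * (a l i * u x b * ψ ((i, b), e)) :=
        Finset.sum_comm
    _ = ∑ i, ∑ e, ∑ b, ∑ x, star (t ((l, x), e)) * (a l i * u x b * ψ ((i, b), e)) :=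
        Finset.sum_congr rfl fun i _ => Finset.sum_congr rfl fun e _ => Finset.sum_comm
    _ = ∑ i, ∑ b, ∑ e, ∑ x, star (t ((l, x), e)) * (a l i * u x b * ψ ((i, b), e)) :=
        Finset.sum_congr rfl fun i _ => Finset.sum_comm
    _ = _ := by
        refine Finset.sum_congr rfl fun i _ => Finset.sum_congr rfl fun b _ =>
          Finset.sum_congr rfl fun e _ => Finset.sum_congr rfl fun x _ => ?_
        ring

lemma amplitude_add {X Y E : Type*} [Fintype X] [Fintype Y] [Fintype E] (V : Matrix Y X ℂ)
    (ψ₁ ψ₂ : X × E → ℂ) (t : Y × E → ℂ) :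
    amplitude V (ψ₁ + ψ₂) t = amplitude V ψ₁ t + amplitude V ψ₂ t := by
  have : toMat (ψ₁ + ψ₂) = toMat ψ₁ + toMat ψ₂ := rfl
  rw [amplitude, amplitude, amplitude, this, Matrix.mul_add, Matrix.mul_add, Matrix.trace_add]

section Instrument

variable {A A' B B' E κ : Type*} [Fintype A] [DecidableEq A] [Fintype A']
  [Fintype B] [DecidableEq B] [Fintype B'] [Fintype E] [Fintype κ]
  {a : κ → Matrix A' A ℂ}

/-- Partial isometries with orthogonal initial spaces and isometries on the other factor form an
operation that does not increase the norm. -/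
lemma sum_hsSq_kronecker_mul_le (hort : ∀ j k, j ≠ k → a j * (a k)ᴴ = 0)
    (hiso : ∀ k, a k * (a k)ᴴ * a k = a k) {u : κ → Matrix B' B ℂ} (hu : ∀ k, (u k)ᴴ * u k = 1)
    (Z : Matrix (A × B) E ℂ) : ∑ k, hsSq ((a k ⊗ₖ u k) * Z) ≤ hsSq Z := by
  classical
  set S : Matrix A A ℂ := ∑ k, (a k)ᴴ * a k with hS
  have hSS : S * S = S := by
    rw [hS, Finset.sum_mul]
    refine Finset.sum_congr rfl fun j _ => ?_
    rw [Finset.mul_sum, Finset.sum_eq_single j]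
    · rw [← Matrix.mul_assoc, Matrix.mul_assoc _ (a j), Matrix.mul_assoc, hiso]
    · intro k _ hk
      rw [Matrix.mul_assoc, ← Matrix.mul_assoc (a j), hort j k hk.symm]
      simp
    · simp
  have hSH : Sᴴ = S := by
    rw [hS, Matrix.conjTranspose_sum]
    simp [Matrix.conjTranspose_mul]
  set P : Matrix (A × B) (A × B) ℂ := S ⊗ₖ 1 with hP
  have hPP : P * P = P := by rw [hP, ← Matrix.mul_kronecker_mul, hSS, Matrix.one_mul]
  have hPH : Pᴴ = P := by rw [hP, Matrix.conjTranspose_kronecker, hSH, Matrix.conjTranspose_one]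
  have hle : hsSq (P * Z) ≤ hsSq Z :=
    hsSq_mul_le_of_contraction (l2_opNorm_le_one_of_proj (by rw [hPH, hPP, hPP])) Z
  refine le_trans (le_of_eq ?_) hle
  have key : ((∑ k, hsSq ((a k ⊗ₖ u k) * Z) : ℝ) : ℂ) = (hsSq (P * Z) : ℝ) := by
    rw [← trace_conjTranspose_mul_self, Matrix.conjTranspose_mul, Matrix.mul_assoc,
      ← Matrix.mul_assoc Pᴴ, hPH, hPP, hP, hS]
    push_cast
    have : (∑ k, (a k)ᴴ * a k) ⊗ₖ (1 : Matrix B B ℂ) = ∑ k, (a k ⊗ₖ u k)ᴴ * (a k ⊗ₖ u k) := by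
      have h1 : ∀ k, (a k ⊗ₖ u k)ᴴ * (a k ⊗ₖ u k) = ((a k)ᴴ * a k) ⊗ₖ (1 : Matrix B B ℂ) := by
        intro k
        rw [Matrix.conjTranspose_kronecker, ← Matrix.mul_kronecker_mul, hu]
      simp_rw [h1]
      ext p q
      simp [Matrix.sum_apply, Finset.sum_mul]
    rw [this, Matrix.sum_mul, Matrix.mul_sum, Matrix.trace_sum]
    refine Finset.sum_congr rfl fun k _ => ?_
    rw [← trace_conjTranspose_mul_self, Matrix.conjTranspose_mul]
    simp only [Matrix.mul_assoc]
  exact_mod_cast key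

lemma sum_sq_amplitude_le_mul (hort : ∀ j k, j ≠ k → a j * (a k)ᴴ = 0)
    (hiso : ∀ k, a k * (a k)ᴴ * a k = a k) {u : κ → Matrix B' B ℂ} (hu : ∀ k, (u k)ᴴ * u k = 1)
    (ψ : (A × B) × E → ℂ) (t : (A' × B') × E → ℂ) :
    ∑ k, ‖amplitude (a k ⊗ₖ u k) ψ t‖ ^ 2 ≤ (∑ x, ‖t x‖ ^ 2) * ∑ x, ‖ψ x‖ ^ 2 := by
  rw [← hsSq_toMat ψ, ← hsSq_toMat t]
  refine le_trans (Finset.sum_le_sum fun k _ => norm_trace_conjTranspose_mul_sq_le _ _) ?_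
  rw [← Finset.mul_sum]
  exact mul_le_mul_of_nonneg_left (sum_hsSq_kronecker_mul_le hort hiso hu (toMat ψ))
    (hsSq_nonneg _)

lemma sum_sq_amplitude_le (hort : ∀ j k, j ≠ k → a j * (a k)ᴴ = 0)
    (hiso : ∀ k, a k * (a k)ᴴ * a k = a k) {u : κ → Matrix B' B ℂ} (hu : ∀ k, (u k)ᴴ * u k = 1)
    (ψ : (A × B) × E → ℂ) {t : (A' × B') × E → ℂ} (ht : ∑ x, ‖t x‖ ^ 2 = 1) :
    ∑ k, ‖amplitude (a k ⊗ₖ u k) ψ t‖ ^ 2 ≤ ∑ x, ‖ψ x‖ ^ 2 := by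
  have h := sum_sq_amplitude_le_mul hort hiso hu ψ t
  rwa [ht, one_mul] at h

lemma hsSq_le_card_of_partialIsometry {L : ℕ} {a : Matrix (Fin L) A ℂ} (h : a * aᴴ * a = a) :
    hsSq a ≤ L := by
  have h1 : ‖a‖ ≤ 1 := l2_opNorm_le_one_of_proj (by
    rw [Matrix.mul_assoc, ← Matrix.mul_assoc a, h])
  have h2 := hsSq_mul_le_of_contraction' (1 : Matrix (Fin L) (Fin L) ℂ) h1
  have h3 : hsSq (1 : Matrix (Fin L) (Fin L) ℂ) = L := by
    have := trace_mul_conjTranspose_self (1 : Matrix (Fin L) (Fin L) ℂ)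
    simp only [Matrix.conjTranspose_one, Matrix.mul_one, Matrix.trace_one, Fintype.card_fin] at this
    exact_mod_cast this.symm
  rwa [Matrix.one_mul, h3] at h2

/-- Outcomes that share a message share, up to a phase, the decoding isometry, and their measurement
operators are orthogonal; Bessel's inequality therefore limits what each message contributes to the
fidelity. -/
lemma sum_sq_amplitude_le_of_oneWayLOCC [Nonempty B] [DecidableEq B'] {L : ℕ}
    {a : κ → Matrix (Fin L) A ℂ}
    (hort : ∀ j k, j ≠ k → a j * (a k)ᴴ = 0)
    (hiso : ∀ k, a k * (a k)ᴴ * a k = a k) {u : κ → Matrix B' B ℂ} (hu : ∀ k, (u k)ᴴ * u k = 1)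
    {M : SuperOp (A × B) (Fin L × B')}
    (hM : ∀ ρ, M ρ = ∑ k, (a k ⊗ₖ u k) * ρ * (a k ⊗ₖ u k)ᴴ) {D : ℕ} (hD : IsOneWayLOCC D M)
    [DecidableEq E] (ψ : (A × B) × E → ℂ) {t : (Fin L × B') × E → ℂ} (ht : ∑ x, ‖t x‖ ^ 2 = 1) :
    ∑ k, ‖amplitude (a k ⊗ₖ u k) ψ t‖ ^ 2 ≤ D * L * ‖toMatA ψ‖ ^ 2 := by
  classical
  obtain ⟨𝒜, ℬ, h𝒜, hℬ, hM'⟩ := hD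
  have hex := exists_message hort hiso hu h𝒜 hℬ hM hM'
  set f : κ → ℝ := fun j => ‖amplitude (a j ⊗ₖ u j) ψ t‖ ^ 2 with hf
  have hf0 : ∀ j, 0 ≤ f j := fun j => sq_nonneg _
  have h1 : ∀ j, f j ≤ ∑ k, if ℬ k = conjMap (u j) then f j else 0 := by
    intro j
    by_cases hj : a j = 0
    · have : f j = 0 := by
        simp [hf, hj, amplitude]
      simp [this]
    · obtain ⟨k, hk⟩ := hex j hj
      refine le_trans (le_of_eq ?_) (Finset.single_le_sum (fun k _ => ?_) (Finset.mem_univ k))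
      · rw [if_pos hk]
      · split_ifs
        · exact hf0 j
        · exact le_rfl
  have h2 : ∀ k : Fin D, (∑ j, if ℬ k = conjMap (u j) then f j else 0) ≤ L * ‖toMatA ψ‖ ^ 2 := by
    intro k
    rw [← Finset.sum_filter]
    rcases (Finset.univ.filter fun j => ℬ k = conjMap (u j)).eq_empty_or_nonempty with h0 | ⟨i, hi⟩
    · rw [h0, Finset.sum_empty]; positivity
    have hi' : ℬ k = conjMap (u i) := (Finset.mem_filter.1 hi).2
    set R := toMatA ψ * (toMatA (pullback (u i) t))ᴴ with hR
    have h3 : ∀ j ∈ Finset.univ.filter (fun j => ℬ k = conjMap (u j)),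
        f j = ‖(a j * R).trace‖ ^ 2 := by
      intro j hj
      have hj' : ℬ k = conjMap (u j) := (Finset.mem_filter.1 hj).2
      obtain ⟨θ, hθ, hθu⟩ := exists_phase_of_conjMap_eq (hu j) (hj'.symm.trans hi')
      rw [hR, ← amplitude_kronecker_eq_trace, hf]
      simp only
      rw [hθu, Matrix.kronecker_smul, amplitude, Matrix.smul_mul, Matrix.mul_smul,
        Matrix.trace_smul, norm_smul, hθ, one_mul, amplitude]
    rw [Finset.sum_congr rfl h3]
    refine (sum_sq_trace_mul_le _ hort (Nat.cast_nonneg L)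
      (fun k => hsSq_le_card_of_partialIsometry (hiso k)) R).trans ?_
    refine mul_le_mul_of_nonneg_left ?_ (Nat.cast_nonneg L)
    refine (hsSq_mul_le _ _).trans ?_
    rw [hsSq_conjTranspose, hsSq_toMatA]
    have := sum_sq_pullback_le (hu i) t
    rw [ht] at this
    exact mul_le_of_le_one_right (sq_nonneg _) this
  calc ∑ j, f j ≤ ∑ j, ∑ k, (if ℬ k = conjMap (u j) then f j else 0) :=
        Finset.sum_le_sum fun j _ => h1 j
    _ = ∑ k, ∑ j, (if ℬ k = conjMap (u j) then f j else 0) := Finset.sum_comm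
    _ ≤ ∑ k : Fin D, L * ‖toMatA ψ‖ ^ 2 := Finset.sum_le_sum fun k _ => h2 k
    _ = D * L * ‖toMatA ψ‖ ^ 2 := by
        rw [Finset.sum_const, Finset.card_univ, Fintype.card_fin, nsmul_eq_mul, mul_assoc]

end Instrument

lemma mergingFidelity_le_one {A B E : Type*} [Fintype A] [DecidableEq A] [Fintype B]
    [DecidableEq B] [Fintype E] [DecidableEq E] {L : ℕ}
    {M : SuperOp (A × B) (Fin L × (Fin L × (A × B)))} (hM : IsLMerging L M)
    {ψ : (A × B) × E → ℂ} (hψ : ∑ x, ‖ψ x‖ ^ 2 = 1) : mergingFidelity L M ψ ≤ 1 := by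
  obtain ⟨hL, -, a, u, ha, hu, hMf⟩ := hM
  have hMsum : M = ∑ k, conjMap (a k ⊗ₖ u k) := by
    refine LinearMap.ext fun ρ => ?_
    rw [hMf, LinearMap.sum_apply]; rfl
  rw [hMsum, mergingFidelity_eq hL a u hψ, ← hψ]
  exact sum_sq_amplitude_le ha.orthogonal ha.partialIsometry hu ψ
    (by rw [sum_sq_targetVec hL, hψ])

/-- A merging with `D` messages has fidelity at most about `D L ‖ψ₁‖²`, where `ψ₁` is a part of the
input that carries almost all its weight and `‖ψ₁‖` is its largest Schmidt coefficient between `A`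
and `BE`. -/
theorem mergingFidelity_le {A B E : Type*} [Fintype A] [DecidableEq A] [Fintype B] [DecidableEq B]
    [Fintype E] [DecidableEq E] {L D : ℕ} {M : SuperOp (A × B) (Fin L × (Fin L × (A × B)))}
    (hM : IsLMerging L M) (hD : IsOneWayLOCC D M) {ψ ψ₁ ψ₂ : (A × B) × E → ℂ}
    (hψ : ∑ x, ‖ψ x‖ ^ 2 = 1) (h12 : ψ = ψ₁ + ψ₂) :
    mergingFidelity L M ψ ≤ 2 * (D * L * ‖toMatA ψ₁‖ ^ 2) + 2 * ∑ x, ‖ψ₂ x‖ ^ 2 := by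
  obtain ⟨hL, -, a, u, ha, hu, hMf⟩ := hM
  have hMsum : M = ∑ k, conjMap (a k ⊗ₖ u k) := by
    refine LinearMap.ext fun ρ => ?_
    rw [hMf, LinearMap.sum_apply]; rfl
  have hB : Nonempty B := by
    by_contra hc
    rw [not_nonempty_iff] at hc
    simp at hψ
  have ht : ∑ x, ‖targetVec L ψ x‖ ^ 2 = 1 := by rw [sum_sq_targetVec hL, hψ]
  rw [hMsum, mergingFidelity_eq hL a u hψ]
  have h1 := sum_sq_amplitude_le_of_oneWayLOCC ha.orthogonal ha.partialIsometry hu hMf hD ψ₁ ht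
  have h2 := sum_sq_amplitude_le ha.orthogonal ha.partialIsometry hu ψ₂ ht
  calc ∑ k, ‖amplitude (a k ⊗ₖ u k) ψ (targetVec L ψ)‖ ^ 2
      ≤ ∑ k, (2 * ‖amplitude (a k ⊗ₖ u k) ψ₁ (targetVec L ψ)‖ ^ 2
          + 2 * ‖amplitude (a k ⊗ₖ u k) ψ₂ (targetVec L ψ)‖ ^ 2) := by
        refine Finset.sum_le_sum fun k _ => ?_
        have : amplitude (a k ⊗ₖ u k) ψ (targetVec L ψ)
            = amplitude (a k ⊗ₖ u k) ψ₁ (targetVec L ψ)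
              + amplitude (a k ⊗ₖ u k) ψ₂ (targetVec L ψ) := by
          rw [← amplitude_add, ← h12]
        rw [this]
        have := norm_add_le (amplitude (a k ⊗ₖ u k) ψ₁ (targetVec L ψ))
          (amplitude (a k ⊗ₖ u k) ψ₂ (targetVec L ψ))
        nlinarith [sq_nonneg (‖amplitude (a k ⊗ₖ u k) ψ₁ (targetVec L ψ)‖
          - ‖amplitude (a k ⊗ₖ u k) ψ₂ (targetVec L ψ)‖), norm_nonneg
          (amplitude (a k ⊗ₖ u k) ψ₁ (targetVec L ψ) + amplitude (a k ⊗ₖ u k) ψ₂ (targetVec L ψ))]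
    _ ≤ _ := by
        rw [Finset.sum_add_distrib, ← Finset.mul_sum, ← Finset.mul_sum]
        gcongr

end Converse

/-! ### Typical subspaces -/

section Typicality

variable {X : Type*} [Fintype X]

lemma sum_prod_eq_one {lam : X → ℝ} (h1 : ∑ x, lam x = 1) (l : ℕ) :
    ∑ x : Fin l → X, ∏ i, lam (x i) = 1 := by
  classical
  have := Finset.prod_univ_sum (fun _ : Fin l => (Finset.univ : Finset X)) fun _ x => lam x
  rw [Fintype.piFinset_univ] at this
  rw [← this]
  simp [h1]

lemma sum_prod_mul_sum {lam g : X → ℝ} (h1 : ∑ x, lam x = 1) (hg : ∑ x, lam x * g x = 0)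
    (l : ℕ) : ∑ x : Fin l → X, (∏ i, lam (x i)) * ∑ i, g (x i) = 0 := by
  induction l with
  | zero => simp
  | succ l ih =>
    rw [← (Fin.consEquiv fun _ : Fin (l + 1) => X).sum_comp, Fintype.sum_prod_type]
    simp only [Fin.consEquiv_apply, Fin.prod_univ_succ, Fin.sum_univ_succ, Fin.cons_zero,
      Fin.cons_succ]
    have : ∀ a : X, ∑ y : Fin l → X, lam a * (∏ i, lam (y i)) * (g a + ∑ i, g (y i))
        = lam a * g a := by
      intro a
      calc _ = ∑ y : Fin l → X, (lam a * g a * (∏ i, lam (y i))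
            + lam a * ((∏ i, lam (y i)) * ∑ i, g (y i))) :=
            Finset.sum_congr rfl fun y _ => by ring
        _ = lam a * g a := by
            rw [Finset.sum_add_distrib, ← Finset.mul_sum, ← Finset.mul_sum, ih,
              sum_prod_eq_one h1]
            ring
    simp_rw [this, hg]

/-- The variance of a sum of independent centred variables. -/
lemma sum_prod_mul_sum_sq {lam g : X → ℝ} (h1 : ∑ x, lam x = 1) (hg : ∑ x, lam x * g x = 0)
    (l : ℕ) : ∑ x : Fin l → X, (∏ i, lam (x i)) * (∑ i, g (x i)) ^ 2
      = l * ∑ x, lam x * g x ^ 2 := by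
  induction l with
  | zero => simp
  | succ l ih =>
    rw [← (Fin.consEquiv fun _ : Fin (l + 1) => X).sum_comp, Fintype.sum_prod_type]
    simp only [Fin.consEquiv_apply, Fin.prod_univ_succ, Fin.sum_univ_succ, Fin.cons_zero,
      Fin.cons_succ]
    have : ∀ a : X, ∑ y : Fin l → X, lam a * (∏ i, lam (y i)) * (g a + ∑ i, g (y i)) ^ 2
        = lam a * g a ^ 2 + lam a * (l * ∑ x, lam x * g x ^ 2) := by
      intro a
      calc _ = ∑ y : Fin l → X, (lam a * g a ^ 2 * (∏ i, lam (y i))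
            + 2 * lam a * g a * ((∏ i, lam (y i)) * ∑ i, g (y i))
            + lam a * ((∏ i, lam (y i)) * (∑ i, g (y i)) ^ 2)) :=
            Finset.sum_congr rfl fun y _ => by ring
        _ = _ := by
            rw [Finset.sum_add_distrib, Finset.sum_add_distrib, ← Finset.mul_sum,
              ← Finset.mul_sum, ← Finset.mul_sum, ih, sum_prod_eq_one h1,
              sum_prod_mul_sum h1 hg]
            ring
    simp_rw [this]
    rw [Finset.sum_add_distrib, ← Finset.sum_mul, h1]
    push_cast
    ring

/-- The asymptotic equipartition property for a probability vector: outside of a set of sequences of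
small weight, all probabilities are close to `2 ^ (-l H)`. -/
lemma exists_typical_set {lam : X → ℝ} (h0 : ∀ x, 0 ≤ lam x) (h1 : ∑ x, lam x = 1) {H : ℝ}
    (hH : H = ∑ x, -(lam x * Real.logb 2 (lam x))) :
    ∃ V : ℝ, 0 ≤ V ∧ ∀ (l : ℕ) (ε : ℝ), 0 < l → 0 < ε → ∃ T : Finset (Fin l → X),
      (T.card : ℝ) ≤ 2 ^ ((l : ℝ) * (H + ε)) ∧
      (∀ x ∈ T, ∏ i, lam (x i) ≤ 2 ^ (-((l : ℝ) * (H - ε)))) ∧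
      1 - ∑ x ∈ T, ∏ i, lam (x i) ≤ V / (l * ε ^ 2) := by
  classical
  set g : X → ℝ := fun x => -Real.logb 2 (lam x) - H with hg
  have hgm : ∑ x, lam x * g x = 0 := by
    have : ∀ x, lam x * g x = -(lam x * Real.logb 2 (lam x)) - lam x * H := fun x => by
      rw [hg]; ring
    simp_rw [this]
    rw [Finset.sum_sub_distrib, ← hH, ← Finset.sum_mul, h1]
    ring
  refine ⟨∑ x, lam x * g x ^ 2, Finset.sum_nonneg fun x _ => mul_nonneg (h0 x) (sq_nonneg _), ?_⟩
  intro l ε hl hε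
  have hl' : (0 : ℝ) < l := Nat.cast_pos.2 hl
  have hp0 : ∀ x : Fin l → X, 0 ≤ ∏ i, lam (x i) := fun x => Finset.prod_nonneg fun i _ => h0 _
  set T : Finset (Fin l → X) :=
    Finset.univ.filter fun x => 0 < ∏ i, lam (x i) ∧ |∑ i, g (x i)| ≤ l * ε with hT
  have hlog : ∀ x ∈ T, Real.logb 2 (∏ i, lam (x i)) = -(l * H) - ∑ i, g (x i) := by
    intro x hx
    have hx0 := (Finset.mem_filter.1 hx).2.1
    have hne : ∀ i, lam (x i) ≠ 0 := fun i hi =>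
      hx0.ne' (Finset.prod_eq_zero (Finset.mem_univ i) hi)
    rw [Real.logb_prod _ _ fun i _ => hne i, hg]
    simp only [Finset.sum_sub_distrib, Finset.sum_neg_distrib, Finset.sum_const, Finset.card_univ,
      Fintype.card_fin, nsmul_eq_mul]
    ring
  have hval : ∀ x ∈ T, ∏ i, lam (x i) = 2 ^ (-(l * H) - ∑ i, g (x i)) := by
    intro x hx
    rw [← hlog x hx, Real.rpow_logb two_pos (by norm_num) (Finset.mem_filter.1 hx).2.1]
  refine ⟨T, ?_, ?_, ?_⟩
  · have hlow : ∀ x ∈ T, (2 : ℝ) ^ (-((l : ℝ) * (H + ε))) ≤ ∏ i, lam (x i) := by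
      intro x hx
      rw [hval x hx]
      refine Real.rpow_le_rpow_of_exponent_le one_le_two ?_
      have := (abs_le.1 (Finset.mem_filter.1 hx).2.2).2
      linarith
    have hsum : (T.card : ℝ) * 2 ^ (-((l : ℝ) * (H + ε))) ≤ 1 := by
      rw [← sum_prod_eq_one h1 l, ← nsmul_eq_mul, ← Finset.sum_const]
      exact (Finset.sum_le_sum hlow).trans
        (Finset.sum_le_sum_of_subset_of_nonneg (Finset.subset_univ _) fun x _ _ => hp0 x)
    rw [Real.rpow_neg two_pos.le, ← div_eq_mul_inv, div_le_one (by positivity)] at hsum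
    exact hsum
  · intro x hx
    rw [hval x hx]
    refine Real.rpow_le_rpow_of_exponent_le one_le_two ?_
    have := (abs_le.1 (Finset.mem_filter.1 hx).2.2).1
    linarith
  · have hcompl : 1 - ∑ x ∈ T, ∏ i, lam (x i) = ∑ x ∈ Tᶜ, ∏ i, lam (x i) := by
      rw [← sum_prod_eq_one h1 l, ← Finset.sum_add_sum_compl T]
      ring
    rw [hcompl, le_div_iff₀ (by positivity)]
    have hle : ∀ x ∈ Tᶜ, (∏ i, lam (x i)) * (l * ε) ^ 2 ≤ (∏ i, lam (x i)) * (∑ i, g (x i)) ^ 2 := by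
      intro x hx
      rcases (hp0 x).eq_or_lt with h | h
      · rw [← h]; simp
      · have hx' : ¬ |∑ i, g (x i)| ≤ l * ε := fun hc =>
          Finset.mem_compl.1 hx (Finset.mem_filter.2 ⟨Finset.mem_univ _, h, hc⟩)
        push Not at hx'
        refine mul_le_mul_of_nonneg_left ?_ h.le
        rw [← sq_abs (∑ i, g (x i))]
        exact pow_le_pow_left₀ (by positivity) hx'.le 2
    have h2 := (Finset.sum_le_sum hle).trans
      (Finset.sum_le_sum_of_subset_of_nonneg (Finset.subset_univ _) fun x _ _ =>
        mul_nonneg (hp0 x) (sq_nonneg _))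
    rw [← Finset.sum_mul, sum_prod_mul_sum_sq h1 hgm] at h2
    have h3 : (∑ x ∈ Tᶜ, ∏ i, lam (x i)) * (l * ε ^ 2) * l
        ≤ (∑ x, lam x * g x ^ 2) * l := by nlinarith
    exact le_of_mul_le_mul_right h3 hl'

end Typicality

section TensorPower

variable {X Y Z : Type*}

/-- The `l`-fold tensor power of a matrix. -/
def tensorPow (l : ℕ) (M : Matrix X Y ℂ) : Matrix (Fin l → X) (Fin l → Y) ℂ :=
  Matrix.of fun x y => ∏ i, M (x i) (y i)

lemma tensorPow_mul [Fintype Y] (l : ℕ) (M : Matrix X Y ℂ) (N : Matrix Y Z ℂ) :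
    tensorPow l (M * N) = tensorPow l M * tensorPow l N := by
  classical
  ext x z
  simp only [tensorPow, Matrix.of_apply, Matrix.mul_apply]
  rw [Finset.prod_univ_sum, Fintype.piFinset_univ]
  exact Finset.sum_congr rfl fun y _ => Finset.prod_mul_distrib

lemma tensorPow_conjTranspose (l : ℕ) (M : Matrix X Y ℂ) :
    tensorPow l Mᴴ = (tensorPow l M)ᴴ := by
  ext x y
  simp [tensorPow, Matrix.conjTranspose_apply]

lemma tensorPow_diagonal [DecidableEq X] (l : ℕ) (d : X → ℂ) :
    tensorPow l (Matrix.diagonal d) = Matrix.diagonal fun x => ∏ i, d (x i) := by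
  ext x y
  rw [tensorPow, Matrix.of_apply]
  by_cases h : x = y
  · subst h; simp
  · rw [Matrix.diagonal_apply_ne _ h]
    obtain ⟨i, hi⟩ := Function.ne_iff.1 h
    exact Finset.prod_eq_zero (Finset.mem_univ i) (Matrix.diagonal_apply_ne _ hi)

lemma tensorPow_one [DecidableEq X] (l : ℕ) : tensorPow l (1 : Matrix X X ℂ) = 1 := by
  rw [← Matrix.diagonal_one, tensorPow_diagonal]
  simp

end TensorPower

section Spectral

variable {X : Type*} [Fintype X]

lemma exists_spectral_decomposition [DecidableEq X] {ρ : Matrix X X ℂ} (hρ : ρ.IsHermitian) :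
    ∃ U : Matrix X X ℂ, Uᴴ * U = 1 ∧ U * Uᴴ = 1 ∧
      ρ = U * Matrix.diagonal (fun x => (hρ.eigenvalues x : ℂ)) * Uᴴ ∧
      ∀ f : ℝ → ℝ, cfc f ρ = U * Matrix.diagonal (fun x => (f (hρ.eigenvalues x) : ℂ)) * Uᴴ := by
  refine ⟨hρ.eigenvectorUnitary, ?_, ?_, ?_, ?_⟩
  · exact (Matrix.mem_unitaryGroup_iff').1 hρ.eigenvectorUnitary.2
  · exact (Matrix.mem_unitaryGroup_iff).1 hρ.eigenvectorUnitary.2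
  · conv_lhs => rw [hρ.spectral_theorem]
    rfl
  · intro f
    rw [hρ.cfc_eq]
    rfl

lemma entropy_eq_sum [DecidableEq X] {ρ : Matrix X X ℂ} (hρ : ρ.IsHermitian) :
    entropy ρ = ∑ x, -(hρ.eigenvalues x * Real.logb 2 (hρ.eigenvalues x)) := by
  obtain ⟨U, hU, -, hd, hf⟩ := exists_spectral_decomposition hρ
  have : (ρ * cfc (Real.logb 2) ρ).trace
      = ((∑ x, hρ.eigenvalues x * Real.logb 2 (hρ.eigenvalues x) : ℝ) : ℂ) := by
    rw [hf]
    set Λ : Matrix X X ℂ := Matrix.diagonal fun x => (hρ.eigenvalues x : ℂ) with hΛ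
    set Λ' : Matrix X X ℂ :=
      Matrix.diagonal fun x => (Real.logb 2 (hρ.eigenvalues x) : ℂ) with hΛ'
    have e : (ρ * (U * Λ' * Uᴴ)).trace = (U * Λ * Uᴴ * (U * Λ' * Uᴴ)).trace := by rw [← hd]
    rw [e, show ∀ D D' : Matrix X X ℂ, U * D * Uᴴ * (U * D' * Uᴴ) = U * (D * D' * Uᴴ) from
        fun D D' => by
          simp only [Matrix.mul_assoc]
          rw [← Matrix.mul_assoc Uᴴ U, hU, Matrix.one_mul],
      Matrix.trace_mul_comm, Matrix.mul_assoc, Matrix.mul_assoc, hU, Matrix.mul_one, hΛ, hΛ', Matrix.diagonal_mul_diagonal,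
      Matrix.trace_diagonal]
    push_cast; rfl
  rw [entropy, this, Complex.ofReal_re, Finset.sum_neg_distrib]

lemma IsState.sum_eigenvalues [DecidableEq X] {ρ : Matrix X X ℂ} (hρ : IsState ρ) :
    ∑ x, hρ.1.isHermitian.eigenvalues x = 1 := by
  have := hρ.1.isHermitian.trace_eq_sum_eigenvalues
  have h2 : ((∑ x, hρ.1.isHermitian.eigenvalues x : ℝ) : ℂ) = ((1 : ℝ) : ℂ) := by
    push_cast; exact this.symm.trans hρ.2
  exact Complex.ofReal_inj.1 h2

open scoped Matrix.Norms.L2Operator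

/-- The range of the isometry `Y` is a subspace of dimension at most `d` that carries all of the
weight of `σ` up to `η` and on which `σ` is at most `μ`. -/
structure IsTypicalSubspace (σ : Matrix X X ℂ) {R : Type*} [Fintype R] [DecidableEq R]
    (Y : Matrix X R ℂ) (d μ η : ℝ) : Prop where
  isometry : Yᴴ * Y = 1
  card_le : (Fintype.card R : ℝ) ≤ d
  norm_le : ‖Yᴴ * σ * Y‖ ≤ μ
  tail_le : (σ.trace - (Yᴴ * σ * Y).trace).re ≤ η

lemma IsTypicalSubspace.norm_sq_le {Z : Type*} [Fintype Z] [DecidableEq Z] {σ : Matrix X X ℂ}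
    {R : Type*} [Fintype R] [DecidableEq R] {Y : Matrix X R ℂ} {d μ η : ℝ}
    (h : IsTypicalSubspace σ Y d μ η)
    {Ψ : Matrix X Z ℂ} (hΨ : Ψ * Ψᴴ = σ) : ‖Y * Yᴴ * Ψ‖ ^ 2 ≤ μ := by
  have h1 : ‖Yᴴ * Ψ‖ ^ 2 ≤ μ := by
    have := Matrix.l2_opNorm_conjTranspose_mul_self (Yᴴ * Ψ)ᴴ
    rw [Matrix.conjTranspose_conjTranspose, Matrix.l2_opNorm_conjTranspose] at this
    rw [sq, ← this, Matrix.conjTranspose_mul, Matrix.conjTranspose_conjTranspose]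
    rw [Matrix.mul_assoc, ← Matrix.mul_assoc Ψ, hΨ, ← Matrix.mul_assoc]
    exact h.norm_le
  have h2 : ‖Y * Yᴴ * Ψ‖ ≤ ‖Yᴴ * Ψ‖ := by
    rw [Matrix.mul_assoc]
    refine (Matrix.l2_opNorm_mul _ _).trans ?_
    exact mul_le_of_le_one_left (norm_nonneg _) (l2_opNorm_le_one_of_isometry h.isometry)
  exact (pow_le_pow_left₀ (norm_nonneg _) h2 2).trans h1

lemma IsTypicalSubspace.hsSq_sub_le {Z : Type*} [Fintype Z] {σ : Matrix X X ℂ}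
    {R : Type*} [Fintype R] [DecidableEq R] {Y : Matrix X R ℂ} {d μ η : ℝ}
    (h : IsTypicalSubspace σ Y d μ η)
    {Ψ : Matrix X Z ℂ} (hΨ : Ψ * Ψᴴ = σ) : hsSq (Ψ - Y * Yᴴ * Ψ) ≤ η := by
  refine le_trans (le_of_eq ?_) h.tail_le
  have : ((hsSq (Ψ - Y * Yᴴ * Ψ) : ℝ) : ℂ) = σ.trace - (Yᴴ * σ * Y).trace := by
    rw [← trace_conjTranspose_mul_self]
    have e : (Ψ - Y * Yᴴ * Ψ)ᴴ * (Ψ - Y * Yᴴ * Ψ) = Ψᴴ * Ψ - Ψᴴ * (Y * (Yᴴ * Ψ)) := by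
      rw [Matrix.conjTranspose_sub, Matrix.conjTranspose_mul, Matrix.conjTranspose_mul,
        Matrix.conjTranspose_conjTranspose]
      simp only [Matrix.sub_mul, Matrix.mul_sub, Matrix.mul_assoc]
      rw [← Matrix.mul_assoc Yᴴ Y, h.isometry, Matrix.one_mul]
      abel
    rw [e, Matrix.trace_sub, Matrix.trace_mul_comm, hΨ, ← Matrix.mul_assoc,
      Matrix.trace_mul_comm, Matrix.mul_assoc, ← Matrix.mul_assoc Ψ, hΨ, ← Matrix.mul_assoc]
  rw [← this, Complex.ofReal_re]

/-- Typical subspaces of the tensor powers of a state. -/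
lemma IsState.exists_typicalSubspace [DecidableEq X] {ρ : Matrix X X ℂ} (hρ : IsState ρ) :
    ∃ V : ℝ, 0 ≤ V ∧ ∀ (l : ℕ) (ε : ℝ), 0 < l → 0 < ε →
      ∃ (r : ℕ) (Y : Matrix (Fin l → X) (Fin r) ℂ),
        IsTypicalSubspace (tensorPow l ρ) Y (2 ^ ((l : ℝ) * (entropy ρ + ε)))
          (2 ^ (-((l : ℝ) * (entropy ρ - ε)))) (V / (l * ε ^ 2)) := by
  obtain ⟨U, hU, -, hd, -⟩ := exists_spectral_decomposition hρ.1.isHermitian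
  set lam := hρ.1.isHermitian.eigenvalues with hlam
  obtain ⟨V, hV, hT⟩ := exists_typical_set (lam := lam) (fun x => hρ.1.eigenvalues_nonneg x)
    hρ.sum_eigenvalues (entropy_eq_sum hρ.1.isHermitian)
  refine ⟨V, hV, fun l ε hl hε => ?_⟩
  obtain ⟨T, hcard, hle, htail⟩ := hT l ε hl hε
  set W := tensorPow l U with hW
  have hWW : Wᴴ * W = 1 := by
    rw [hW, ← tensorPow_conjTranspose, ← tensorPow_mul, hU, tensorPow_one]
  have hσ : Wᴴ * tensorPow l ρ * W = Matrix.diagonal fun x => ((∏ i, lam (x i) : ℝ) : ℂ) := by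
    rw [hd, tensorPow_mul, tensorPow_mul, tensorPow_conjTranspose, ← hW, tensorPow_diagonal]
    simp only [Matrix.mul_assoc]
    rw [hWW, Matrix.mul_one, ← Matrix.mul_assoc, hWW, Matrix.one_mul]
    simp
  set e : Fin T.card ≃ T := T.equivFin.symm with he
  set Y : Matrix (Fin l → X) (Fin T.card) ℂ := W.submatrix id (fun i => (e i : Fin l → X)) with hY
  have hinj : Function.Injective fun i => (e i : Fin l → X) :=
    Subtype.val_injective.comp e.injective
  have hsub : ∀ N : Matrix (Fin l → X) (Fin l → X) ℂ,
      Yᴴ * N * Y = (Wᴴ * N * W).submatrix (fun i => (e i : Fin l → X)) fun i => (e i : Fin l → X) := by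
    intro N
    ext i j
    simp [hY, Matrix.mul_apply]
  have hYσ : Yᴴ * tensorPow l ρ * Y
      = Matrix.diagonal fun i => ((∏ j, lam ((e i : Fin l → X) j) : ℝ) : ℂ) := by
    rw [hsub, hσ, Matrix.submatrix_diagonal _ _ hinj]
    rfl
  refine ⟨T.card, Y, ?_, by rwa [Fintype.card_fin], ?_, ?_⟩
  · have := hsub 1
    rwa [Matrix.mul_one, Matrix.mul_one, hWW, Matrix.submatrix_one _ hinj] at this
  · rw [hYσ, Matrix.l2_opNorm_diagonal]
    refine (pi_norm_le_iff_of_nonneg (by positivity)).2 fun i => ?_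
    rw [Complex.norm_real, Real.norm_eq_abs, abs_of_nonneg
      (Finset.prod_nonneg fun j _ => hρ.1.eigenvalues_nonneg _)]
    exact hle _ (e i).2
  · have h1 : (tensorPow l ρ).trace = 1 := by
      have : (tensorPow l ρ).trace = ∏ _i : Fin l, ρ.trace := by
        simp only [Matrix.trace, Matrix.diag_apply, tensorPow, Matrix.of_apply]
        rw [Finset.prod_univ_sum, Fintype.piFinset_univ]
      rw [this, hρ.2]; simp
    have h2 : (Yᴴ * tensorPow l ρ * Y).trace = ((∑ x ∈ T, ∏ i, lam (x i) : ℝ) : ℂ) := by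
      rw [hYσ, Matrix.trace_diagonal, ← Finset.sum_coe_sort T, ← e.sum_comp]
      push_cast; rfl
    rw [h1, h2, Complex.sub_re, Complex.one_re, Complex.ofReal_re]
    exact htail

end Spectral

/-! ### Marginals of a purification and of its powers -/

section Marginals

/-- The entropy is the sum of `-z log z` over the roots of the characteristic polynomial. -/
lemma entropy_eq_roots {X : Type*} [Fintype X] [DecidableEq X] {ρ : Matrix X X ℂ}
    (hρ : ρ.IsHermitian) :
    entropy ρ = (ρ.charpoly.roots.map fun z : ℂ => -(z.re * Real.logb 2 z.re)).sum := by
  rw [entropy_eq_sum hρ, hρ.roots_charpoly_eq_eigenvalues, Multiset.map_map]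
  rfl

open Polynomial in
/-- `M M*` and `(M* M)ᵀ` have the same nonzero spectrum, hence the same entropy. -/
lemma entropy_mul_conjTranspose {X E : Type*} [Fintype X] [DecidableEq X] [Fintype E]
    [DecidableEq E] (M : Matrix X E ℂ) : entropy (M * Mᴴ) = entropy (Mᴴ * M)ᵀ := by
  rw [entropy_eq_roots (Matrix.isHermitian_mul_conjTranspose_self M),
    entropy_eq_roots (Matrix.isHermitian_conjTranspose_mul_self M).transpose,
    Matrix.charpoly_transpose]
  have h := congrArg Polynomial.roots (Matrix.charpoly_mul_comm' M Mᴴ)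
  rw [Polynomial.roots_mul, Polynomial.roots_mul, Polynomial.roots_X_pow,
    Polynomial.roots_X_pow] at h
  · have h2 := congrArg (fun s : Multiset ℂ =>
      (s.map fun z : ℂ => -(z.re * Real.logb 2 z.re)).sum) h
    simpa [Multiset.map_nsmul, Multiset.sum_nsmul] using h2
  · exact mul_ne_zero (pow_ne_zero _ Polynomial.X_ne_zero) (Matrix.charpoly_monic _).ne_zero
  · exact mul_ne_zero (pow_ne_zero _ Polynomial.X_ne_zero) (Matrix.charpoly_monic _).ne_zero

variable {A B E : Type*}

/-- The coefficient matrix of a vector of a tripartite system for the cut `B | AE`. -/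
def toMatB (ψ : (A × B) × E → ℂ) : Matrix B (A × E) ℂ :=
  Matrix.of fun b p => ψ ((p.1, b), p.2)

/-- The coefficient matrix of a vector of a tripartite system for the cut `E | AB`. -/
def toMatE (ψ : (A × B) × E → ℂ) : Matrix E (A × B) ℂ :=
  Matrix.of fun e p => ψ (p, e)

/-- The `l`-fold tensor power of a vector of a tripartite system, grouped by subsystems. -/
def powVec (l : ℕ) (ψ : (A × B) × E → ℂ) : ((Fin l → A) × (Fin l → B)) × (Fin l → E) → ℂ :=
  fun x => ∏ i, ψ ((x.1.1 i, x.1.2 i), x.2 i)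

lemma toMatA_mul_conjTranspose [Fintype B] [Fintype E] (ψ : (A × B) × E → ℂ) :
    toMatA ψ * (toMatA ψ)ᴴ = traceSnd (traceSnd (pureState ψ)) := by
  ext a a'
  simp [toMatA, traceSnd, pureState, Matrix.mul_apply, Matrix.vecMulVec_apply,
    Fintype.sum_prod_type]

lemma toMatB_mul_conjTranspose [Fintype A] [Fintype E] (ψ : (A × B) × E → ℂ) :
    toMatB ψ * (toMatB ψ)ᴴ = traceFst (traceSnd (pureState ψ)) := by
  ext a a'
  simp [toMatB, traceSnd, traceFst, pureState, Matrix.mul_apply, Matrix.vecMulVec_apply,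
    Fintype.sum_prod_type]

lemma toMatE_mul_conjTranspose [Fintype A] [Fintype B] (ψ : (A × B) × E → ℂ) :
    toMatE ψ * (toMatE ψ)ᴴ = traceFst (pureState ψ) := by
  ext a a'
  simp [toMatE, traceFst, pureState, Matrix.mul_apply, Matrix.vecMulVec_apply,
    Fintype.sum_prod_type]

lemma toMat_mul_conjTranspose {X : Type*} [Fintype E] (ψ : X × E → ℂ) :
    toMat ψ * (toMat ψ)ᴴ = traceSnd (pureState ψ) := by
  ext a a'
  simp [toMat, traceSnd, pureState, Matrix.mul_apply, Matrix.vecMulVec_apply]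

/-- The two marginals of a pure state have the same entropy. -/
lemma entropy_traceFst_pureState {X : Type*} [Fintype X] [DecidableEq X] [Fintype E]
    [DecidableEq E] (ψ : X × E → ℂ) :
    entropy (traceFst (pureState ψ)) = entropy (traceSnd (pureState ψ)) := by
  rw [← toMat_mul_conjTranspose, entropy_mul_conjTranspose]
  congr 1
  ext a a'
  simp [toMat, traceFst, pureState, Matrix.mul_apply, Matrix.vecMulVec_apply, mul_comm]

lemma submatrix_equiv_mul_conjTranspose {X Y Z : Type*} [Fintype Y] [Fintype Z] (M : Matrix X Y ℂ)
    (e : Z ≃ Y) : M.submatrix id e * (M.submatrix id e)ᴴ = M * Mᴴ := by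
  rw [Matrix.conjTranspose_submatrix, Matrix.submatrix_mul_equiv, Matrix.submatrix_id_id]

lemma toMatA_powVec_mul_conjTranspose [Fintype B] [Fintype E] (l : ℕ)
    (ψ : (A × B) × E → ℂ) :
    toMatA (powVec l ψ) * (toMatA (powVec l ψ))ᴴ
      = tensorPow l (traceSnd (traceSnd (pureState ψ))) := by
  rw [← toMatA_mul_conjTranspose, tensorPow_mul, tensorPow_conjTranspose,
    ← submatrix_equiv_mul_conjTranspose (tensorPow l (toMatA ψ))
      (Equiv.arrowProdEquivProdArrow (Fin l) (fun _ => B) fun _ => E).symm]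
  rfl

lemma toMatB_powVec_mul_conjTranspose [Fintype A] [Fintype E] (l : ℕ)
    (ψ : (A × B) × E → ℂ) :
    toMatB (powVec l ψ) * (toMatB (powVec l ψ))ᴴ
      = tensorPow l (traceFst (traceSnd (pureState ψ))) := by
  rw [← toMatB_mul_conjTranspose, tensorPow_mul, tensorPow_conjTranspose,
    ← submatrix_equiv_mul_conjTranspose (tensorPow l (toMatB ψ))
      (Equiv.arrowProdEquivProdArrow (Fin l) (fun _ => A) fun _ => E).symm]
  rfl

lemma toMatE_powVec_mul_conjTranspose [Fintype A] [Fintype B] (l : ℕ)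
    (ψ : (A × B) × E → ℂ) :
    toMatE (powVec l ψ) * (toMatE (powVec l ψ))ᴴ = tensorPow l (traceFst (pureState ψ)) := by
  rw [← toMatE_mul_conjTranspose, tensorPow_mul, tensorPow_conjTranspose,
    ← submatrix_equiv_mul_conjTranspose (tensorPow l (toMatE ψ))
      (Equiv.arrowProdEquivProdArrow (Fin l) (fun _ => A) fun _ => B).symm]
  rfl

lemma IsState.of_mul_conjTranspose {X Y : Type*} [Fintype X] [Fintype Y] {M : Matrix X Y ℂ}
    (h : hsSq M = 1) : IsState (M * Mᴴ) :=
  ⟨Matrix.posSemidef_self_mul_conjTranspose M, by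
    rw [trace_mul_conjTranspose_self, h, Complex.ofReal_one]⟩

section

variable [Fintype A] [Fintype B] [Fintype E]

lemma IsPurification.sum_sq {X : Type*} [Fintype X] {ψ : X × E → ℂ} {ρ : Matrix X X ℂ}
    (h : IsPurification ψ ρ) (hρ : IsState ρ) : ∑ x, ‖ψ x‖ ^ 2 = 1 := by
  have h1 := hρ.2
  rw [← h, ← toMat_mul_conjTranspose, trace_mul_conjTranspose_self, hsSq_toMat] at h1
  exact_mod_cast h1

lemma hsSq_toMatB (ψ : (A × B) × E → ℂ) : hsSq (toMatB ψ) = ∑ x, ‖ψ x‖ ^ 2 := by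
  simp only [hsSq, toMatB, Fintype.sum_prod_type, Matrix.of_apply]
  rw [Finset.sum_comm]

lemma hsSq_toMatE (ψ : (A × B) × E → ℂ) : hsSq (toMatE ψ) = ∑ x, ‖ψ x‖ ^ 2 := by
  simp only [hsSq, toMatE, Matrix.of_apply]
  rw [Finset.sum_comm, ← Fintype.sum_prod_type']

lemma sum_sq_powVec (l : ℕ) {ψ : (A × B) × E → ℂ} (h : ∑ x, ‖ψ x‖ ^ 2 = 1) :
    ∑ x, ‖powVec l ψ x‖ ^ 2 = 1 := by
  classical
  have h1 := Finset.prod_univ_sum (fun _ : Fin l => (Finset.univ : Finset ((A × B) × E)))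
    fun _ x => ‖ψ x‖ ^ 2
  rw [Fintype.piFinset_univ] at h1
  simp only [h, Finset.prod_const_one] at h1
  rw [h1]
  let e : (((Fin l → A) × (Fin l → B)) × (Fin l → E)) ≃ (Fin l → (A × B) × E) :=
    { toFun := fun x i => ((x.1.1 i, x.1.2 i), x.2 i)
      invFun := fun y => ((fun i => (y i).1.1, fun i => (y i).1.2), fun i => (y i).2)
      left_inv := fun _ => rfl
      right_inv := fun _ => rfl }
  rw [← e.sum_comp]
  refine Finset.sum_congr rfl fun x _ => ?_
  rw [powVec, norm_prod, Finset.prod_pow]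
  rfl

end

/-- `φ_K ⊗ ψ` for a tripartite vector `ψ`, grouped by subsystems. -/
noncomputable def withMaxEnt (K : ℕ) (ψ : (A × B) × E → ℂ) : ((Fin K × A) × (Fin K × B)) × E → ℂ :=
  fun x => maxEnt K (x.1.1.1, x.1.2.1) * ψ ((x.1.1.2, x.1.2.2), x.2)

lemma sourceVec_eq_withMaxEnt (K l : ℕ) (ψ : (A × B) × E → ℂ) :
    sourceVec K l ψ = withMaxEnt K (powVec l ψ) := rfl

lemma sum_maxEnt_mul_star (K : ℕ) (i j : Fin K) :
    ∑ k, maxEnt K (i, k) * star (maxEnt K (j, k)) = if i = j then ((K : ℂ))⁻¹ else 0 := by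
  have hK : (((√(K : ℝ))⁻¹ : ℝ) : ℂ) * (((√(K : ℝ))⁻¹ : ℝ) : ℂ) = (K : ℂ)⁻¹ := by
    rw [← Complex.ofReal_mul, ← mul_inv, Real.mul_self_sqrt (Nat.cast_nonneg K)]
    push_cast; rfl
  unfold maxEnt
  by_cases h : i = j
  · subst h
    simp only [apply_ite star, star_zero, mul_ite, mul_zero, ite_mul, zero_mul]
    simp only [RCLike.star_def, Complex.conj_ofReal, hK]
    simp
  · rw [if_neg h]
    refine Finset.sum_eq_zero fun k _ => ?_
    by_cases h1 : i = k
    · rw [if_neg (fun h2 : j = k => h (h1.trans h2.symm))]; simp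
    · rw [if_neg h1, zero_mul]

lemma toMatA_withMaxEnt_mul_conjTranspose [Fintype B] [Fintype E] (K : ℕ) (ψ : (A × B) × E → ℂ) :
    toMatA (withMaxEnt K ψ) * (toMatA (withMaxEnt K ψ))ᴴ
      = (K : ℂ)⁻¹ • ((1 : Matrix (Fin K) (Fin K) ℂ) ⊗ₖ (toMatA ψ * (toMatA ψ)ᴴ)) := by
  ext p q
  simp only [toMatA, withMaxEnt, Matrix.mul_apply, Matrix.conjTranspose_apply, Matrix.of_apply,
    Fintype.sum_prod_type, star_mul', Matrix.smul_apply, Matrix.kroneckerMap_apply,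
    Matrix.one_apply, smul_eq_mul]
  calc _ = ∑ k, maxEnt K (p.1, k) * star (maxEnt K (q.1, k)) *
        ∑ b, ∑ e, ψ ((p.2, b), e) * star (ψ ((q.2, b), e)) := by
        refine Finset.sum_congr rfl fun k _ => ?_
        simp only [Finset.mul_sum]
        exact Finset.sum_congr rfl fun b _ => Finset.sum_congr rfl fun e _ => by ring
    _ = _ := by
        rw [← Finset.sum_mul, sum_maxEnt_mul_star]
        split_ifs <;> simp

lemma toMatB_withMaxEnt_mul_conjTranspose [Fintype A] [Fintype E] (K : ℕ) (ψ : (A × B) × E → ℂ) :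
    toMatB (withMaxEnt K ψ) * (toMatB (withMaxEnt K ψ))ᴴ
      = (K : ℂ)⁻¹ • ((1 : Matrix (Fin K) (Fin K) ℂ) ⊗ₖ (toMatB ψ * (toMatB ψ)ᴴ)) := by
  have hsymm : ∀ i j : Fin K, maxEnt K (i, j) = maxEnt K (j, i) := fun i j => by
    simp [maxEnt, eq_comm]
  ext p q
  simp only [toMatB, withMaxEnt, Matrix.mul_apply, Matrix.conjTranspose_apply, Matrix.of_apply,
    Fintype.sum_prod_type, star_mul', Matrix.smul_apply, Matrix.kroneckerMap_apply,
    Matrix.one_apply, smul_eq_mul]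
  calc _ = ∑ k, maxEnt K (p.1, k) * star (maxEnt K (q.1, k)) *
        ∑ b, ∑ e, ψ ((b, p.2), e) * star (ψ ((b, q.2), e)) := by
        refine Finset.sum_congr rfl fun k _ => ?_
        simp only [Finset.mul_sum]
        exact Finset.sum_congr rfl fun b _ => Finset.sum_congr rfl fun e _ => by
          rw [hsymm k, hsymm k]; ring
    _ = _ := by
        rw [← Finset.sum_mul, sum_maxEnt_mul_star]
        split_ifs <;> simp

lemma toMatE_withMaxEnt_mul_conjTranspose [Fintype A] [Fintype B] {K : ℕ} (hK : 0 < K)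
    (ψ : (A × B) × E → ℂ) :
    toMatE (withMaxEnt K ψ) * (toMatE (withMaxEnt K ψ))ᴴ = toMatE ψ * (toMatE ψ)ᴴ := by
  ext p q
  simp only [toMatE, withMaxEnt, Matrix.mul_apply, Matrix.conjTranspose_apply, Matrix.of_apply,
    Fintype.sum_prod_type, star_mul']
  calc _ = ∑ i, ∑ a, ∑ k, maxEnt K (i, k) * star (maxEnt K (i, k)) *
        ∑ b, ψ ((a, b), p) * star (ψ ((a, b), q)) := by
        refine Finset.sum_congr rfl fun i _ => Finset.sum_congr rfl fun a _ =>
          Finset.sum_congr rfl fun k _ => ?_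
        simp only [Finset.mul_sum]
        exact Finset.sum_congr rfl fun b _ => by ring
    _ = _ := by
        simp_rw [← Finset.sum_mul, sum_maxEnt_mul_star]
        rw [Finset.sum_comm]
        refine Finset.sum_congr rfl fun a _ => ?_
        rw [← Finset.sum_mul]
        have : (K : ℂ) ≠ 0 := by exact_mod_cast hK.ne'
        simp [this]

lemma sum_sq_withMaxEnt [Fintype A] [Fintype B] [Fintype E] {K : ℕ} (hK : 0 < K)
    (ψ : (A × B) × E → ℂ) :
    ∑ x, ‖withMaxEnt K ψ x‖ ^ 2 = ∑ x, ‖ψ x‖ ^ 2 := by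
  rw [← hsSq_toMatE, ← hsSq_toMatE]
  have := congrArg Matrix.trace (toMatE_withMaxEnt_mul_conjTranspose hK ψ)
  rw [trace_mul_conjTranspose_self, trace_mul_conjTranspose_self] at this
  exact_mod_cast this

open scoped Matrix.Norms.L2Operator

/-- A maximally mixed ancilla of dimension `K` multiplies the dimension of a typical subspace by `K`
and divides the weights by `K`. -/
lemma IsTypicalSubspace.maxMixed {X : Type*} [Fintype X] {σ : Matrix X X ℂ}
    {R : Type*} [Fintype R] [DecidableEq R] {Y : Matrix X R ℂ} {d μ η : ℝ}
    (h : IsTypicalSubspace σ Y d μ η) {K : ℕ} (hK : 0 < K) :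
    IsTypicalSubspace ((K : ℂ)⁻¹ • ((1 : Matrix (Fin K) (Fin K) ℂ) ⊗ₖ σ))
      ((1 : Matrix (Fin K) (Fin K) ℂ) ⊗ₖ Y) (K * d) (μ / K) η := by
  have hK' : (K : ℂ) ≠ 0 := by exact_mod_cast hK.ne'
  have hYY : ((1 : Matrix (Fin K) (Fin K) ℂ) ⊗ₖ Y)ᴴ
      * ((K : ℂ)⁻¹ • ((1 : Matrix (Fin K) (Fin K) ℂ) ⊗ₖ σ)) * ((1 : Matrix (Fin K) (Fin K) ℂ) ⊗ₖ Y)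
      = (K : ℂ)⁻¹ • ((1 : Matrix (Fin K) (Fin K) ℂ) ⊗ₖ (Yᴴ * σ * Y)) := by
    rw [Matrix.conjTranspose_kronecker, Matrix.mul_smul, Matrix.smul_mul,
      ← Matrix.mul_kronecker_mul, ← Matrix.mul_kronecker_mul, Matrix.conjTranspose_one,
      Matrix.mul_one, Matrix.mul_one]
  refine ⟨?_, ?_, ?_, ?_⟩
  · rw [Matrix.conjTranspose_kronecker, ← Matrix.mul_kronecker_mul, h.isometry,
      Matrix.conjTranspose_one, Matrix.mul_one, Matrix.one_kronecker_one]
  · rw [Fintype.card_prod, Fintype.card_fin]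
    push_cast
    exact mul_le_mul_of_nonneg_left h.card_le (Nat.cast_nonneg K)
  · rw [hYY, norm_smul, norm_inv, Complex.norm_natCast, div_eq_inv_mul]
    exact mul_le_mul_of_nonneg_left ((l2_opNorm_one_kronecker_le _).trans h.norm_le)
      (by positivity)
  · rw [hYY, Matrix.trace_smul, Matrix.trace_smul, Matrix.trace_kronecker, Matrix.trace_kronecker,
      Matrix.trace_one, Fintype.card_fin, smul_eq_mul, smul_eq_mul, inv_mul_cancel_left₀ hK',
      inv_mul_cancel_left₀ hK']
    exact h.tail_le

end Marginals

/-! ### Optimal isometries -/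

section Uhlmann

open scoped Matrix.Norms.L2Operator

variable {m b c : Type*} [Fintype m] [DecidableEq m] [Fintype b] [DecidableEq b]
  [Fintype c] [DecidableEq c]

/-- The inner product of two vectors of `EuclideanSpace`, as an entry of a matrix product. -/
lemma conjTranspose_mul_apply_eq_inner {m b c : Type*} [Fintype c] (M : Matrix c b ℂ)
    (N : Matrix c m ℂ) (i : b) (j : m) :
    (Mᴴ * N) i j = inner ℂ (WithLp.toLp 2 (Mᵀ i)) (WithLp.toLp 2 (Nᵀ j)) := by
  rw [EuclideanSpace.inner_toLp_toLp, Matrix.mul_apply, dotProduct]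
  exact Finset.sum_congr rfl fun k _ => mul_comm _ _

/-- Columns that are orthonormal on a set `s` of indices can be changed off `s` so as to become
orthonormal, provided that there is room. -/
lemma exists_isometry_extension (hbc : Fintype.card b ≤ Fintype.card c) (V : Matrix c b ℂ)
    (s : Set b) (hV : ∀ i ∈ s, ∀ j ∈ s, (Vᴴ * V) i j = if i = j then 1 else 0) :
    ∃ W : Matrix c b ℂ, Wᴴ * W = 1 ∧ ∀ k, ∀ i ∈ s, W k i = V k i := by
  classical
  obtain ⟨f⟩ := Function.Embedding.nonempty_of_card_le hbc
  let v : c → EuclideanSpace ℂ c := fun x =>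
    if h : ∃ i, f i = x then WithLp.toLp 2 (Vᵀ h.choose) else 0
  have hv : ∀ i, v (f i) = WithLp.toLp 2 (Vᵀ i) := by
    intro i
    have h : ∃ j, f j = f i := ⟨i, rfl⟩
    simp only [v, dif_pos h]
    rw [f.injective h.choose_spec]
  have hon : Orthonormal ℂ ((f '' s).domRestrict v) := by
    rw [orthonormal_iff_ite]
    rintro ⟨x, hx⟩ ⟨y, hy⟩
    obtain ⟨i, hi, rfl⟩ := hx
    obtain ⟨j, hj, rfl⟩ := hy
    rw [Set.domRestrict_apply, Set.domRestrict_apply, hv, hv, ← conjTranspose_mul_apply_eq_inner,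
      hV i hi j hj]
    by_cases h : i = j
    · subst h
      rw [if_pos rfl, if_pos rfl]
    · rw [if_neg h, if_neg fun h' => h (f.injective (congrArg Subtype.val h'))]
  obtain ⟨e, he⟩ := hon.exists_orthonormalBasis_extension_of_card_eq (by simp)
  refine ⟨Matrix.of fun k i => e (f i) k, ?_, ?_⟩
  · ext i j
    rw [conjTranspose_mul_apply_eq_inner]
    have := orthonormal_iff_ite.1 e.orthonormal (f i) (f j)
    rw [Matrix.one_apply]
    simp only [f.injective.eq_iff] at this
    exact this
  · intro k i hi
    rw [Matrix.of_apply, he (f i) ⟨i, hi, rfl⟩, hv]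
    rfl

/-- The thin singular value decomposition. -/
lemma exists_svd (hbc : Fintype.card b ≤ Fintype.card c) (Z : Matrix c b ℂ) :
    ∃ (W : Matrix c b ℂ) (s : b → ℝ) (U : Matrix b b ℂ), Wᴴ * W = 1 ∧ (∀ k, 0 ≤ s k) ∧
      Uᴴ * U = 1 ∧ Z = W * Matrix.diagonal (fun k => (s k : ℂ)) * Uᴴ := by
  have hG := Matrix.posSemidef_conjTranspose_mul_self Z
  obtain ⟨U, hU, hU', hd, -⟩ := exists_spectral_decomposition hG.isHermitian
  set lam := hG.isHermitian.eigenvalues with hlam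
  have hlam0 : ∀ k, 0 ≤ lam k := hG.eigenvalues_nonneg
  have hZU : (Z * U)ᴴ * (Z * U) = Matrix.diagonal fun k => (lam k : ℂ) := by
    rw [Matrix.conjTranspose_mul, Matrix.mul_assoc, ← Matrix.mul_assoc Zᴴ]
    conv_lhs => rw [hd]
    simp only [Matrix.mul_assoc]
    rw [hU, Matrix.mul_one, ← Matrix.mul_assoc, hU, Matrix.one_mul]
  set V : Matrix c b ℂ := Matrix.of fun k i => ((√(lam i))⁻¹ : ℝ) * (Z * U) k i with hV
  have hVV : ∀ i j, (Vᴴ * V) i j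
      = ((√(lam i))⁻¹ : ℝ) * ((√(lam j))⁻¹ : ℝ) * ((Z * U)ᴴ * (Z * U)) i j := by
    intro i j
    rw [Matrix.mul_apply, Matrix.mul_apply, Finset.mul_sum]
    refine Finset.sum_congr rfl fun k _ => ?_
    simp only [hV, Matrix.conjTranspose_apply, Matrix.of_apply, star_mul', RCLike.star_def,
      Complex.conj_ofReal]
    ring
  obtain ⟨W, hW, hWV⟩ := exists_isometry_extension hbc V {i | lam i ≠ 0} (by
    intro i hi j hj
    rw [hVV, hZU, Matrix.diagonal_apply]
    split_ifs with h
    · subst h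
      have h0 : √(lam i) ≠ 0 := (Real.sqrt_pos.2 ((hlam0 i).lt_of_ne' hi)).ne'
      rw [← Complex.ofReal_mul, ← Complex.ofReal_mul]
      nth_rewrite 3 [← Real.mul_self_sqrt (hlam0 i)]
      rw [← Complex.ofReal_one]
      congr 1
      field_simp
    · simp)
  refine ⟨W, fun k => √(lam k), U, hW, fun k => Real.sqrt_nonneg _, hU, ?_⟩
  have key : Z * U = W * Matrix.diagonal fun k => ((√(lam k) : ℝ) : ℂ) := by
    ext k i
    rw [Matrix.mul_diagonal]
    by_cases hi : lam i = 0
    · -- the `i`-th column of `Z U` has norm `lam i = 0`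
      have h1 := congrFun (congrFun hZU i) i
      rw [Matrix.diagonal_apply_eq, hi, conjTranspose_mul_apply_eq_inner, Complex.ofReal_zero,
        inner_self_eq_zero] at h1
      have h2 := congrArg (fun v : EuclideanSpace ℂ c => v k) h1
      simp only [hi, Real.sqrt_zero, Complex.ofReal_zero, mul_zero]
      exact h2
    · rw [hWV k i hi, hV, Matrix.of_apply]
      have h0 : ((√(lam i) : ℝ) : ℂ) ≠ 0 := by
        exact_mod_cast (Real.sqrt_pos.2 ((hlam0 i).lt_of_ne' hi)).ne'
      rw [Complex.ofReal_inv]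
      field_simp
  rw [← key, Matrix.mul_assoc, hU', Matrix.mul_one]

lemma norm_trace_mul_le_of_posSemidef {P K : Matrix b b ℂ} (hP : P.PosSemidef) (hK : ‖K‖ ≤ 1) :
    (P * K).trace.re ≤ P.trace.re := by
  obtain ⟨Q, rfl⟩ := CStarAlgebra.nonneg_iff_eq_star_mul_self.1 (Matrix.nonneg_iff_posSemidef.2 hP)
  rw [Matrix.star_eq_conjTranspose] at *
  rw [trace_conjTranspose_mul_self, Complex.ofReal_re, Matrix.mul_assoc]
  have h := norm_trace_conjTranspose_mul_le Q (Q * K)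
  have h2 : √(hsSq (Q * K)) ≤ √(hsSq Q) := Real.sqrt_le_sqrt (hsSq_mul_le_of_contraction' Q hK)
  calc _ ≤ ‖(Qᴴ * (Q * K)).trace‖ := Complex.re_le_norm _
    _ ≤ √(hsSq Q) * √(hsSq Q) := h.trans (mul_le_mul_of_nonneg_left h2 (Real.sqrt_nonneg _))
    _ = hsSq Q := Real.mul_self_sqrt (hsSq_nonneg Q)

/-- Among all contractions `C`, the real part of `tr (Z C)` is maximal at the adjoint of an
isometry. -/
lemma exists_isometry_forall_trace_le (hbc : Fintype.card b ≤ Fintype.card c) (Z : Matrix c b ℂ) :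
    ∃ w : Matrix c b ℂ, wᴴ * w = 1 ∧
      ∀ C : Matrix b c ℂ, ‖C‖ ≤ 1 → (Z * C).trace.re ≤ (Z * wᴴ).trace.re := by
  obtain ⟨W, s, U, hW, hs, hU, rfl⟩ := exists_svd hbc Z
  have hU' : U * Uᴴ = 1 := mul_eq_one_comm.1 hU
  have hD : (Matrix.diagonal fun k => (s k : ℂ)).PosSemidef :=
    Matrix.PosSemidef.diagonal fun k => Complex.zero_le_real.2 (hs k)
  refine ⟨W * Uᴴ, ?_, fun C hC => ?_⟩
  · rw [Matrix.conjTranspose_mul, Matrix.conjTranspose_conjTranspose, Matrix.mul_assoc,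
      ← Matrix.mul_assoc Wᴴ, hW, Matrix.one_mul, hU']
  · have e1 : (W * Matrix.diagonal (fun k => (s k : ℂ)) * Uᴴ * C).trace
        = (Matrix.diagonal (fun k => (s k : ℂ)) * (Uᴴ * C * W)).trace := by
      simp only [Matrix.mul_assoc]
      rw [Matrix.trace_mul_comm]
      simp only [Matrix.mul_assoc]
    have e2 : (W * Matrix.diagonal (fun k => (s k : ℂ)) * Uᴴ * (W * Uᴴ)ᴴ).trace
        = (Matrix.diagonal fun k => (s k : ℂ)).trace := by
      rw [Matrix.conjTranspose_mul, Matrix.conjTranspose_conjTranspose]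
      simp only [Matrix.mul_assoc]
      rw [← Matrix.mul_assoc Uᴴ U, hU, Matrix.one_mul, Matrix.trace_mul_comm, Matrix.mul_assoc, hW,
        Matrix.mul_one]
    rw [e1, e2]
    refine norm_trace_mul_le_of_posSemidef hD ?_
    have hU1 : ‖Uᴴ‖ ≤ 1 := by
      rw [Matrix.l2_opNorm_conjTranspose]; exact l2_opNorm_le_one_of_isometry hU
    calc ‖Uᴴ * C * W‖ ≤ ‖Uᴴ‖ * ‖C‖ * ‖W‖ :=
          (Matrix.l2_opNorm_mul _ _).trans
            (mul_le_mul_of_nonneg_right (Matrix.l2_opNorm_mul _ _) (norm_nonneg _))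
      _ ≤ 1 * 1 * 1 := by
          gcongr
          exact l2_opNorm_le_one_of_isometry hW
      _ = 1 := by norm_num

/-- The polar decomposition `X = √(X X*) V`, with `√(X X*) = X V*`. -/
lemma exists_polar (X : Matrix m b ℂ) :
    ∃ V : Matrix m b ℂ, ‖V‖ ≤ 1 ∧ (X * Vᴴ).PosSemidef ∧ X * Vᴴ * V = X := by
  rcases le_total (Fintype.card b) (Fintype.card m) with h | h
  · obtain ⟨W, s, U, hW, hs, hU, rfl⟩ := exists_svd h X
    have hU' : U * Uᴴ = 1 := mul_eq_one_comm.1 hU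
    have hD : (Matrix.diagonal fun k => (s k : ℂ)).PosSemidef :=
      Matrix.PosSemidef.diagonal fun k => Complex.zero_le_real.2 (hs k)
    have e : W * Matrix.diagonal (fun k => (s k : ℂ)) * Uᴴ * (W * Uᴴ)ᴴ
        = W * Matrix.diagonal (fun k => (s k : ℂ)) * Wᴴ := by
      rw [Matrix.conjTranspose_mul, Matrix.conjTranspose_conjTranspose]
      simp only [Matrix.mul_assoc]
      rw [← Matrix.mul_assoc Uᴴ U, hU, Matrix.one_mul]
    refine ⟨W * Uᴴ, ?_, ?_, ?_⟩
    · refine l2_opNorm_le_one_of_isometry ?_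
      rw [Matrix.conjTranspose_mul, Matrix.conjTranspose_conjTranspose, Matrix.mul_assoc,
        ← Matrix.mul_assoc Wᴴ, hW, Matrix.one_mul, hU']
    · rw [e]; exact hD.mul_mul_conjTranspose_same W
    · rw [e]
      simp only [Matrix.mul_assoc]
      rw [← Matrix.mul_assoc Wᴴ W, hW, Matrix.one_mul]
  · obtain ⟨W, s, U, hW, hs, hU, hX⟩ := exists_svd h Xᴴ
    have hU' : U * Uᴴ = 1 := mul_eq_one_comm.1 hU
    have hD : (Matrix.diagonal fun k => (s k : ℂ)).PosSemidef :=
      Matrix.PosSemidef.diagonal fun k => Complex.zero_le_real.2 (hs k)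
    have hX' : X = U * Matrix.diagonal (fun k => (s k : ℂ)) * Wᴴ := by
      have := congrArg Matrix.conjTranspose hX
      rw [Matrix.conjTranspose_conjTranspose, Matrix.conjTranspose_mul, Matrix.conjTranspose_mul,
        Matrix.conjTranspose_conjTranspose, hD.isHermitian.eq, ← Matrix.mul_assoc] at this
      exact this
    have e : X * (U * Wᴴ)ᴴ = U * Matrix.diagonal (fun k => (s k : ℂ)) * Uᴴ := by
      rw [hX', Matrix.conjTranspose_mul, Matrix.conjTranspose_conjTranspose]
      simp only [Matrix.mul_assoc]
      rw [← Matrix.mul_assoc Wᴴ W, hW, Matrix.one_mul]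
    refine ⟨U * Wᴴ, ?_, ?_, ?_⟩
    · rw [← Matrix.l2_opNorm_conjTranspose]
      refine l2_opNorm_le_one_of_isometry ?_
      rw [Matrix.conjTranspose_conjTranspose, Matrix.conjTranspose_mul,
        Matrix.conjTranspose_conjTranspose, Matrix.mul_assoc, ← Matrix.mul_assoc Wᴴ, hW,
        Matrix.one_mul, hU']
    · rw [e]; exact hD.mul_mul_conjTranspose_same U
    · rw [e, hX']
      simp only [Matrix.mul_assoc]
      rw [← Matrix.mul_assoc Uᴴ U, hU, Matrix.one_mul]

/-- The Powers–Størmer inequality, in variational form. -/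
lemma exists_hsSq_sub_le_trace {A B : Matrix m m ℂ} (hA : A.PosSemidef) (hB : B.PosSemidef) :
    ∃ O : Matrix m m ℂ, ‖O‖ ≤ 1 ∧ hsSq (A - B) ≤ (O * (A * A - B * B)).trace.re := by
  have hS : (A - B).IsHermitian := hA.isHermitian.sub hB.isHermitian
  obtain ⟨U, hU, hU', hd, -⟩ := exists_spectral_decomposition hS
  set s := hS.eigenvalues with hs
  set Sg : Matrix m m ℂ := Matrix.diagonal fun k => ((SignType.sign (s k) : ℝ) : ℂ) with hSg
  set Ds : Matrix m m ℂ := Matrix.diagonal fun k => ((s k : ℝ) : ℂ) with hDs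
  set A' := Uᴴ * A * U with hA'
  set B' := Uᴴ * B * U with hB'
  have hAB : A' - B' = Ds := by
    rw [hA', hB', ← Matrix.sub_mul, ← Matrix.mul_sub, hd]
    simp only [Matrix.mul_assoc]
    rw [hU, Matrix.mul_one, ← Matrix.mul_assoc, hU, Matrix.one_mul]
  have hdiag : ∀ k, (A' k k).re - (B' k k).re = s k := by
    intro k
    have := congrFun (congrFun hAB k) k
    rw [hDs, Matrix.diagonal_apply_eq, Matrix.sub_apply] at this
    rw [← Complex.sub_re, this, Complex.ofReal_re]
  have hA0 : ∀ k, 0 ≤ (A' k k).re := fun k =>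
    (Complex.nonneg_iff.1 ((hA.conjTranspose_mul_mul_same U).diag_nonneg (i := k))).1
  have hB0 : ∀ k, 0 ≤ (B' k k).re := fun k =>
    (Complex.nonneg_iff.1 ((hB.conjTranspose_mul_mul_same U).diag_nonneg (i := k))).1
  refine ⟨U * Sg * Uᴴ, ?_, ?_⟩
  · have hSg1 : ‖Sg‖ ≤ 1 := by
      rw [hSg, Matrix.l2_opNorm_diagonal]
      refine (pi_norm_le_iff_of_nonneg zero_le_one).2 fun k => ?_
      rw [Complex.norm_real]
      rcases lt_trichotomy (s k) 0 with h | h | h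
      · simp [sign_neg h]
      · simp [h]
      · simp [sign_pos h]
    calc ‖U * Sg * Uᴴ‖ ≤ ‖U‖ * ‖Sg‖ * ‖Uᴴ‖ :=
          (Matrix.l2_opNorm_mul _ _).trans
            (mul_le_mul_of_nonneg_right (Matrix.l2_opNorm_mul _ _) (norm_nonneg _))
      _ ≤ 1 * 1 * 1 := by
          rw [Matrix.l2_opNorm_conjTranspose]
          have := l2_opNorm_le_one_of_isometry hU
          gcongr
      _ = 1 := by norm_num
  · have e1 : hsSq (A - B) = ∑ k, s k ^ 2 := by
      have : ((hsSq (A - B) : ℝ) : ℂ) = ((∑ k, s k ^ 2 : ℝ) : ℂ) := by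
        rw [← trace_conjTranspose_mul_self, hS.eq]
        have : (A - B) * (A - B) = U * (Ds * (Ds * Uᴴ)) := by
          rw [hd]
          simp only [Matrix.mul_assoc]
          rw [← Matrix.mul_assoc Uᴴ U, hU, Matrix.one_mul]
        rw [this, Matrix.trace_mul_comm]
        simp only [Matrix.mul_assoc]
        rw [hU, Matrix.mul_one, hDs, Matrix.diagonal_mul_diagonal, Matrix.trace_diagonal]
        push_cast
        exact Finset.sum_congr rfl fun k _ => (sq _).symm
      exact_mod_cast this
    have e2 : (U * Sg * Uᴴ * (A * A - B * B)).trace = (Sg * (A' * A' - B' * B')).trace := by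
      have : A' * A' - B' * B' = Uᴴ * (A * A - B * B) * U := by
        rw [hA', hB', Matrix.mul_sub, Matrix.sub_mul]
        simp only [Matrix.mul_assoc]
        rw [← Matrix.mul_assoc U Uᴴ, hU', Matrix.one_mul, ← Matrix.mul_assoc U Uᴴ, hU',
          Matrix.one_mul]
      rw [this]
      simp only [Matrix.mul_assoc]
      rw [Matrix.trace_mul_comm]
      simp only [Matrix.mul_assoc]
    have e3 : A' * A' - B' * B' = (1 / 2 : ℂ) • (Ds * (A' + B') + (A' + B') * Ds) := by
      rw [← hAB, Matrix.mul_add, Matrix.sub_mul, Matrix.sub_mul, Matrix.add_mul, Matrix.mul_sub,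
        Matrix.mul_sub]
      rw [show A' * A' - B' * A' + (A' * B' - B' * B') + (A' * A' - A' * B' + (B' * A' - B' * B'))
        = (2 : ℂ) • (A' * A' - B' * B') by rw [two_smul]; abel, smul_smul]
      norm_num
    rw [e1, e2, Matrix.trace, Complex.re_sum]
    refine Finset.sum_le_sum fun k _ => ?_
    rw [Matrix.diag_apply, hSg, Matrix.diagonal_mul, e3, Matrix.smul_apply, Matrix.add_apply, hDs,
      Matrix.diagonal_mul, Matrix.mul_diagonal, Matrix.add_apply, smul_eq_mul]
    have e4 : ((SignType.sign (s k) : ℝ) : ℂ) * (1 / 2 * ((s k : ℂ) * (A' k k + B' k k)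
        + (A' k k + B' k k) * (s k : ℂ)))
        = (((SignType.sign (s k) : ℝ) * s k : ℝ) : ℂ) * (A' k k + B' k k) := by
      push_cast; ring
    rw [e4, Complex.re_ofReal_mul, Complex.add_re, sign_mul_self]
    have h1 := hdiag k
    have h2 := hA0 k
    have h3 := hB0 k
    have h4 : |s k| ≤ (A' k k).re + (B' k k).re := by
      rw [abs_le]; constructor <;> linarith
    rw [← sq_abs, sq]
    exact mul_le_mul_of_nonneg_left h4 (abs_nonneg _)

lemma hsSq_sub {m b : Type*} [Fintype m] [Fintype b] (A B : Matrix m b ℂ) :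
    hsSq (A - B) = hsSq A + hsSq B - 2 * (Bᴴ * A).trace.re := by
  have h : (((A - B)ᴴ * (A - B)).trace).re = hsSq (A - B) := by
    rw [trace_conjTranspose_mul_self, Complex.ofReal_re]
  have h1 : ((Aᴴ * A).trace).re = hsSq A := by
    rw [trace_conjTranspose_mul_self, Complex.ofReal_re]
  have h2 : ((Bᴴ * B).trace).re = hsSq B := by
    rw [trace_conjTranspose_mul_self, Complex.ofReal_re]
  have h3 : ((Aᴴ * B).trace).re = ((Bᴴ * A).trace).re := by
    rw [← Complex.conj_re, ← RCLike.star_def, ← Matrix.trace_conjTranspose,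
      Matrix.conjTranspose_mul, Matrix.conjTranspose_conjTranspose]
  rw [← h, Matrix.conjTranspose_sub, Matrix.sub_mul, Matrix.mul_sub, Matrix.mul_sub,
    Matrix.trace_sub, Matrix.trace_sub, Matrix.trace_sub, Complex.sub_re, Complex.sub_re,
    Complex.sub_re, h1, h2, h3]
  ring

/-- A quantitative form of Uhlmann's theorem: if `X X*` and `T T*` are close, then some isometry
takes `X` close to `T`. -/
theorem exists_isometry_trace_ge (hbc : Fintype.card b ≤ Fintype.card c) (X : Matrix m b ℂ)
    (T : Matrix m c ℂ) :
    ∃ (w : Matrix c b ℂ) (O : Matrix m m ℂ), wᴴ * w = 1 ∧ ‖O‖ ≤ 1 ∧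
      hsSq T - (O * (X * Xᴴ - T * Tᴴ)).trace.re ≤ (Tᴴ * X * wᴴ).trace.re := by
  obtain ⟨V, hV, hVp, hVX⟩ := exists_polar X
  obtain ⟨Q, hQ, hQp, hQT⟩ := exists_polar T
  obtain ⟨O, hO, hOle⟩ := exists_hsSq_sub_le_trace hVp hQp
  obtain ⟨w, hw, hmax⟩ := exists_isometry_forall_trace_le hbc (Tᴴ * X)
  have hXX : X * Vᴴ * (X * Vᴴ) = X * Xᴴ := by
    have h1 : X * Vᴴ * (X * Vᴴ) = X * Vᴴ * (X * Vᴴ)ᴴ := by rw [hVp.isHermitian.eq]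
    rw [h1, Matrix.conjTranspose_mul, Matrix.conjTranspose_conjTranspose, ← Matrix.mul_assoc, hVX]
  have hTT : T * Qᴴ * (T * Qᴴ) = T * Tᴴ := by
    have h1 : T * Qᴴ * (T * Qᴴ) = T * Qᴴ * (T * Qᴴ)ᴴ := by rw [hQp.isHermitian.eq]
    rw [h1, Matrix.conjTranspose_mul, Matrix.conjTranspose_conjTranspose, ← Matrix.mul_assoc, hQT]
  have hX2 : hsSq (X * Vᴴ) = hsSq X := by
    have : ((hsSq (X * Vᴴ) : ℝ) : ℂ) = hsSq X := by
      rw [← trace_mul_conjTranspose_self, ← trace_mul_conjTranspose_self, hVp.isHermitian.eq, hXX]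
    exact_mod_cast this
  have hT2 : hsSq (T * Qᴴ) = hsSq T := by
    have : ((hsSq (T * Qᴴ) : ℝ) : ℂ) = hsSq T := by
      rw [← trace_mul_conjTranspose_self, ← trace_mul_conjTranspose_self, hQp.isHermitian.eq, hTT]
    exact_mod_cast this
  rw [hXX, hTT, hsSq_sub, hX2, hT2] at hOle
  have hC : ‖Vᴴ * Q‖ ≤ 1 := by
    refine (Matrix.l2_opNorm_mul _ _).trans ?_
    rw [Matrix.l2_opNorm_conjTranspose]
    exact mul_le_one₀ hV (norm_nonneg _) hQ
  have h1 := hmax _ hC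
  have e1 : (Tᴴ * X * (Vᴴ * Q)).trace = ((T * Qᴴ)ᴴ * (X * Vᴴ)).trace := by
    rw [Matrix.conjTranspose_mul, Matrix.conjTranspose_conjTranspose, ← Matrix.mul_assoc,
      Matrix.trace_mul_comm]
    simp only [Matrix.mul_assoc]
  have hH : ((X * Xᴴ - T * Tᴴ).trace).re = hsSq X - hsSq T := by
    rw [Matrix.trace_sub, trace_mul_conjTranspose_self, trace_mul_conjTranspose_self,
      Complex.sub_re, Complex.ofReal_re, Complex.ofReal_re]
  refine ⟨w, (1 / 2 : ℂ) • (O - 1), hw, ?_, ?_⟩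
  · rw [norm_smul]
    have h2 : ‖O - 1‖ ≤ 1 + 1 := (norm_sub_le _ _).trans (add_le_add hO l2_opNorm_one_le)
    have h3 : ‖(1 / 2 : ℂ)‖ = 1 / 2 := by norm_num
    rw [h3]; linarith
  · refine le_trans ?_ h1
    rw [e1, Matrix.smul_mul, Matrix.trace_smul, Matrix.sub_mul, Matrix.one_mul, Matrix.trace_sub,
      smul_eq_mul]
    have h4 : ((1 / 2 : ℂ) * ((O * (X * Xᴴ - T * Tᴴ)).trace - (X * Xᴴ - T * Tᴴ).trace)).re
        = 1 / 2 * ((O * (X * Xᴴ - T * Tᴴ)).trace.re - (X * Xᴴ - T * Tᴴ).trace.re) := by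
      rw [show (1 / 2 : ℂ) = ((1 / 2 : ℝ) : ℂ) by norm_num, Complex.re_ofReal_mul, Complex.sub_re]
    rw [h4, hH]
    linarith

end Uhlmann

/-! ### Decoupling by random permutations and phases -/

section Decoupling

/-- There is a unitary matrix of size `n` all of whose entries have the same absolute value, namely
the discrete Fourier transform. -/
lemma exists_flat_unitary {P R : Type*} [Fintype P] [DecidableEq P] [Fintype R] [DecidableEq R]
    [Nonempty R] (hPR : Fintype.card P = Fintype.card R) :
    ∃ F : Matrix P R ℂ, Fᴴ * F = 1 ∧ F * Fᴴ = 1 ∧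
      ∀ p a, ‖F p a‖ ^ 2 = (Fintype.card R : ℝ)⁻¹ := by
  set n := Fintype.card R with hn
  have hn0 : n ≠ 0 := Fintype.card_ne_zero
  have : NeZero n := ⟨hn0⟩
  let eP : P ≃ ZMod n := Fintype.equivOfCardEq (by rw [ZMod.card, hPR])
  let eR : R ≃ ZMod n := Fintype.equivOfCardEq (by rw [ZMod.card])
  let G : Matrix (ZMod n) (ZMod n) ℂ :=
    Matrix.of fun x y => (((√(n : ℝ))⁻¹ : ℝ) : ℂ) * ZMod.stdAddChar (x * y)
  have hsq : (((√(n : ℝ))⁻¹ : ℝ) : ℂ) * (((√(n : ℝ))⁻¹ : ℝ) : ℂ) = (n : ℂ)⁻¹ := by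
    rw [← Complex.ofReal_mul, ← mul_inv, Real.mul_self_sqrt (Nat.cast_nonneg n)]
    push_cast; rfl
  have hGG : Gᴴ * G = 1 := by
    ext x y
    rw [Matrix.mul_apply, Matrix.one_apply]
    have h1 : ∀ z, Gᴴ x z * G z y = (n : ℂ)⁻¹ * ZMod.stdAddChar (z * (y - x)) := by
      intro z
      simp only [G, Matrix.conjTranspose_apply, Matrix.of_apply, star_mul', RCLike.star_def,
        Complex.conj_ofReal, ← AddChar.map_neg_eq_conj]
      rw [mul_mul_mul_comm, hsq, ← AddChar.map_add_eq_mul]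
      congr 2
      ring
    simp_rw [h1]
    rw [← Finset.mul_sum, AddChar.sum_mulShift _ (ZMod.isPrimitive_stdAddChar n), ZMod.card]
    by_cases h : x = y
    · rw [if_pos (by rw [h, sub_self]), if_pos h, inv_mul_cancel₀ (by exact_mod_cast hn0)]
    · rw [if_neg (fun h' => h (sub_eq_zero.1 h').symm), if_neg h]
      simp
  have hGG' : G * Gᴴ = 1 := mul_eq_one_comm.1 hGG
  refine ⟨G.submatrix eP eR, ?_, ?_, ?_⟩
  · rw [Matrix.conjTranspose_submatrix, Matrix.submatrix_mul_equiv, hGG,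
      Matrix.submatrix_one_equiv]
  · rw [Matrix.conjTranspose_submatrix, Matrix.submatrix_mul_equiv, hGG',
      Matrix.submatrix_one_equiv]
  · intro p a
    simp only [G, Matrix.submatrix_apply, Matrix.of_apply]
    rw [norm_mul, AddChar.norm_apply, mul_one, Complex.norm_real, Real.norm_eq_abs, sq_abs,
      inv_pow, Real.sq_sqrt (Nat.cast_nonneg n)]

variable {R : Type*}

/-- The character `θ ↦ exp (2 π i ⟨e, θ⟩ / 3)` of `(ℤ/3)^R`. -/
noncomputable def phaseChar [Fintype R] (e θ : R → ZMod 3) : ℂ := ZMod.stdAddChar (∑ a, θ a * e a)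

lemma phaseChar_mul_star [Fintype R] (e e' θ : R → ZMod 3) :
    phaseChar e θ * star (phaseChar e' θ) = phaseChar (e - e') θ := by
  rw [phaseChar, phaseChar, phaseChar, RCLike.star_def, ← AddChar.map_neg_eq_conj,
    ← AddChar.map_add_eq_mul, ← Finset.sum_neg_distrib, ← Finset.sum_add_distrib]
  congr 1
  exact Finset.sum_congr rfl fun a _ => by rw [Pi.sub_apply]; ring

lemma sum_phaseChar [Fintype R] [DecidableEq R] {e : R → ZMod 3} (he : e ≠ 0) :
    ∑ θ, phaseChar e θ = 0 := by
  obtain ⟨c, hc⟩ := Function.ne_iff.1 he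
  have h : ∀ θ : R → ZMod 3, phaseChar e θ = ∏ a, ZMod.stdAddChar (θ a * e a) := fun θ => by
    rw [phaseChar]
    exact map_prod (ZMod.stdAddChar (N := 3)).toMonoidHom
      (fun a => Multiplicative.ofAdd (θ a * e a)) Finset.univ
  simp_rw [h]
  have := Finset.prod_univ_sum (fun _ : R => (Finset.univ : Finset (ZMod 3)))
    fun a x => (ZMod.stdAddChar (x * e a) : ℂ)
  rw [Fintype.piFinset_univ] at this
  rw [← this]
  refine Finset.prod_eq_zero (Finset.mem_univ c) ?_
  rw [AddChar.sum_mulShift _ (ZMod.isPrimitive_stdAddChar 3), if_neg (show ¬ e c = 0 from hc), Nat.cast_zero]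

/-- Parseval's identity for characters of `(ℤ/3)^R`. -/
lemma sum_norm_sq_phaseChar [Fintype R] [DecidableEq R] {S : Type*} [Fintype S] {e : S → R → ZMod 3}
    (he : Function.Injective e) (c : S → ℂ) :
    ∑ θ, ‖∑ s, c s * phaseChar (e s) θ‖ ^ 2
      = Fintype.card (R → ZMod 3) * ∑ s, ‖c s‖ ^ 2 := by
  classical
  have key : ((∑ θ, ‖∑ s, c s * phaseChar (e s) θ‖ ^ 2 : ℝ) : ℂ)
      = ((Fintype.card (R → ZMod 3) * ∑ s, ‖c s‖ ^ 2 : ℝ) : ℂ) := by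
    push_cast
    have h1 : ∀ θ, ((‖∑ s, c s * phaseChar (e s) θ‖ : ℂ)) ^ 2
        = ∑ s, ∑ t, c s * star (c t) * phaseChar (e s - e t) θ := by
      intro θ
      rw [← Complex.mul_conj', ← RCLike.star_def, star_sum, Finset.sum_mul_sum]
      refine Finset.sum_congr rfl fun s _ => Finset.sum_congr rfl fun t _ => ?_
      rw [← phaseChar_mul_star, star_mul']
      ring
    simp_rw [h1]
    rw [Finset.sum_comm, Finset.mul_sum]
    refine Finset.sum_congr rfl fun s _ => ?_
    rw [Finset.sum_comm, Finset.sum_eq_single s]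
    · rw [← Finset.mul_sum, RCLike.star_def, Complex.mul_conj']
      simp [phaseChar, mul_comm]
    · intro t _ ht
      rw [← Finset.mul_sum, sum_phaseChar (sub_ne_zero.2 fun h => ht (he h).symm), mul_zero]
    · exact fun h => absurd (Finset.mem_univ s) h
  exact_mod_cast key

/-- The exponents of the phase products `θ_a θ̄_b`, `a ≠ b`, and of the trivial product. Three
different values per phase suffice to tell them apart. -/
def phaseExponent [DecidableEq R] : Option {p : R × R // p.1 ≠ p.2} → R → ZMod 3
  | none => 0
  | some p => Pi.single p.1.1 1 - Pi.single p.1.2 1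

lemma phaseExponent_injective [DecidableEq R] : Function.Injective (phaseExponent (R := R)) := by
  have h10 : (1 : ZMod 3) ≠ 0 := by decide
  have h11 : (-1 : ZMod 3) ≠ 1 := by decide
  have hne : ∀ p : {p : R × R // p.1 ≠ p.2}, phaseExponent (some p) p.1.1 = 1 := fun p => by
    simp [phaseExponent, p.2]
  have hne2 : ∀ p : {p : R × R // p.1 ≠ p.2}, phaseExponent (some p) p.1.2 = -1 := fun p => by
    simp [phaseExponent, p.2.symm]
  rintro (_ | ⟨⟨a, b⟩, hp⟩) (_ | ⟨⟨a', b'⟩, hq⟩) h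
  · rfl
  · exact absurd ((hne ⟨(a', b'), hq⟩).symm.trans (congrFun h.symm a')) h10
  · exact absurd ((hne ⟨(a, b), hp⟩).symm.trans (congrFun h a)) h10
  · have h1 := (hne ⟨(a, b), hp⟩).symm.trans (congrFun h a)
    have h2 := (hne2 ⟨(a, b), hp⟩).symm.trans (congrFun h b)
    simp only at hp hq
    simp only [phaseExponent, Pi.sub_apply, Pi.single_apply] at h1 h2
    have haa : a = a' := by
      by_contra hc
      rw [if_neg hc] at h1
      split_ifs at h1 <;> revert h1 <;> decide
    have hbb : b = b' := by
      by_contra hc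
      rw [if_neg hc, if_neg (fun hb => hp (haa.trans hb.symm))] at h2
      revert h2; decide
    subst haa hbb
    rfl

/-- The average over independent random phases of a quadratic expression. -/
lemma sum_norm_sq_phases [Fintype R] [DecidableEq R] (d : ℂ) (c : R → R → ℂ) :
    ∑ θ : R → ZMod 3, ‖d + ∑ a, ∑ b, (if a = b then 0 else
        c a b * (ZMod.stdAddChar (θ a) * star (ZMod.stdAddChar (θ b) : ℂ)))‖ ^ 2
      = Fintype.card (R → ZMod 3)
        * (‖d‖ ^ 2 + ∑ a, ∑ b, if a = b then 0 else ‖c a b‖ ^ 2) := by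
  have hsub : ∀ {M : Type} [AddCommMonoid M] (f : R → R → M),
      ∑ a, ∑ b, (if a = b then 0 else f a b)
        = ∑ p : {p : R × R // p.1 ≠ p.2}, f p.1.1 p.1.2 := by
    intro M _ f
    rw [← Fintype.sum_prod_type' (fun a b => if a = b then 0 else f a b),
      ← Finset.sum_subtype (Finset.univ.filter fun p : R × R => p.1 ≠ p.2) (by simp)
        (fun p => f p.1 p.2), Finset.sum_filter]
    simp only [ne_eq, ite_not]
  have h := sum_norm_sq_phaseChar phaseExponent_injective
    (fun s : Option {p : R × R // p.1 ≠ p.2} => s.elim d fun p => c p.1.1 p.1.2)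
  simp only [Fintype.sum_option, Option.elim] at h
  rw [hsub, ← h]
  refine Finset.sum_congr rfl fun θ _ => ?_
  rw [hsub]
  congr 3
  · simp [phaseChar, phaseExponent]
  · refine Finset.sum_congr rfl fun p _ => ?_
    congr 1
    rw [phaseChar, RCLike.star_def, ← AddChar.map_neg_eq_conj, ← AddChar.map_add_eq_mul]
    congr 1
    simp [phaseExponent, mul_sub, Finset.sum_sub_distrib, Pi.single_apply, ← sub_eq_add_neg]

/-- The group of permutations acts doubly transitively. -/
lemma sum_perm_apply_pair {P : Type*} [Fintype P] [DecidableEq P] (f : P → P → ℝ) {p q : P}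
    (hpq : p ≠ q) :
    (Fintype.card P : ℝ) * (Fintype.card P - 1) * ∑ π : Equiv.Perm P, f (π p) (π q)
      = Fintype.card (Equiv.Perm P) * ∑ x, ∑ y, if x = y then 0 else f x y := by
  have hT : ∀ x y, x ≠ y → ∑ π : Equiv.Perm P, f (π x) (π y) = ∑ π : Equiv.Perm P, f (π p) (π q) := by
    intro x y hxy
    obtain ⟨σ, h1, h2⟩ : ∃ σ : Equiv.Perm P, σ x = p ∧ σ y = q := by
      refine ⟨Equiv.swap (Equiv.swap x p y) q * Equiv.swap x p, ?_, ?_⟩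
      · rw [Equiv.Perm.mul_apply, Equiv.swap_apply_left, Equiv.swap_apply_of_ne_of_ne _ hpq]
        intro h
        apply hxy
        have := congrArg (Equiv.swap x p) h
        rwa [Equiv.swap_apply_right, Equiv.swap_apply_self] at this
      · rw [Equiv.Perm.mul_apply, Equiv.swap_apply_left]
    rw [← Equiv.sum_comp (Equiv.mulRight σ)]
    refine Finset.sum_congr rfl fun π _ => ?_
    simp [h1, h2]
  have h1 : ∑ x, ∑ y, (if x = y then 0 else ∑ π : Equiv.Perm P, f (π x) (π y))
      = (Fintype.card P : ℝ) * (Fintype.card P - 1) * ∑ π : Equiv.Perm P, f (π p) (π q) := by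
    have : ∀ x y, (if x = y then 0 else ∑ π : Equiv.Perm P, f (π x) (π y))
        = (1 - if x = y then (1 : ℝ) else 0) * ∑ π : Equiv.Perm P, f (π p) (π q) := by
      intro x y
      split_ifs with h
      · simp
      · rw [hT x y h]; ring
    simp_rw [this, ← Finset.sum_mul]
    congr 1
    simp [Finset.sum_sub_distrib]
    ring
  rw [← h1]
  have h2 : ∀ π : Equiv.Perm P, ∑ x, ∑ y, (if x = y then 0 else f (π x) (π y))
      = ∑ x, ∑ y, if x = y then 0 else f x y := by
    intro π
    rw [← Equiv.sum_comp π fun x => ∑ y, if x = y then 0 else f x y]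
    refine Finset.sum_congr rfl fun x _ => ?_
    rw [← Equiv.sum_comp π fun y => if π x = y then 0 else f (π x) y]
    simp
  calc _ = ∑ x, ∑ y, ∑ π : Equiv.Perm P, (if x = y then 0 else f (π x) (π y)) := by
        refine Finset.sum_congr rfl fun x _ => Finset.sum_congr rfl fun y _ => ?_
        split_ifs <;> simp
    _ = ∑ π : Equiv.Perm P, ∑ x, ∑ y, (if x = y then 0 else f (π x) (π y)) := by
        simp_rw [Finset.sum_comm (s := (Finset.univ : Finset P))
          (t := (Finset.univ : Finset (Equiv.Perm P)))]
    _ = _ := by simp_rw [h2]; simp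

/-- The rows of a flat unitary matrix `F`, permuted at random and with random phases on the
columns. -/
noncomputable def scramble {P : Type*} (F : Matrix P R ℂ) (g : Equiv.Perm P × (R → ZMod 3)) :
    Matrix P R ℂ :=
  Matrix.of fun p a => F (g.1 p) a * ZMod.stdAddChar (g.2 a)

section Average

lemma scramble_mul_conjTranspose {P : Type*} [DecidableEq P] [Fintype R] {F : Matrix P R ℂ}
    (hF : F * Fᴴ = 1)
    (g : Equiv.Perm P × (R → ZMod 3)) : scramble F g * (scramble F g)ᴴ = 1 := by
  ext p q
  have h : ∀ a, scramble F g p a * (scramble F g)ᴴ a q = F (g.1 p) a * Fᴴ a (g.1 q) := by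
    intro a
    simp only [scramble, Matrix.conjTranspose_apply, Matrix.of_apply, star_mul', RCLike.star_def]
    rw [mul_mul_mul_comm, Complex.mul_conj', AddChar.norm_apply]
    simp
  rw [Matrix.mul_apply]
  simp_rw [h]
  rw [← Matrix.mul_apply, hF, Matrix.one_apply, Matrix.one_apply]
  simp

lemma sum_norm_sq_scramble_apply {P : Type*} [Fintype R] [DecidableEq R] {F : Matrix P R ℂ}
    (X : Matrix R R ℂ) (t : ℂ)
    (hflat : ∀ p a, ‖F p a‖ ^ 2 = (Fintype.card R : ℝ)⁻¹) (p q : P) (π : Equiv.Perm P) :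
    ∑ θ : R → ZMod 3, ‖(scramble F (π, θ) * X * (scramble F (π, θ))ᴴ) p q - t‖ ^ 2
      = Fintype.card (R → ZMod 3) * (‖∑ a, F (π p) a * star (F (π q) a) * X a a - t‖ ^ 2
        + ((Fintype.card R : ℝ)⁻¹) ^ 2 * ∑ a, ∑ b, if a = b then 0 else ‖X a b‖ ^ 2) := by
  have h := sum_norm_sq_phases (∑ a, F (π p) a * star (F (π q) a) * X a a - t)
    (fun a b => F (π p) a * X a b * star (F (π q) b))
  have e1 : ∀ a b, ‖F (π p) a * X a b * star (F (π q) b)‖ ^ 2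
      = ((Fintype.card R : ℝ)⁻¹) ^ 2 * ‖X a b‖ ^ 2 := by
    intro a b
    rw [norm_mul, norm_mul, norm_star, mul_pow, mul_pow, hflat, hflat]
    ring
  simp only [e1, Finset.mul_sum, mul_ite, mul_zero] at h ⊢
  rw [← h]
  refine Finset.sum_congr rfl fun θ _ => ?_
  congr 2
  have e2 : (scramble F (π, θ) * X * (scramble F (π, θ))ᴴ) p q
      = ∑ a, ∑ b, F (π p) a * X a b * star (F (π q) b)
        * (ZMod.stdAddChar (θ a) * star (ZMod.stdAddChar (θ b) : ℂ)) := by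
    simp only [Matrix.mul_apply, scramble, Matrix.conjTranspose_apply, Matrix.of_apply, star_mul',
      Finset.sum_mul]
    rw [Finset.sum_comm]
    refine Finset.sum_congr rfl fun a _ => Finset.sum_congr rfl fun b _ => ?_
    ring
  have e3 : ∀ a, ∑ b, F (π p) a * X a b * star (F (π q) b)
        * (ZMod.stdAddChar (θ a) * star (ZMod.stdAddChar (θ b) : ℂ))
      = F (π p) a * star (F (π q) a) * X a a + ∑ b, if a = b then 0 else
        F (π p) a * X a b * star (F (π q) b)
        * (ZMod.stdAddChar (θ a) * star (ZMod.stdAddChar (θ b) : ℂ)) := by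
    intro a
    rw [← Finset.add_sum_erase _ _ (Finset.mem_univ a),
      ← Finset.add_sum_erase (f := fun b => if a = b then _ else _) _ (Finset.mem_univ a),
      if_pos rfl, zero_add]
    congr 1
    · rw [RCLike.star_def, Complex.mul_conj', AddChar.norm_apply]
      push_cast
      ring
    · refine Finset.sum_congr rfl fun b hb => ?_
      rw [if_neg (Finset.ne_of_mem_erase hb).symm]
  rw [e2]
  simp_rw [e3]
  rw [Finset.sum_add_distrib]
  ring

variable {P : Type*} [Fintype P] [DecidableEq P] [Fintype R] [DecidableEq R]

/-- Decoupling: on average, a block of `L` rows of a scrambled flat unitary maps every operator `X`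
close to a multiple of the identity, in Hilbert–Schmidt norm. -/
lemma sum_hsSq_scramble_le {F : Matrix P R ℂ} (hF : Fᴴ * F = 1)
    (hflat : ∀ p a, ‖F p a‖ ^ 2 = (Fintype.card R : ℝ)⁻¹)
    (hPR : Fintype.card P = Fintype.card R)
    {L : ℕ} {row : Fin L → P} (hrow : Function.Injective row) (X : Matrix R R ℂ) :
    ∑ g, hsSq (((scramble F g).submatrix row id) * X * ((scramble F g).submatrix row id)ᴴ
        - ((Fintype.card R : ℂ)⁻¹ * X.trace) • (1 : Matrix (Fin L) (Fin L) ℂ))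
      ≤ Fintype.card (Equiv.Perm P × (R → ZMod 3)) * (((L : ℝ) / Fintype.card R) ^ 2 * hsSq X) := by
  set n := Fintype.card R with hn
  set NP : ℝ := (Fintype.card (Equiv.Perm P) : ℝ) with hNP
  set NT : ℝ := (Fintype.card (R → ZMod 3) : ℝ) with hNT
  set off : ℝ := ∑ a, ∑ b, if a = b then 0 else ‖X a b‖ ^ 2 with hoff
  set dg : ℝ := ∑ a, ‖X a a‖ ^ 2 with hdg
  have hX : hsSq X = dg + off := by
    rw [hsSq, hdg, hoff, ← Finset.sum_add_distrib]
    refine Finset.sum_congr rfl fun a _ => ?_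
    rw [← Finset.add_sum_erase _ _ (Finset.mem_univ a),
      ← Finset.add_sum_erase (f := fun b => if a = b then (0 : ℝ) else _) _ (Finset.mem_univ a),
      if_pos rfl, zero_add]
    congr 1
    exact Finset.sum_congr rfl fun b hb => by rw [if_neg (Finset.ne_of_mem_erase hb).symm]
  have hoff0 : 0 ≤ off := Finset.sum_nonneg fun a _ => Finset.sum_nonneg fun b _ => by
    split_ifs
    · exact le_rfl
    · exact sq_nonneg _
  have hdg0 : 0 ≤ dg := Finset.sum_nonneg fun a _ => sq_nonneg _
  have hNT0 : 0 ≤ NT := Nat.cast_nonneg _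
  have hNP0 : 0 ≤ NP := Nat.cast_nonneg _
  set f : P → P → ℝ := fun x y => ‖∑ a, F x a * star (F y a) * X a a‖ ^ 2 with hf
  have hfsum : ∑ x, ∑ y, (if x = y then 0 else f x y) ≤ dg := by
    have h1 : ∑ x, ∑ y, f x y = dg := by
      have e : ∑ x, ∑ y, f x y = hsSq (F * (Matrix.diagonal (fun a => X a a) * Fᴴ)) := by
        simp only [hf, hsSq, Matrix.mul_apply (M := F), Matrix.diagonal_mul,
          Matrix.conjTranspose_apply]
        refine Finset.sum_congr rfl fun x _ => Finset.sum_congr rfl fun y _ => ?_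
        congr 2
        exact Finset.sum_congr rfl fun a _ => by ring
      rw [e, hsSq_isometry_mul hF, ← hsSq_conjTranspose, Matrix.conjTranspose_mul,
        Matrix.conjTranspose_conjTranspose, hsSq_isometry_mul hF, hsSq_conjTranspose, hdg, hsSq]
      refine Finset.sum_congr rfl fun a _ => ?_
      rw [Finset.sum_eq_single a]
      · simp
      · intro b _ hb; rw [Matrix.diagonal_apply_ne _ hb.symm]; simp
      · simp
    rw [← h1]
    refine Finset.sum_le_sum fun x _ => Finset.sum_le_sum fun y _ => ?_
    split_ifs
    · exact sq_nonneg _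
    · exact le_rfl
  -- the average of each entry, over permutations and phases
  have hentry : ∀ r s : Fin L, ∑ g, ‖(scramble F g * X * (scramble F g)ᴴ) (row r) (row s)
      - (if r = s then (n : ℂ)⁻¹ * X.trace else 0)‖ ^ 2
      = NT * ((∑ π : Equiv.Perm P, if r = s then 0 else f (π (row r)) (π (row s)))
        + NP * ((n : ℝ)⁻¹ ^ 2 * off)) := by
    intro r s
    rw [Fintype.sum_prod_type]
    simp_rw [sum_norm_sq_scramble_apply X _ hflat]
    rw [← Finset.mul_sum, Finset.sum_add_distrib, Finset.sum_const, Finset.card_univ,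
      nsmul_eq_mul]
    congr 2
    refine Finset.sum_congr rfl fun π _ => ?_
    by_cases h : r = s
    · subst h
      rw [if_pos rfl, if_pos rfl, Matrix.trace, Finset.mul_sum]
      have : ∀ a, F (π (row r)) a * star (F (π (row r)) a) = (n : ℂ)⁻¹ := by
        intro a
        rw [RCLike.star_def, Complex.mul_conj', ← Complex.ofReal_pow, hflat]
        push_cast; rfl
      have e : ∑ a, F (π (row r)) a * star (F (π (row r)) a) * X a a
          = ∑ a, (n : ℂ)⁻¹ * X.diag a :=
        Finset.sum_congr rfl fun a _ => by rw [this]; rfl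
      rw [e, sub_self]
      simp
    · rw [if_neg h, if_neg h, sub_zero]
  have hperm : ∀ r s : Fin L, r ≠ s → (n : ℝ) * (n - 1) *
      ∑ π : Equiv.Perm P, f (π (row r)) (π (row s)) ≤ NP * dg := by
    intro r s hrs
    have := sum_perm_apply_pair f (hrow.ne hrs)
    rw [hPR] at this
    rw [this]
    exact mul_le_mul_of_nonneg_left hfsum hNP0
  have hLn : L ≤ n := by
    have := Fintype.card_le_of_injective row hrow
    rwa [Fintype.card_fin, hPR] at this
  have hLHS : ∑ g, hsSq (((scramble F g).submatrix row id) * X * ((scramble F g).submatrix row id)ᴴ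
        - ((n : ℂ)⁻¹ * X.trace) • (1 : Matrix (Fin L) (Fin L) ℂ))
      = ∑ r : Fin L, ∑ s : Fin L,
        NT * ((∑ π : Equiv.Perm P, if r = s then 0 else f (π (row r)) (π (row s)))
        + NP * ((n : ℝ)⁻¹ ^ 2 * off)) := by
    simp_rw [← hentry]
    simp only [hsSq]
    rw [Finset.sum_comm]
    refine Finset.sum_congr rfl fun r _ => ?_
    rw [Finset.sum_comm]
    refine Finset.sum_congr rfl fun s _ => Finset.sum_congr rfl fun g _ => ?_
    congr 2
    rw [Matrix.sub_apply, Matrix.smul_apply, Matrix.one_apply, smul_eq_mul, mul_ite, mul_one,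
      mul_zero]
    rfl
  rw [hLHS]
  have hcardg : (Fintype.card (Equiv.Perm P × (R → ZMod 3)) : ℝ) = NP * NT := by
    rw [Fintype.card_prod]; push_cast; rfl
  rw [hcardg, hX]
  rcases Nat.eq_zero_or_pos L with hL0 | hL0
  · subst hL0
    simp
  have hL1 : (1 : ℝ) ≤ L := by exact_mod_cast hL0
  have hn1 : (1 : ℝ) ≤ n := by exact_mod_cast hL0.trans_le hLn
  have hLn' : (L : ℝ) ≤ n := by exact_mod_cast hLn
  -- each off-diagonal entry contributes at most `c`
  obtain ⟨c, hc0, hcpair, hcle⟩ : ∃ c : ℝ, 0 ≤ c ∧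
      (∀ r s : Fin L, r ≠ s → ∑ π : Equiv.Perm P, f (π (row r)) (π (row s)) ≤ c) ∧
      (L : ℝ) * (L - 1) * c ≤ ((L : ℝ) / n) ^ 2 * (NP * dg) := by
    rcases lt_or_eq_of_le (show 1 ≤ L from hL0) with h | h
    · have hn2 : (1 : ℝ) < n := lt_of_lt_of_le (by exact_mod_cast h) hLn'
      have hpos : (0 : ℝ) < n * (n - 1) := by nlinarith
      refine ⟨NP * dg / (n * (n - 1)), by positivity, fun r s hrs => ?_, ?_⟩
      · rw [le_div_iff₀ hpos, mul_comm]
        exact hperm r s hrs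
      · rw [div_pow, ← mul_div_assoc, div_mul_eq_mul_div, div_le_div_iff₀ hpos (by positivity)]
        have hNd : 0 ≤ NP * dg := mul_nonneg hNP0 hdg0
        have h1 : (L : ℝ) * (L - 1) * n ^ 2 ≤ L ^ 2 * (n * (n - 1)) := by
          have : (L : ℝ) * n * ((L - 1) * n) ≤ L * n * (L * (n - 1)) :=
            mul_le_mul_of_nonneg_left (by nlinarith) (by positivity)
          nlinarith
        nlinarith [mul_le_mul_of_nonneg_right h1 hNd]
    · refine ⟨0, le_rfl, fun r s hrs => ?_, ?_⟩
      · have hLs : L = 1 := h.symm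
        subst hLs
        exact absurd (Subsingleton.elim r s) hrs
      · rw [mul_zero]; positivity
  have hterm : ∀ r s : Fin L,
      NT * ((∑ π : Equiv.Perm P, if r = s then 0 else f (π (row r)) (π (row s)))
        + NP * ((n : ℝ)⁻¹ ^ 2 * off))
      ≤ NT * ((1 - if r = s then (1 : ℝ) else 0) * c + NP * ((n : ℝ)⁻¹ ^ 2 * off)) := by
    intro r s
    refine mul_le_mul_of_nonneg_left (add_le_add_left ?_ _) hNT0
    by_cases h : r = s
    · simp [h]
    · simp only [if_neg h]
      simpa using hcpair r s h
  refine (Finset.sum_le_sum fun r _ => Finset.sum_le_sum fun s _ => hterm r s).trans ?_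
  have hsum : ∑ r : Fin L, ∑ s : Fin L,
      NT * ((1 - if r = s then (1 : ℝ) else 0) * c + NP * ((n : ℝ)⁻¹ ^ 2 * off))
      = NT * ((L : ℝ) * (L - 1) * c + L ^ 2 * (NP * ((n : ℝ)⁻¹ ^ 2 * off))) := by
    simp_rw [← Finset.mul_sum]
    congr 1
    simp_rw [Finset.sum_add_distrib, ← Finset.sum_mul, Finset.sum_sub_distrib]
    simp
    ring
  rw [hsum]
  calc NT * ((L : ℝ) * (L - 1) * c + L ^ 2 * (NP * ((n : ℝ)⁻¹ ^ 2 * off)))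
      ≤ NT * (((L : ℝ) / n) ^ 2 * (NP * dg) + L ^ 2 * (NP * ((n : ℝ)⁻¹ ^ 2 * off))) :=
        mul_le_mul_of_nonneg_left (add_le_add_left hcle _) hNT0
    _ = NP * NT * (((L : ℝ) / n) ^ 2 * (dg + off)) := by
        rw [div_eq_mul_inv]; ring

end Average

end Decoupling

/-! ### Mergings from orthonormal families -/

section Instrument

lemma isCP_sum_conjMap {X Y κ : Type*} [Fintype X] [Fintype Y] (s : Finset κ)
    (a : κ → Matrix Y X ℂ) : IsCP (∑ k ∈ s, conjMap (a k)) := by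
  intro n T hT
  rw [tensorId_sum]
  refine Matrix.posSemidef_sum _ fun k _ => ?_
  rw [tensorId_conjMap]
  exact hT.mul_mul_conjTranspose_same _

lemma trace_sum_conjMap {X Y κ : Type*} [Fintype X] [Fintype Y] (s : Finset κ)
    (a : κ → Matrix Y X ℂ) (T : Matrix X X ℂ) :
    ((∑ k ∈ s, conjMap (a k)) T).trace = ((∑ k ∈ s, (a k)ᴴ * a k) * T).trace := by
  rw [LinearMap.sum_apply, Matrix.trace_sum, Matrix.sum_mul, Matrix.trace_sum]
  refine Finset.sum_congr rfl fun k _ => ?_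
  rw [conjMap_apply, Matrix.trace_mul_comm, ← Matrix.mul_assoc]

lemma isChannel_conjMap {X Y : Type*} [Fintype X] [DecidableEq X] [Fintype Y]
    {u : Matrix Y X ℂ} (hu : uᴴ * u = 1) : IsChannel (conjMap u) := by
  have h := isCP_sum_conjMap (Finset.univ : Finset Unit) (fun _ => u)
  have h' := trace_sum_conjMap (Finset.univ : Finset Unit) (fun _ => u)
  simp only [Finset.univ_unique, Finset.sum_singleton] at h h'
  exact ⟨h, fun T => by rw [h', hu, Matrix.one_mul]⟩

lemma tensor_conjMap {A A' B B' : Type*} [Fintype A] [Fintype B] (a : Matrix A' A ℂ)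
    (u : Matrix B' B ℂ) : tensor (conjMap a) (conjMap u) = conjMap (a ⊗ₖ u) := by
  classical
  have key : ∀ (X : Matrix A A ℂ) (Y : Matrix B B ℂ),
      tensor (conjMap a) (conjMap u) (X ⊗ₖ Y) = conjMap (a ⊗ₖ u) (X ⊗ₖ Y) := by
    intro X Y
    rw [tensor_kronecker, conjMap_apply, conjMap_apply, conjMap_apply,
      Matrix.conjTranspose_kronecker, ← Matrix.mul_kronecker_mul, ← Matrix.mul_kronecker_mul]
  refine Matrix.ext_linearMap _ fun p q => LinearMap.ext_ring ?_
  have h : Matrix.single p q (1 : ℂ) = Matrix.single p.1 q.1 1 ⊗ₖ Matrix.single p.2 q.2 1 := by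
    rw [Matrix.single_kronecker_single, mul_one]
  simp only [LinearMap.comp_apply, Matrix.singleLinearMap_apply, h]
  exact key _ _

/-- If `B`'s isometry depends on `A`'s outcome only through its class, then it suffices to send the
class. -/
lemma isOneWayLOCC_sum_conjMap {A A' B B' κ : Type*} [Fintype A] [DecidableEq A] [Fintype A']
    [Fintype B] [DecidableEq B] [Fintype B'] [Fintype κ] {D : ℕ} (f : κ → Fin D)
    {a : κ → Matrix A' A ℂ} (ha : ∑ k, (a k)ᴴ * a k = 1) {u : Fin D → Matrix B' B ℂ}
    (hu : ∀ d, (u d)ᴴ * u d = 1) :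
    IsOneWayLOCC D (∑ k, conjMap (a k ⊗ₖ u (f k))) := by
  classical
  refine ⟨fun d => ∑ k with f k = d, conjMap (a k), fun d => conjMap (u d),
    ⟨fun d => isCP_sum_conjMap _ _, fun T => ?_⟩, fun d => isChannel_conjMap (hu d), ?_⟩
  · rw [Finset.sum_fiberwise, trace_sum_conjMap, ha, Matrix.one_mul]
  · have h : ∀ d, tensor (∑ k with f k = d, conjMap (a k)) (conjMap (u d))
        = ∑ k with f k = d, conjMap (a k ⊗ₖ u (f k)) := by
      intro d
      refine LinearMap.ext fun T => ?_
      rw [tensor, LinearMap.comp_apply, tensorId_sum, LinearMap.sum_apply]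
      refine Finset.sum_congr rfl fun k hk => ?_
      rw [← tensor_conjMap, (Finset.mem_filter.1 hk).2]
      rfl
    simp_rw [h]
    rw [Finset.sum_fiberwise]

/-- An orthonormal family of `J` blocks of `L` vectors extends to an `L`-instrument in which these
blocks are the initial spaces of the first `J` operators of rank `L`. -/
lemma exists_isLInstrument {A : Type*} [Fintype A] [DecidableEq A] {L J : ℕ} (hL : 0 < L)
    (b : Fin J → Matrix (Fin L) A ℂ)
    (hb : ∀ j j', b j * (b j')ᴴ = if j = j' then 1 else 0) :
    ∃ (a : Fin (Fintype.card A / L + 1) → Matrix (Fin L) A ℂ)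
      (f : Fin (Fintype.card A / L + 1) → Fin (J + 1))
      (e : Fin J → Fin (Fintype.card A / L + 1)),
      IsLInstrument L a ∧ ∑ k, (a k)ᴴ * a k = 1 ∧ Function.Injective e ∧
      ∀ j, f (e j) = j.castSucc ∧ a (e j) = b j := by
  classical
  set N := Fintype.card A with hN
  set D := N / L with hD
  have hJ : J ≤ D := by
    rw [hD, Nat.le_div_iff_mul_le hL]
    let Q : Matrix (Fin J × Fin L) A ℂ := Matrix.of fun p x => b p.1 p.2 x
    have hQ : Q * Qᴴ = 1 := by
      ext p q
      have := congrFun (congrFun (hb p.1 q.1) p.2) q.2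
      rw [show (Q * Qᴴ) p q = (b p.1 * (b q.1)ᴴ) p.2 q.2 from rfl, this]
      rcases p with ⟨j, r⟩
      rcases q with ⟨j', r'⟩
      by_cases h : j = j'
      · subst h; simp [Matrix.one_apply]
      · simp [h]
    have h1 : (Q * Qᴴ).rank ≤ Fintype.card A := by
      rw [Matrix.rank_self_mul_conjTranspose]; exact Matrix.rank_le_card_width Q
    rw [hQ, Matrix.rank_one, Fintype.card_prod, Fintype.card_fin, Fintype.card_fin] at h1
    exact h1
  have hND : N < L * (D + 1) := Nat.lt_mul_div_succ N hL
  -- the vectors are numbered by pairs (block, position), of which the first `N` are used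
  let good : Fin (D + 1) × Fin L → Prop := fun p => (p.2 : ℕ) + L * (p.1 : ℕ) < N
  have hcard : Fintype.card {p // good p} = N := by
    have he : Fintype.card {p // good p} = Fintype.card {x : Fin ((D + 1) * L) // (x : ℕ) < N} :=
      Fintype.card_congr (finProdFinEquiv.subtypeEquiv fun p => Iff.rfl)
    rw [he, Fintype.card_subtype, Fin.card_filter_val_lt,
      min_eq_right (by rw [mul_comm]; exact hND.le)]
  have hLD : L * D ≤ N := Nat.mul_div_le N L
  have hgood : ∀ (k : Fin (D + 1)) (r : Fin L), (k : ℕ) < D → good (k, r) := by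
    intro k r hk
    change (r : ℕ) + L * (k : ℕ) < N
    have h1 : L * ((k : ℕ) + 1) ≤ L * D := Nat.mul_le_mul_left L hk
    have h2 := r.2
    rw [Nat.mul_succ] at h1
    linarith
  let V : Matrix A {p // good p} ℂ := Matrix.of fun x p =>
    if h : (p.1.1 : ℕ) < J then star (b ⟨p.1.1, h⟩ p.1.2 x) else 0
  obtain ⟨W, hW, hWV⟩ := exists_isometry_extension (hcard.trans hN).le V {p | (p.1.1 : ℕ) < J} (by
    rintro ⟨⟨i, r⟩, hp⟩ (hi : (i : ℕ) < J) ⟨⟨i', r'⟩, hp'⟩ (hi' : (i' : ℕ) < J)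
    have h1 : (Vᴴ * V) ⟨(i, r), hp⟩ ⟨(i', r'), hp'⟩ = (b ⟨i, hi⟩ * (b ⟨i', hi'⟩)ᴴ) r r' := by
      rw [Matrix.mul_apply, Matrix.mul_apply]
      refine Finset.sum_congr rfl fun x _ => ?_
      simp [V, hi, hi']
    rw [h1, hb]
    by_cases h : i = i'
    · subst h
      simp [Matrix.one_apply]
    · have : ¬ ((⟨i, hi⟩ : Fin J) = ⟨i', hi'⟩) := fun h' => h (Fin.ext (Fin.mk.inj_iff.1 h'))
      rw [if_neg this, if_neg]
      · rfl
      · simp [h])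
  have hW' : W * Wᴴ = 1 := (Matrix.mul_eq_one_comm_of_card_eq _ _ _ (hN.symm.trans hcard.symm)).2 hW
  let Y : Matrix (Fin (D + 1) × Fin L) A ℂ := Matrix.of fun p x =>
    if h : good p then star (W x ⟨p, h⟩) else 0
  have hYY : Yᴴ * Y = 1 := by
    rw [← hW']
    ext x y
    rw [Matrix.mul_apply, Matrix.mul_apply]
    symm
    refine (Finset.sum_of_injOn Subtype.val Subtype.val_injective.injOn (by simp) ?_ ?_)
    · rintro p - hp
      have : ¬ good p := fun h => hp ⟨⟨p, h⟩, by simp, rfl⟩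
      simp [Y, this]
    · rintro ⟨p, hp⟩ -
      simp [Y, hp]
  have hYY' : Y * Yᴴ = Matrix.diagonal fun p => if good p then 1 else 0 := by
    ext p q
    rw [Matrix.mul_apply, Matrix.diagonal_apply]
    by_cases hp : good p
    · by_cases hq : good q
      · have := congrFun (congrFun hW ⟨p, hp⟩) ⟨q, hq⟩
        rw [Matrix.mul_apply, Matrix.one_apply] at this
        simpa [Y, hp, hq] using this
      · have : p ≠ q := fun h => hq (h ▸ hp)
        simp [Y, hq, this]
    · simp [Y, hp]
  let τ := (finRotate (D + 1)).symm
  let a : Fin (D + 1) → Matrix (Fin L) A ℂ := fun k => Y.submatrix (fun r => (τ k, r)) id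
  have haa : ∀ k k', a k * (a k')ᴴ = if k = k' then
      Matrix.diagonal (fun r => if good (τ k, r) then 1 else 0) else 0 := by
    intro k k'
    ext r s
    rw [show (a k * (a k')ᴴ) r s = (Y * Yᴴ) (τ k, r) (τ k', s) from rfl, hYY']
    by_cases h : k = k'
    · subst h; simp [Matrix.diagonal_apply]
    · simp [h]
  have hsum : ∑ k, (a k)ᴴ * a k = 1 := by
    rw [← hYY]
    ext x y
    rw [Matrix.sum_apply, Matrix.mul_apply, Fintype.sum_prod_type,
      ← τ.sum_comp (fun k => ∑ r, Yᴴ x (k, r) * Y (k, r) y)]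
    rfl
  have hτ : ∀ k, k ≠ 0 → (τ k : ℕ) < D := by
    intro k hk
    have h1 : τ k ≠ Fin.last D := by
      intro h
      apply hk
      rw [← finRotate_last, ← h, Equiv.apply_symm_apply]
    exact lt_of_le_of_ne (Nat.lt_succ_iff.1 (τ k).2) fun h => h1 (Fin.ext h)
  have hτ0 : τ 0 = Fin.last D := by
    rw [← finRotate_last, Equiv.symm_apply_apply]
  refine ⟨a, fun k => if h : (τ k : ℕ) < J then ⟨τ k, h.trans (Nat.lt_succ_self J)⟩ else Fin.last J,
    fun j => finRotate (D + 1) ⟨j, j.2.trans_le (hJ.trans (Nat.le_succ D))⟩, ⟨?_, ?_, ?_, ?_⟩,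
    hsum, ?_, ?_⟩
  · intro k
    rw [haa, if_pos rfl]
    ext r x
    rw [Matrix.diagonal_mul]
    by_cases h : good (τ k, r) <;> simp [a, Y, h]
  · intro j k hjk
    rw [haa, if_neg hjk]
  · rw [← Matrix.rank_self_mul_conjTranspose, haa, if_pos rfl, Matrix.rank_diagonal, hτ0,
      Fintype.card_subtype]
    have h1 : ∀ r : Fin L, ((if good (Fin.last D, r) then (1 : ℂ) else 0) ≠ 0)
        ↔ (r : ℕ) < N - L * D := by
      intro r
      have h2 : good (Fin.last D, r) ↔ (r : ℕ) < N - L * D := Nat.lt_sub_iff_add_lt.symm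
      rw [← h2]
      by_cases h : good (Fin.last D, r) <;> simp [h]
    simp_rw [h1]
    rw [Fin.card_filter_val_lt, min_eq_right]
    rw [Nat.mul_succ] at hND
    exact Nat.sub_le_iff_le_add.2 (by linarith)
  · intro k hk
    rw [← Matrix.rank_self_mul_conjTranspose, haa, if_pos rfl]
    have h1 : (fun r => if good (τ k, r) then (1 : ℂ) else 0) = fun _ => 1 :=
      funext fun r => if_pos (hgood _ _ (hτ k hk))
    rw [h1, Matrix.diagonal_one, Matrix.rank_one, Fintype.card_fin]
  · intro j j' h
    have := (finRotate (D + 1)).injective h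
    exact Fin.ext (Fin.mk.inj_iff.1 this)
  · intro j
    have h1 : τ (finRotate (D + 1) ⟨j, j.2.trans_le (hJ.trans (Nat.le_succ D))⟩)
        = ⟨j, j.2.trans_le (hJ.trans (Nat.le_succ D))⟩ := Equiv.symm_apply_apply _ _
    constructor
    · simp only [h1]
      rw [dif_pos j.2]
      rfl
    · ext r x
      have h2 : good (⟨j, j.2.trans_le (hJ.trans (Nat.le_succ D))⟩, r) :=
        hgood _ _ (j.2.trans_le hJ)
      simp only [a, Matrix.submatrix_apply, id, h1]
      simp only [Y, Matrix.of_apply, dif_pos h2]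
      rw [hWV x ⟨_, h2⟩ j.2]
      simp [V]

lemma exists_merging {A B : Type*} [Fintype A] [DecidableEq A] [Fintype B] [DecidableEq B]
    (E : Type*) [Fintype E] [DecidableEq E] {L J : ℕ} (hL : 0 < L) (hLA : L ≤ Fintype.card A)
    (b : Fin J → Matrix (Fin L) A ℂ)
    (hb : ∀ j j', b j * (b j')ᴴ = if j = j' then 1 else 0)
    (u : Fin J → Matrix (Fin L × (A × B)) B ℂ) (hu : ∀ j, (u j)ᴴ * u j = 1) :
    ∃ M : SuperOp (A × B) (Fin L × (Fin L × (A × B))), IsLMerging L M ∧ IsOneWayLOCC (J + 1) M ∧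
      ∀ ψ : (A × B) × E → ℂ, ∑ x, ‖ψ x‖ ^ 2 = 1 →
        ∑ j, ‖amplitude (b j ⊗ₖ u j) ψ (targetVec L ψ)‖ ^ 2 ≤ mergingFidelity L M ψ := by
  obtain ⟨a, f, e, ha, ha1, he, hae⟩ := exists_isLInstrument hL b hb
  obtain ⟨v, hv, -⟩ := exists_isometry_extension (b := B) (c := Fin L × (A × B)) (by
    simp only [Fintype.card_prod, Fintype.card_fin]
    have : 1 ≤ L * Fintype.card A := Nat.mul_pos hL (hL.trans_le hLA)
    nlinarith) 0 ∅ (by simp)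
  let w : Fin (J + 1) → Matrix (Fin L × (A × B)) B ℂ := Fin.snoc u v
  have hw : ∀ d, (w d)ᴴ * w d = 1 := by
    intro d
    induction d using Fin.lastCases with
    | last => simpa [w] using hv
    | cast j => simpa [w] using hu j
  refine ⟨∑ k, conjMap (a k ⊗ₖ w (f k)), ⟨hL, hLA, a, fun k => w (f k), ha, fun k => hw _,
    fun ρ => by rw [LinearMap.sum_apply]; rfl⟩, isOneWayLOCC_sum_conjMap f ha1 hw, fun ψ hψ => ?_⟩
  rw [mergingFidelity_eq hL a (fun k => w (f k)) hψ]
  have h : ∀ j, ‖amplitude (b j ⊗ₖ u j) ψ (targetVec L ψ)‖ ^ 2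
      = ‖amplitude (a (e j) ⊗ₖ w (f (e j))) ψ (targetVec L ψ)‖ ^ 2 := by
    intro j
    rw [(hae j).1, (hae j).2]
    simp [w]
  simp_rw [h]
  exact (Finset.sum_map Finset.univ ⟨e, he⟩
    (fun k => ‖amplitude (a k ⊗ₖ w (f k)) ψ (targetVec L ψ)‖ ^ 2)).symm.le.trans
    (Finset.sum_le_univ_sum_of_nonneg fun _ => sq_nonneg _)

end Instrument

/-! ### The one-shot direct bound -/

section Direct

open scoped Matrix.Norms.L2Operator

variable {A B E : Type*} [Fintype A] [Fintype B] [Fintype E]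

/-- The operator from `B` to `A` given by the component of a tripartite vector at a basis vector
of `E`. -/
def slice (φ : (A × B) × E → ℂ) (e : E) : Matrix A B ℂ := Matrix.of fun a b => φ ((a, b), e)

/-- The coefficient matrix of `(b ⊗ 1) φ` for the cut `A'E | B`. -/
def postMat {A' : Type*} (b : Matrix A' A ℂ) (φ : (A × B) × E → ℂ) : Matrix (A' × E) B ℂ :=
  Matrix.of fun p β => (b * slice φ p.2) p.1 β

/-- The coefficient matrix of the target vector for the cut between `K_A E` and `B`'s systems. -/
noncomputable def targetMat (L : ℕ) (φ : (A × B) × E → ℂ) : Matrix (Fin L × E)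
    (Fin L × (A × B)) ℂ :=
  Matrix.of fun p q => maxEnt L (p.1, q.1) * φ (q.2, p.2)

lemma amplitude_targetVec {L : ℕ} (b : Matrix (Fin L) A ℂ) (u : Matrix (Fin L × (A × B)) B ℂ)
    (φ : (A × B) × E → ℂ) :
    amplitude (b ⊗ₖ u) φ (targetVec L φ) = ((targetMat L φ)ᴴ * postMat b φ * uᵀ).trace := by
  have h1 : amplitude (b ⊗ₖ u) φ (targetVec L φ)
      = ∑ e, ∑ r, ∑ x, star (targetMat L φ (r, e) x) * ∑ β, postMat b φ (r, e) β * u x β := by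
    simp only [amplitude, Matrix.trace, Matrix.diag_apply, Matrix.mul_apply (M := (toMat _)ᴴ)]
    refine Finset.sum_congr rfl fun e _ => ?_
    rw [Fintype.sum_prod_type]
    refine Finset.sum_congr rfl fun r _ => Finset.sum_congr rfl fun x _ => ?_
    congr 1
    simp only [Matrix.mul_apply, Fintype.sum_prod_type, postMat, slice, Matrix.of_apply, toMat,
      Matrix.kroneckerMap_apply, Finset.sum_mul]
    rw [Finset.sum_comm]
    exact Finset.sum_congr rfl fun _ _ => Finset.sum_congr rfl fun _ _ => by ring
  have h2 : ((targetMat L φ)ᴴ * postMat b φ * uᵀ).trace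
      = ∑ x, ∑ r, ∑ e, star (targetMat L φ (r, e) x) * ∑ β, postMat b φ (r, e) β * u x β := by
    rw [Matrix.mul_assoc]
    simp only [Matrix.trace, Matrix.diag_apply, Matrix.mul_apply, Fintype.sum_prod_type (α₁ := Fin L)
      (α₂ := E), Matrix.conjTranspose_apply, Matrix.transpose_apply]
  rw [h1, h2, Finset.sum_comm]
  conv_rhs => rw [Finset.sum_comm]
  exact Finset.sum_congr rfl fun r _ => Finset.sum_comm

lemma hsSq_targetMat {L : ℕ} (hL : 0 < L) (φ : (A × B) × E → ℂ) :
    hsSq (targetMat L φ) = ∑ x, ‖φ x‖ ^ 2 := by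
  rw [← sum_sq_targetVec hL]
  simp only [hsSq, Fintype.sum_prod_type, targetMat, targetVec, Matrix.of_apply]
  have : ∀ x : Fin L, ∑ e : E, ∑ s : Fin L, ∑ a : A, ∑ b : B, ‖maxEnt L (x, s) * φ ((a, b), e)‖ ^ 2
      = ∑ s : Fin L, ∑ a : A, ∑ b : B, ∑ e : E, ‖maxEnt L (x, s) * φ ((a, b), e)‖ ^ 2 := by
    intro x
    rw [Finset.sum_comm]
    refine Finset.sum_congr rfl fun s _ => ?_
    rw [Finset.sum_comm]
    exact Finset.sum_congr rfl fun a _ => Finset.sum_comm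
  exact Finset.sum_congr rfl fun x _ => this x

lemma targetMat_mul_conjTranspose {A B E : Type*} [Fintype A] [Fintype B] {L : ℕ}
    (φ : (A × B) × E → ℂ) (r r' : Fin L) (e e' : E) :
    (targetMat L φ * (targetMat L φ)ᴴ) (r, e) (r', e')
      = (((L : ℂ)⁻¹ * (slice φ e * (slice φ e')ᴴ).trace) • (1 : Matrix (Fin L) (Fin L) ℂ)) r r' := by
  have h1 : (targetMat L φ * (targetMat L φ)ᴴ) (r, e) (r', e')
      = (∑ s, maxEnt L (r, s) * star (maxEnt L (r', s)))
        * (slice φ e * (slice φ e')ᴴ).trace := by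
    simp only [Matrix.mul_apply, Fintype.sum_prod_type, targetMat, Matrix.of_apply,
      Matrix.conjTranspose_apply, Matrix.trace, Matrix.diag_apply, slice, star_mul']
    rw [Finset.sum_mul]
    simp_rw [Finset.mul_sum]
    exact Finset.sum_congr rfl fun s _ => Finset.sum_congr rfl fun a _ =>
      Finset.sum_congr rfl fun b _ => by ring
  rw [h1, sum_maxEnt_mul_star, Matrix.smul_apply, Matrix.one_apply, smul_eq_mul]
  split_ifs <;> simp

lemma postMat_mul_conjTranspose {A B E A' : Type*} [Fintype A] [Fintype B] (b : Matrix A' A ℂ)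
    (φ : (A × B) × E → ℂ) (r r' : A') (e e' : E) :
    (postMat b φ * (postMat b φ)ᴴ) (r, e) (r', e')
      = (b * (slice φ e * (slice φ e')ᴴ) * bᴴ) r r' := by
  have : b * (slice φ e * (slice φ e')ᴴ) * bᴴ = (b * slice φ e) * (b * slice φ e')ᴴ := by
    rw [Matrix.conjTranspose_mul]
    simp only [Matrix.mul_assoc]
  rw [this]
  rfl

lemma hsSq_eq_sum_blocks {m m' E E' : Type*} [Fintype m] [Fintype m'] [Fintype E] [Fintype E']
    (H : Matrix (m × E) (m' × E') ℂ) :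
    hsSq H = ∑ e, ∑ e', hsSq (Matrix.of fun r r' => H (r, e) (r', e')) := by
  simp only [hsSq, Fintype.sum_prod_type, Matrix.of_apply]
  rw [Finset.sum_comm]
  refine Finset.sum_congr rfl fun e _ => ?_
  conv_rhs => rw [Finset.sum_comm]
  exact Finset.sum_congr rfl fun r _ => Finset.sum_comm

lemma sum_hsSq_slice_mul_le [DecidableEq A] [DecidableEq B] [DecidableEq E] {E' : Type*}
    [Fintype E'] (φ : (A × B) × E → ℂ) (χ : (A × B) × E' → ℂ) :
    ∑ e, ∑ e', hsSq (slice φ e * (slice χ e')ᴴ) ≤ ‖toMatB φ‖ ^ 2 * ∑ x, ‖χ x‖ ^ 2 := by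
  have h1 : ∑ e, ∑ e', hsSq (slice φ e * (slice χ e')ᴴ) = hsSq ((toMatB φ)ᴴ * toMatB χ) := by
    rw [hsSq_eq_sum_blocks]
    refine Finset.sum_congr rfl fun e _ => Finset.sum_congr rfl fun e' _ => ?_
    refine Finset.sum_congr rfl fun a _ => Finset.sum_congr rfl fun a' _ => ?_
    rw [← norm_star ((slice φ e * (slice χ e')ᴴ) a a')]
    congr 2
    simp [Matrix.mul_apply, slice, toMatB]
  rw [h1, ← hsSq_toMatB, ← Matrix.l2_opNorm_conjTranspose]
  exact hsSq_mul_le _ _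

lemma hsSq_kronecker {m n m' n' : Type*} [Fintype m] [Fintype n] [Fintype m'] [Fintype n']
    (M : Matrix m n ℂ) (M' : Matrix m' n' ℂ) : hsSq (M ⊗ₖ M') = hsSq M * hsSq M' := by
  simp only [hsSq, Fintype.sum_prod_type, Matrix.kroneckerMap_apply, norm_mul, mul_pow,
    Finset.sum_mul_sum]

lemma hsSq_one {m : Type*} [Fintype m] [DecidableEq m] :
    hsSq (1 : Matrix m m ℂ) = Fintype.card m := by
  have := trace_mul_conjTranspose_self (1 : Matrix m m ℂ)
  rw [Matrix.conjTranspose_one, Matrix.mul_one, Matrix.trace_one] at this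
  exact_mod_cast this.symm

lemma l2_opNorm_submatrix_le {m n n' : Type*} [Fintype m] [DecidableEq m] [Fintype n]
    [DecidableEq n] [Fintype n'] [DecidableEq n'] (O : Matrix m n ℂ) {f : n' → n}
    (hf : Function.Injective f) : ‖O.submatrix id f‖ ≤ ‖O‖ := by
  set Z := (1 : Matrix n n ℂ).submatrix id f with hZ
  have h2 : O.submatrix id f = O * Z := by
    ext p p'
    simp [hZ, Matrix.mul_apply, Matrix.one_apply]
  have h3 : Zᴴ * Z = 1 := by
    ext p p'
    simp [hZ, Matrix.mul_apply, Matrix.one_apply, hf.eq_iff]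
  rw [h2]
  exact (Matrix.l2_opNorm_mul _ _).trans
    (mul_le_of_le_one_right (norm_nonneg _) (l2_opNorm_le_one_of_isometry h3))

lemma norm_trace_mul_le_of_contraction {m m' : Type*} [Fintype m] [Fintype m'] [DecidableEq m]
    [DecidableEq m'] {O : Matrix m' m ℂ} (hO : ‖O‖ ≤ 1) (Q : Matrix m m ℂ) {H : Matrix m m' ℂ}
    (hH : Q * H = H) : ‖(O * H).trace‖ ≤ √(hsSq Q) * √(hsSq H) := by
  rw [← hH, ← Matrix.mul_assoc]
  refine (norm_trace_mul_le _ _).trans ?_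
  rw [hH]
  exact mul_le_mul_of_nonneg_right (Real.sqrt_le_sqrt (hsSq_mul_le_of_contraction hO Q))
    (Real.sqrt_nonneg _)

/-- Random rotations of a subspace that contains the part of `φ` at `A` decouple the blocks of `L`
vectors from the remaining system, which consists of a label in `κ` and of `E`.  With the dimension
`n` of the subspace, `b j` is the `j`-th block after a rotation that is good for the average over
the blocks and over the labels with weights `w`. -/
lemma exists_decoupling [DecidableEq A] {κ R : Type*} [Fintype κ] [Fintype R]
    [DecidableEq R] [Nonempty R] {L J : ℕ} (hJ : J * L ≤ Fintype.card R)
    {W : Matrix A R ℂ} (hW : Wᴴ * W = 1) (φ : (A × B) × (κ × E) → ℂ)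
    (hWφ : W * (Wᴴ * toMatA φ) = toMatA φ) {w : κ → ℝ} (hw : ∀ i, 0 ≤ w i) :
    ∃ b : Fin J → Matrix (Fin L) A ℂ,
      (∀ j j', b j * (b j')ᴴ = if j = j' then 1 else 0) ∧
      ∑ j, ∑ i, w i * √(∑ e, ∑ p, hsSq (b j * (slice φ (i, e) * (slice φ p)ᴴ) * (b j)ᴴ
        - ((Fintype.card R : ℂ)⁻¹ * (slice φ (i, e) * (slice φ p)ᴴ).trace) • 1))
      ≤ ∑ _j : Fin J, ∑ i, w i * ((L / Fintype.card R : ℝ)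
        * √(∑ e, ∑ p, hsSq (slice φ (i, e) * (slice φ p)ᴴ))) := by
  classical
  obtain ⟨F, hF, hF', hflat⟩ := exists_flat_unitary (P := R) (R := R) rfl
  obtain ⟨pos⟩ : Nonempty (Fin J × Fin L ↪ R) :=
    Function.Embedding.nonempty_of_card_le (by simpa using hJ)
  set row : Fin J → Fin L → R := fun j r => pos (j, r) with hrow
  set n : ℝ := (Fintype.card R : ℝ) with hn
  set G := Equiv.Perm R × (R → ZMod 3)
  set c : κ → ℝ := fun i =>
    (L / n : ℝ) * √(∑ e, ∑ p, hsSq (slice φ (i, e) * (slice φ p)ᴴ)) with hc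
  let b : G → Fin J → Matrix (Fin L) A ℂ := fun g j => (scramble F g).submatrix (row j) id * Wᴴ
  set h : G → Fin J → κ → ℝ := fun g j i =>
    ∑ e, ∑ p, hsSq (b g j * (slice φ (i, e) * (slice φ p)ᴴ) * (b g j)ᴴ
      - ((Fintype.card R : ℂ)⁻¹ * (slice φ (i, e) * (slice φ p)ᴴ).trace) • 1) with hh
  have hslice : ∀ e, W * (Wᴴ * slice φ e) = slice φ e := by
    intro e
    ext a β
    have := congrFun (congrFun hWφ a) (β, e)
    simpa [Matrix.mul_apply, slice, toMatA] using this
  have hWn : ‖W‖ ≤ 1 := l2_opNorm_le_one_of_isometry hW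
  have hWn' : ‖Wᴴ‖ ≤ 1 := by rwa [Matrix.l2_opNorm_conjTranspose]
  have havg : ∀ j i, ∑ g, h g j i ≤ Fintype.card G * c i ^ 2 := by
    intro j i
    have h1 : ∀ e e', ∑ g, hsSq (b g j * (slice φ e * (slice φ e')ᴴ) * (b g j)ᴴ
          - ((Fintype.card R : ℂ)⁻¹ * (slice φ e * (slice φ e')ᴴ).trace) • 1)
        ≤ Fintype.card G * ((L / n) ^ 2 * hsSq (slice φ e * (slice φ e')ᴴ)) := by
      intro e e'
      have hr : Function.Injective (row j) := fun r r' h => by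
        have := pos.injective h
        exact (Prod.mk.inj this).2
      have h2 := sum_hsSq_scramble_le hF hflat rfl hr (Wᴴ * (slice φ e * (slice φ e')ᴴ) * W)
      have htr : (Wᴴ * (slice φ e * (slice φ e')ᴴ) * W).trace
          = (slice φ e * (slice φ e')ᴴ).trace := by
        rw [Matrix.trace_mul_comm, ← Matrix.mul_assoc, ← Matrix.mul_assoc, Matrix.mul_assoc W,
          hslice]
      rw [htr] at h2
      have hX : hsSq (Wᴴ * (slice φ e * (slice φ e')ᴴ) * W) ≤ hsSq (slice φ e * (slice φ e')ᴴ) :=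
        (hsSq_mul_le_of_contraction' _ hWn).trans (hsSq_mul_le_of_contraction hWn' _)
      refine le_trans (le_of_eq ?_) (h2.trans ?_)
      · refine Finset.sum_congr rfl fun g _ => ?_
        congr 2
        simp only [b, Matrix.conjTranspose_mul, Matrix.conjTranspose_conjTranspose,
          Matrix.mul_assoc]
      · gcongr
    calc ∑ g, h g j i = ∑ e, ∑ p, ∑ g, hsSq (b g j * (slice φ (i, e) * (slice φ p)ᴴ) * (b g j)ᴴ
          - ((Fintype.card R : ℂ)⁻¹ * (slice φ (i, e) * (slice φ p)ᴴ).trace) • 1) := by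
            rw [hh, Finset.sum_comm]
            exact Finset.sum_congr rfl fun e _ => Finset.sum_comm
      _ ≤ ∑ e, ∑ p, Fintype.card G * ((L / n) ^ 2 * hsSq (slice φ (i, e) * (slice φ p)ᴴ)) :=
            Finset.sum_le_sum fun e _ => Finset.sum_le_sum fun p _ => h1 (i, e) p
      _ = Fintype.card G * ((L / n) ^ 2 * ∑ e, ∑ p, hsSq (slice φ (i, e) * (slice φ p)ᴴ)) := by
            simp_rw [Finset.mul_sum]
      _ = Fintype.card G * c i ^ 2 := by
            rw [hc, mul_pow, Real.sq_sqrt (Finset.sum_nonneg fun _ _ =>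
              Finset.sum_nonneg fun _ _ => hsSq_nonneg _)]
  have hc0 : ∀ i, 0 ≤ c i := fun i => by positivity
  have hh0 : ∀ g j i, 0 ≤ h g j i := fun g j i =>
    Finset.sum_nonneg fun _ _ => Finset.sum_nonneg fun _ _ => hsSq_nonneg _
  have hsqrt : ∀ j i, ∑ g, √(h g j i) ≤ Fintype.card G * c i := by
    intro j i
    refine le_of_sq_le_sq ?_ (mul_nonneg (Nat.cast_nonneg _) (hc0 i))
    have h1 : (∑ g, √(h g j i)) ^ 2 ≤ Fintype.card G * ∑ g, √(h g j i) ^ 2 :=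
      sq_sum_le_card_mul_sum_sq
    have h2 : ∑ g, √(h g j i) ^ 2 = ∑ g, h g j i :=
      Finset.sum_congr rfl fun g _ => Real.sq_sqrt (hh0 g j i)
    rw [h2] at h1
    calc (∑ g, √(h g j i)) ^ 2 ≤ Fintype.card G * (Fintype.card G * c i ^ 2) :=
          h1.trans (mul_le_mul_of_nonneg_left (havg j i) (Nat.cast_nonneg _))
      _ = (Fintype.card G * c i) ^ 2 := by ring
  obtain ⟨g, -, hg⟩ : ∃ g ∈ (Finset.univ : Finset G),
      ∑ j, ∑ i, w i * √(h g j i) ≤ ∑ _j : Fin J, ∑ i, w i * c i := by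
    refine Finset.exists_le_of_sum_le Finset.univ_nonempty ?_
    rw [Finset.sum_comm, Finset.sum_const (M := ℝ), Finset.card_univ, nsmul_eq_mul,
      Finset.mul_sum]
    refine Finset.sum_le_sum fun j _ => ?_
    rw [Finset.sum_comm, Finset.mul_sum]
    refine Finset.sum_le_sum fun i _ => ?_
    rw [← Finset.mul_sum, mul_left_comm]
    exact mul_le_mul_of_nonneg_left (hsqrt j i) (hw i)
  refine ⟨b g, fun j j' => ?_, hg⟩
  have hb : b g j * (b g j')ᴴ = (scramble F g * (scramble F g)ᴴ).submatrix (row j) (row j') := by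
    simp only [b, Matrix.conjTranspose_mul, Matrix.conjTranspose_conjTranspose]
    rw [Matrix.mul_assoc, ← Matrix.mul_assoc Wᴴ, hW, Matrix.one_mul]
    rfl
  rw [hb, scramble_mul_conjTranspose hF']
  ext r r'
  rw [Matrix.submatrix_apply, Matrix.one_apply]
  by_cases hj : j = j'
  · subst hj
    simp [hrow, Matrix.one_apply]
  · simp [hrow, hj]

/-- The one-shot direct part for a single vector whose system `E` comes with a label in `κ`; the
matrix `P i` supports the component with label `i` at `E`. -/
lemma exists_blocks_isometries [DecidableEq A] [DecidableEq B] [DecidableEq E] {κ R : Type*}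
    [Fintype κ] [DecidableEq κ] [Fintype R] [DecidableEq R] [Nonempty R] {L J : ℕ} (hL : 0 < L)
    (hJ : J * L ≤ Fintype.card R) {W : Matrix A R ℂ} (hW : Wᴴ * W = 1)
    (φ : (A × B) × (κ × E) → ℂ) (hWφ : W * (Wᴴ * toMatA φ) = toMatA φ) (P : κ → Matrix E E ℂ)
    (hP : ∀ i e x, ∑ e', P i e e' * φ (x, (i, e')) = φ (x, (i, e))) :
    ∃ (b : Fin J → Matrix (Fin L) A ℂ) (u : Fin J → Matrix (Fin L × (A × B)) B ℂ),
      (∀ j j', b j * (b j')ᴴ = if j = j' then 1 else 0) ∧ (∀ j, (u j)ᴴ * u j = 1) ∧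
      J * (L / Fintype.card R : ℝ) * (∑ x, ‖φ x‖ ^ 2)
        - ∑ i, √(L * hsSq (P i)) * √(∑ e, ∑ p, hsSq (slice φ (i, e) * (slice φ p)ᴴ))
      ≤ ∑ j, √(L / Fintype.card R) * (amplitude (b j ⊗ₖ u j) φ (targetVec L φ)).re := by
  obtain ⟨b, hb, hsum⟩ := exists_decoupling hJ hW φ hWφ (w := fun i => √(L * hsSq (P i)))
    fun i => Real.sqrt_nonneg _
  set n : ℝ := (Fintype.card R : ℝ) with hn
  have hn0 : 0 < n := Nat.cast_pos.2 Fintype.card_pos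
  set q : ℝ := L / n with hq
  have hL' : (0 : ℝ) < L := by exact_mod_cast hL
  have hq0 : 0 ≤ q := by positivity
  set h : Fin J → κ → ℝ := fun j i =>
    ∑ e, ∑ p, hsSq (b j * (slice φ (i, e) * (slice φ p)ᴴ) * (b j)ᴴ
        - ((Fintype.card R : ℂ)⁻¹ * (slice φ (i, e) * (slice φ p)ᴴ).trace) • 1) with hh
  have key : ∀ j, ∃ u : Matrix (Fin L × (A × B)) B ℂ, uᴴ * u = 1 ∧
      q * (∑ x, ‖φ x‖ ^ 2) - ∑ i, √(L * hsSq (P i)) * √(h j i)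
        ≤ √q * (amplitude (b j ⊗ₖ u) φ (targetVec L φ)).re := by
    intro j
    set X := postMat (b j) φ with hX
    set T := ((√q : ℝ) : ℂ) • targetMat L φ with hT
    have hcard : Fintype.card B ≤ Fintype.card (Fin L × (A × B)) := by
      have hA : Fintype.card R ≤ Fintype.card A := by
        have h1 : (Wᴴ * W).rank ≤ Fintype.card A :=
          (Matrix.rank_mul_le_right _ _).trans (Matrix.rank_le_card_height W)
        rwa [hW, Matrix.rank_one] at h1
      have hA' : 1 ≤ L * Fintype.card A :=
        Nat.mul_pos hL ((Fintype.card_pos (α := R)).trans_le hA)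
      simp only [Fintype.card_prod, Fintype.card_fin]
      nlinarith
    obtain ⟨w, O, hw, hO, hle⟩ := exists_isometry_trace_ge hcard X T
    have hTT : ∀ r r' e e', (T * Tᴴ) (r, e) (r', e')
        = (((Fintype.card R : ℂ)⁻¹ * (slice φ e * (slice φ e')ᴴ).trace) •
          (1 : Matrix (Fin L) (Fin L) ℂ)) r r' := by
      intro r r' e e'
      have h1 : T * Tᴴ = (q : ℂ) • (targetMat L φ * (targetMat L φ)ᴴ) := by
        rw [hT, Matrix.conjTranspose_smul, Matrix.smul_mul, Matrix.mul_smul, smul_smul,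
          RCLike.star_def, Complex.conj_ofReal, ← Complex.ofReal_mul, Real.mul_self_sqrt hq0]
      rw [h1, Matrix.smul_apply, targetMat_mul_conjTranspose, ← Matrix.smul_apply, smul_smul,
        ← mul_assoc]
      rw [hq, hn]
      push_cast
      field_simp
    set H := X * Xᴴ - T * Tᴴ with hH
    -- the rows of `H` that carry the label `i`
    let inc : κ → Fin L × E → Fin L × (κ × E) := fun i p => (p.1, (i, p.2))
    have hHi : ∀ i, hsSq (H.submatrix (inc i) id) = h j i := by
      intro i
      rw [hsSq_eq_sum_blocks, hh]
      refine Finset.sum_congr rfl fun e _ => Finset.sum_congr rfl fun p _ => ?_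
      congr 1
      ext r r'
      have h1 : H (r, (i, e)) (r', p) = (X * Xᴴ) (r, (i, e)) (r', p) - (T * Tᴴ) (r, (i, e)) (r', p) :=
        rfl
      rw [Matrix.sub_apply, ← hTT, ← postMat_mul_conjTranspose, ← hX, ← h1]
      rfl
    have hQX : ∀ i, ((1 : Matrix (Fin L) (Fin L) ℂ) ⊗ₖ P i) * X.submatrix (inc i) id
        = X.submatrix (inc i) id := by
      intro i
      ext ⟨r, e⟩ β
      have hP' : ∀ a, ∑ e', P i e e' * slice φ (i, e') a β = slice φ (i, e) a β := fun a =>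
        hP i e (a, β)
      simp only [Matrix.mul_apply, Fintype.sum_prod_type, Matrix.kroneckerMap_apply, hX, postMat,
        Matrix.of_apply, Matrix.one_apply, ite_mul, one_mul, zero_mul, Matrix.submatrix_apply, inc,
        id]
      rw [Finset.sum_eq_single r (fun r' _ h => by simp [h.symm]) (by simp)]
      simp only [if_true, Finset.mul_sum]
      rw [Finset.sum_comm]
      refine Finset.sum_congr rfl fun a _ => ?_
      rw [← hP' a, Finset.mul_sum]
      exact Finset.sum_congr rfl fun _ _ => by ring
    have hQT : ∀ i, ((1 : Matrix (Fin L) (Fin L) ℂ) ⊗ₖ P i) * T.submatrix (inc i) id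
        = T.submatrix (inc i) id := by
      intro i
      have h1 : T.submatrix (inc i) id
          = ((√q : ℝ) : ℂ) • (targetMat L φ).submatrix (inc i) id := rfl
      rw [h1, Matrix.mul_smul]
      congr 1
      ext ⟨r, e⟩ ⟨s, x⟩
      simp only [Matrix.mul_apply, Fintype.sum_prod_type, Matrix.kroneckerMap_apply, targetMat,
        Matrix.of_apply, Matrix.one_apply, ite_mul, one_mul, zero_mul, Matrix.submatrix_apply, inc,
        id]
      rw [Finset.sum_eq_single r (fun r' _ h => by simp [h.symm]) (by simp)]
      simp only [if_true]
      rw [← hP i e x, Finset.mul_sum]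
      exact Finset.sum_congr rfl fun _ _ => by ring
    have hQ : ∀ i, hsSq ((1 : Matrix (Fin L) (Fin L) ℂ) ⊗ₖ P i) = L * hsSq (P i) := by
      intro i
      rw [hsSq_kronecker, hsSq_one, Fintype.card_fin]
    have htr : (O * H).trace.re ≤ ∑ i, √(L * hsSq (P i)) * √(h j i) := by
      have h1 : (O * H).trace
          = ∑ i, (O.submatrix id (inc i) * H.submatrix (inc i) id).trace := by
        rw [← Matrix.trace_sum]
        congr 1
        ext p p'
        rw [Matrix.sum_apply, Matrix.mul_apply, Fintype.sum_prod_type]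
        simp_rw [Fintype.sum_prod_type (α₁ := κ)]
        rw [Finset.sum_comm]
        refine Finset.sum_congr rfl fun i _ => ?_
        rw [Matrix.mul_apply, Fintype.sum_prod_type]
        rfl
      have hinc : ∀ i, Function.Injective (inc i) := fun i p p' hpp => by
        have h2 := Prod.mk.inj hpp
        exact Prod.ext h2.1 (Prod.mk.inj h2.2).2
      rw [h1, Complex.re_sum]
      refine Finset.sum_le_sum fun i _ => (Complex.re_le_norm _).trans ?_
      have hOi : ‖O.submatrix id (inc i)‖ ≤ 1 := (l2_opNorm_submatrix_le O (hinc i)).trans hO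
      have h4 := norm_trace_mul_le_of_contraction hOi ((1 : Matrix (Fin L) (Fin L) ℂ) ⊗ₖ P i)
        (H := H.submatrix (inc i) id) (by
          have h5 : H.submatrix (inc i) id
              = X.submatrix (inc i) id * Xᴴ - T.submatrix (inc i) id * Tᴴ := rfl
          rw [h5, Matrix.mul_sub, ← Matrix.mul_assoc, ← Matrix.mul_assoc, hQX, hQT])
      rwa [hQ, hHi] at h4
    refine ⟨(wᴴ)ᵀ, ?_, ?_⟩
    · have h1 : ((wᴴ)ᵀ)ᴴ * (wᴴ)ᵀ = (wᴴ * w)ᵀ := by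
        rw [Matrix.transpose_mul]
        congr 1
        ext
        simp
      rw [h1, hw, Matrix.transpose_one]
    · rw [amplitude_targetVec, Matrix.transpose_transpose]
      have h1 : (Tᴴ * X * wᴴ).trace = ((√q : ℝ) : ℂ) * ((targetMat L φ)ᴴ * X * wᴴ).trace := by
        rw [hT, Matrix.conjTranspose_smul, RCLike.star_def, Complex.conj_ofReal, Matrix.smul_mul,
          Matrix.smul_mul, Matrix.trace_smul, smul_eq_mul]
      rw [h1, Complex.re_ofReal_mul] at hle
      have h2 : hsSq T = q * ∑ x, ‖φ x‖ ^ 2 := by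
        rw [hT, hsSq_smul, hsSq_targetMat hL, Complex.norm_real, Real.norm_eq_abs, sq_abs,
          Real.sq_sqrt hq0]
      rw [h2] at hle
      linarith
  choose u hu hle using key
  refine ⟨b, u, hb, hu, ?_⟩
  have hJq : J * q ≤ 1 := by
    rw [hq, ← mul_div_assoc, div_le_one hn0, hn]
    exact_mod_cast hJ
  calc _ ≤ J * q * (∑ x, ‖φ x‖ ^ 2) - ∑ j, ∑ i, √(L * hsSq (P i)) * √(h j i) := by
        refine sub_le_sub_left (hsum.trans ?_) _
        rw [Finset.sum_const, Finset.card_univ, Fintype.card_fin, nsmul_eq_mul, Finset.mul_sum]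
        refine Finset.sum_le_sum fun i _ => ?_
        rw [mul_left_comm, ← mul_assoc (J : ℝ)]
        exact mul_le_mul_of_nonneg_left (mul_le_of_le_one_left (Real.sqrt_nonneg _) hJq)
          (Real.sqrt_nonneg _)
    _ = ∑ j, (q * (∑ x, ‖φ x‖ ^ 2) - ∑ i, √(L * hsSq (P i)) * √(h j i)) := by
        rw [Finset.sum_sub_distrib, Finset.sum_const, Finset.card_univ, Fintype.card_fin,
          nsmul_eq_mul, mul_assoc]
    _ ≤ _ := Finset.sum_le_sum fun j _ => hle j

lemma sum_mul_norm_amplitude_le [DecidableEq A] [DecidableEq B] {L J : ℕ}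
    {b : Fin J → Matrix (Fin L) A ℂ} (hb : ∀ j j', b j * (b j')ᴴ = if j = j' then 1 else 0)
    {u : Fin J → Matrix (Fin L × (A × B)) B ℂ} (hu : ∀ j, (u j)ᴴ * u j = 1) {q : ℝ} (hq : 0 ≤ q)
    (hJq : J * q ≤ 1) (χ : (A × B) × E → ℂ) (t : (Fin L × (Fin L × (A × B))) × E → ℂ) :
    ∑ j, √q * ‖amplitude (b j ⊗ₖ u j) χ t‖
      ≤ √(∑ j, ‖amplitude (b j ⊗ₖ u j) χ t‖ ^ 2) ∧
    √(∑ j, ‖amplitude (b j ⊗ₖ u j) χ t‖ ^ 2) ≤ √(∑ x, ‖t x‖ ^ 2) * √(∑ x, ‖χ x‖ ^ 2) := by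
  constructor
  · refine (Real.sum_mul_le_sqrt_mul_sqrt _ _ _).trans ?_
    refine mul_le_of_le_one_left (Real.sqrt_nonneg _) ?_
    rw [Real.sqrt_le_one]
    simpa [Real.sq_sqrt hq] using hJq
  · rw [← Real.sqrt_mul (Finset.sum_nonneg fun _ _ => sq_nonneg _)]
    refine Real.sqrt_le_sqrt (sum_sq_amplitude_le_mul (fun j k hjk => ?_) (fun k => ?_) hu χ t)
    · rw [hb, if_neg hjk]
    · rw [hb, if_pos rfl, Matrix.one_mul]

lemma targetVec_sub {L : ℕ} {A B E : Type*} (ψ φ : (A × B) × E → ℂ) :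
    targetVec L (ψ - φ) = targetVec L ψ - targetVec L φ := by
  ext x
  simp [targetVec, mul_sub]

lemma amplitude_sub_amplitude {X Y : Type*} [Fintype X] [Fintype Y] (V : Matrix Y X ℂ)
    (ψ φ : X × E → ℂ) (s t : Y × E → ℂ) :
    amplitude V ψ s - amplitude V φ t = amplitude V (ψ - φ) s + amplitude V φ (s - t) := by
  have h1 : toMat (ψ - φ) = toMat ψ - toMat φ := rfl
  have h2 : toMat (s - t) = toMat s - toMat t := rfl
  simp only [amplitude, h1, h2, Matrix.conjTranspose_sub, Matrix.sub_mul, Matrix.mul_sub,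
    Matrix.trace_sub]
  ring

lemma one_sub_le_sum_sq {X : Type*} [Fintype X] {ψ φ : X → ℂ} (hψ : ∑ x, ‖ψ x‖ ^ 2 = 1) {s : ℝ}
    (hs0 : 0 ≤ s) (hs : ∑ x, ‖(ψ - φ) x‖ ^ 2 ≤ s ^ 2) : 1 - 2 * s ≤ ∑ x, ‖φ x‖ ^ 2 := by
  have h1 : ∀ x, ‖ψ x‖ ^ 2 - 2 * (‖ψ x‖ * ‖(ψ - φ) x‖) ≤ ‖φ x‖ ^ 2 := by
    intro x
    have h2 := abs_norm_sub_norm_le (ψ x) (ψ x - φ x)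
    rw [sub_sub_cancel] at h2
    have h3 := sq_le_sq' (abs_le.1 h2).1 (abs_le.1 h2).2
    rw [Pi.sub_apply]
    nlinarith [sq_nonneg ‖ψ x - φ x‖]
  have h2 := Finset.sum_le_sum fun x (_ : x ∈ Finset.univ) => h1 x
  rw [Finset.sum_sub_distrib, ← Finset.mul_sum, hψ] at h2
  have h3 := Real.sum_mul_le_sqrt_mul_sqrt Finset.univ (fun x => ‖ψ x‖) (fun x => ‖(ψ - φ) x‖)
  rw [hψ, Real.sqrt_one, one_mul] at h3
  have hs' : √(∑ x, ‖(ψ - φ) x‖ ^ 2) ≤ s := Real.sqrt_le_iff.2 ⟨hs0, hs⟩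
  linarith

/-- The one-shot direct part: a merging with `⌊n / L⌋ + 1` messages that works for all the vectors
`ψ i`.  The parts `φ i` of these vectors are supported at `A` in one common subspace of dimension
`n`, their supports at `E` have small rank and their Schmidt coefficients between `B` and `AE` are
small. -/
theorem exists_merging_fidelity_ge [DecidableEq A] [DecidableEq B] [DecidableEq E] {ι R : Type*}
    [Fintype ι] [DecidableEq ι] [Fintype R] [DecidableEq R] {L : ℕ} (hL : 0 < L)
    (hLR : L ≤ Fintype.card R) {W : Matrix A R ℂ} (hW : Wᴴ * W = 1)
    {ψ φ : ι → (A × B) × E → ℂ} (hψ : ∀ i, ∑ x, ‖ψ i x‖ ^ 2 = 1)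
    (hφ : ∀ i, ∑ x, ‖φ i x‖ ^ 2 ≤ 1) {s : ℝ} (hs0 : 0 ≤ s)
    (hs : ∀ i, ∑ x, ‖(ψ i - φ i) x‖ ^ 2 ≤ s ^ 2)
    (hWφ : ∀ i, W * (Wᴴ * toMatA (φ i)) = toMatA (φ i)) {P : ι → Matrix E E ℂ}
    (hP : ∀ i, P i * toMatE (φ i) = toMatE (φ i)) {d μ : ι → ℝ} (hd : ∀ i, hsSq (P i) ≤ d i)
    (hμ : ∀ i, ‖toMatB (φ i)‖ ^ 2 ≤ μ i) :
    ∃ M : SuperOp (A × B) (Fin L × (Fin L × (A × B))), IsLMerging L M ∧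
      IsOneWayLOCC (Fintype.card R / L + 1) M ∧
      ∀ i, 1 - 2 * (Fintype.card ι * (L / Fintype.card R : ℝ) + 4 * Fintype.card ι * s
        + ∑ k, √(L * d k * μ k * Fintype.card ι)) ≤ mergingFidelity L M (ψ i) := by
  have hR0 : 0 < Fintype.card R := hL.trans_le hLR
  have : Nonempty R := Fintype.card_pos_iff.1 hR0
  set N : ℝ := (Fintype.card ι : ℝ) with hN
  set n : ℝ := (Fintype.card R : ℝ) with hn
  have hn0 : 0 < n := Nat.cast_pos.2 hR0
  set J := Fintype.card R / L with hJdef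
  have hJ : J * L ≤ Fintype.card R := Nat.div_mul_le_self _ _
  set q : ℝ := L / n with hq
  have hq0 : 0 ≤ q := by positivity
  have hJq : J * q ≤ 1 := by
    rw [hq, ← mul_div_assoc, div_le_one hn0, hn]
    exact_mod_cast hJ
  have hJq' : 1 - q ≤ J * q := by
    have h1 : Fintype.card R < L * (J + 1) := Nat.lt_mul_div_succ _ hL
    have h2 : n ≤ L * (J + 1) := by rw [hn]; exact_mod_cast h1.le
    have h3 : 1 ≤ q * (J + 1) := by
      rw [hq, div_mul_eq_mul_div, le_div_iff₀ hn0, one_mul]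
      exact h2
    linarith
  -- the vectors `φ i` are the components of a single vector, where `i` is kept together with `E`
  let Φ : (A × B) × (ι × E) → ℂ := fun x => φ x.2.1 (x.1, x.2.2)
  have hWΦ : W * (Wᴴ * toMatA Φ) = toMatA Φ := by
    ext a ⟨β, i, e⟩
    exact congrFun (congrFun (hWφ i) a) (β, e)
  have hPΦ : ∀ i e x, ∑ e', P i e e' * Φ (x, (i, e')) = Φ (x, (i, e)) := fun i e x =>
    congrFun (congrFun (hP i) e) x
  have hΦ : ∑ x, ‖Φ x‖ ^ 2 = ∑ i, ∑ x, ‖φ i x‖ ^ 2 := by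
    rw [Fintype.sum_prod_type]
    simp_rw [Fintype.sum_prod_type (α₁ := ι)]
    rw [Finset.sum_comm]
    refine Finset.sum_congr rfl fun i _ => ?_
    rw [Fintype.sum_prod_type (α₁ := A × B)]
  obtain ⟨b, u, hb, hu, hle⟩ := exists_blocks_isometries hL hJ hW Φ hWΦ P hPΦ
  obtain ⟨M, hM, hMD, hMF⟩ := exists_merging E hL (hLR.trans (by
    have h1 : (Wᴴ * W).rank ≤ Fintype.card A :=
      (Matrix.rank_mul_le_right _ _).trans (Matrix.rank_le_card_height W)
    rwa [hW, Matrix.rank_one] at h1)) b hb u hu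
  refine ⟨M, hM, hMD, fun i => ?_⟩
  -- the amplitudes of the vectors `ψ i`, and of their parts `φ i`
  let f : ι → Fin J → ℂ := fun i j => amplitude (b j ⊗ₖ u j) (ψ i) (targetVec L (ψ i))
  let f' : ι → Fin J → ℂ := fun i j => amplitude (b j ⊗ₖ u j) (φ i) (targetVec L (φ i))
  have hamp : ∀ j, amplitude (b j ⊗ₖ u j) Φ (targetVec L Φ) = ∑ i, f' i j := by
    intro j
    simp only [amplitude, Matrix.trace, Fintype.sum_prod_type, f']
    rfl
  let g : ι → ℝ := fun i => ∑ j, √q * (f i j).re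
  have hψt : ∀ i, ∑ x, ‖targetVec L (ψ i) x‖ ^ 2 = 1 := fun i => by
    rw [sum_sq_targetVec hL, hψ]
  have hgF : ∀ i, g i ≤ √(∑ j, ‖f i j‖ ^ 2) := fun i =>
    (Finset.sum_le_sum fun j _ => mul_le_mul_of_nonneg_left (Complex.re_le_norm _)
      (Real.sqrt_nonneg q)).trans (sum_mul_norm_amplitude_le hb hu hq0 hJq _ _).1
  have hg1 : ∀ i, g i ≤ 1 := fun i => (hgF i).trans (by
    have := (sum_mul_norm_amplitude_le hb hu hq0 hJq (ψ i) (targetVec L (ψ i))).2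
    rwa [hψt, hψ, Real.sqrt_one, one_mul] at this)
  have hgg : ∀ i, ∑ j, √q * (f' i j).re - 2 * s ≤ g i := by
    intro i
    have hs' : √(∑ x, ‖(ψ i - φ i) x‖ ^ 2) ≤ s := Real.sqrt_le_iff.2 ⟨hs0, hs i⟩
    have h1 := sum_mul_norm_amplitude_le hb hu hq0 hJq (ψ i - φ i) (targetVec L (ψ i))
    have h2 := sum_mul_norm_amplitude_le hb hu hq0 hJq (φ i) (targetVec L (ψ i - φ i))
    rw [hψt, Real.sqrt_one, one_mul] at h1
    rw [sum_sq_targetVec hL] at h2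
    have h3 : √(∑ x, ‖φ i x‖ ^ 2) ≤ 1 := Real.sqrt_le_one.2 (hφ i)
    have h4 : √(∑ x, ‖(ψ i - φ i) x‖ ^ 2) * √(∑ x, ‖φ i x‖ ^ 2) ≤ s :=
      (mul_le_of_le_one_right (Real.sqrt_nonneg _) h3).trans hs'
    have h5 : ∑ j, √q * (f' i j).re - g i
        ≤ ∑ j, √q * ‖amplitude (b j ⊗ₖ u j) (ψ i - φ i) (targetVec L (ψ i))‖
          + ∑ j, √q * ‖amplitude (b j ⊗ₖ u j) (φ i) (targetVec L (ψ i - φ i))‖ := by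
      rw [← Finset.sum_sub_distrib, ← Finset.sum_add_distrib]
      refine Finset.sum_le_sum fun j _ => ?_
      rw [← mul_sub, ← mul_add]
      refine mul_le_mul_of_nonneg_left ?_ (Real.sqrt_nonneg q)
      have h6 := amplitude_sub_amplitude (b j ⊗ₖ u j) (ψ i) (φ i) (targetVec L (ψ i))
        (targetVec L (φ i))
      rw [← targetVec_sub] at h6
      rw [← Complex.sub_re]
      refine (Complex.re_le_norm _).trans ?_
      rw [norm_sub_rev]
      exact (congrArg norm h6).le.trans (norm_add_le _ _)
    linarith [h1.1, h1.2, h2.1, h2.2]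
  have hφ' : ∀ i, 1 - 2 * s ≤ ∑ x, ‖φ i x‖ ^ 2 := fun i =>
    one_sub_le_sum_sq (hψ i) hs0 (hs i)
  set η : ℝ := N * q + 4 * N * s + ∑ k, √(L * d k * μ k * N) with hη
  have hsum : N - η ≤ ∑ i, g i := by
    have h1 : ∑ j, √q * (amplitude (b j ⊗ₖ u j) Φ (targetVec L Φ)).re
        = ∑ i, ∑ j, √q * (f' i j).re := by
      rw [Finset.sum_comm]
      refine Finset.sum_congr rfl fun j _ => ?_
      rw [hamp, Complex.re_sum, Finset.mul_sum]
    rw [h1, hΦ] at hle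
    have h2 : ∑ i, ∑ j, √q * (f' i j).re - 2 * N * s ≤ ∑ i, g i := by
      have := Finset.sum_le_sum fun i (_ : i ∈ Finset.univ) => hgg i
      rw [Finset.sum_sub_distrib, Finset.sum_const, Finset.card_univ, nsmul_eq_mul] at this
      linarith
    have h3 : N * (1 - 2 * s) ≤ ∑ i, ∑ x, ‖φ i x‖ ^ 2 := by
      have := Finset.sum_le_sum fun i (_ : i ∈ Finset.univ) => hφ' i
      rwa [Finset.sum_const, Finset.card_univ, nsmul_eq_mul] at this
    have h4 : ∑ i, ∑ x, ‖φ i x‖ ^ 2 ≤ N := by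
      have := Finset.sum_le_sum fun i (_ : i ∈ Finset.univ) => hφ i
      rwa [Finset.sum_const, Finset.card_univ, nsmul_eq_mul, mul_one] at this
    have h5 : ∑ i, √(L * hsSq (P i)) * √(∑ e, ∑ p, hsSq (slice Φ (i, e) * (slice Φ p)ᴴ))
        ≤ ∑ i, √(L * d i * μ i * N) := by
      refine Finset.sum_le_sum fun i _ => ?_
      have h8 : ∑ e, ∑ p, hsSq (slice Φ (i, e) * (slice Φ p)ᴴ) ≤ μ i * N := by
        refine (sum_hsSq_slice_mul_le (φ i) Φ).trans ?_
        rw [hΦ]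
        exact mul_le_mul (hμ i) h4 (Finset.sum_nonneg fun _ _ => Finset.sum_nonneg fun _ _ =>
          sq_nonneg _) ((sq_nonneg _).trans (hμ i))
      rw [← Real.sqrt_mul (mul_nonneg (Nat.cast_nonneg L) (hsSq_nonneg _)), mul_assoc (_ * d i)]
      refine Real.sqrt_le_sqrt (mul_le_mul (mul_le_mul_of_nonneg_left (hd i) (Nat.cast_nonneg L)) h8
        (Finset.sum_nonneg fun _ _ => Finset.sum_nonneg fun _ _ => hsSq_nonneg _) ?_)
      exact mul_nonneg (Nat.cast_nonneg L) ((hsSq_nonneg _).trans (hd i))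
    have h6 : (1 - q) * ∑ i, ∑ x, ‖φ i x‖ ^ 2 ≤ J * q * ∑ i, ∑ x, ‖φ i x‖ ^ 2 := by
      gcongr
    have h7 : q * ∑ i, ∑ x, ‖φ i x‖ ^ 2 ≤ q * N := by gcongr
    rw [hη]
    linarith
  have hgi : 1 - η ≤ g i := by
    classical
    have h1 : ∑ k ∈ Finset.univ.erase i, g k ≤ ∑ k ∈ Finset.univ.erase i, (1 : ℝ) :=
      Finset.sum_le_sum fun k _ => hg1 k
    have h2 := Finset.add_sum_erase Finset.univ g (Finset.mem_univ i)
    have h3 := Finset.add_sum_erase Finset.univ (fun _ : ι => (1 : ℝ)) (Finset.mem_univ i)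
    have h4 : ∑ _i : ι, (1 : ℝ) = N := by simp [hN]
    linarith
  refine le_trans ?_ (hMF (ψ i) (hψ i))
  change _ ≤ ∑ j, ‖f i j‖ ^ 2
  have hS0 : 0 ≤ ∑ j, ‖f i j‖ ^ 2 := Finset.sum_nonneg fun _ _ => sq_nonneg _
  rcases le_total η 1 with h | h
  · have h1 : 1 - η ≤ √(∑ j, ‖f i j‖ ^ 2) := hgi.trans (hgF i)
    have h2 := pow_le_pow_left₀ (sub_nonneg.2 h) h1 2
    rw [Real.sq_sqrt hS0] at h2
    nlinarith [sq_nonneg η]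
  · linarith

end Direct

/-! ### The asymptotic converse -/

section Asymptotics

open scoped Matrix.Norms.L2Operator

variable {A B E : Type*} [Fintype A] [Fintype B] [Fintype E]

lemma sum_sq_sourceVec {K : ℕ} (hK : 0 < K) (l : ℕ) {ψ : (A × B) × E → ℂ}
    (hψ : ∑ x, ‖ψ x‖ ^ 2 = 1) : ∑ x, ‖sourceVec K l ψ x‖ ^ 2 = 1 := by
  rw [sourceVec_eq_withMaxEnt, sum_sq_withMaxEnt hK, sum_sq_powVec l hψ]

lemma isState_traceSnd_traceSnd {ψ : (A × B) × E → ℂ} (hψ : ∑ x, ‖ψ x‖ ^ 2 = 1) :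
    IsState (traceSnd (traceSnd (pureState ψ))) := by
  rw [← toMatA_mul_conjTranspose]
  exact IsState.of_mul_conjTranspose (by rw [hsSq_toMatA, hψ])

variable [DecidableEq A] [DecidableEq B] [DecidableEq E]

/-- The fidelity of a merging of `φ_K ⊗ ψ^{⊗ l}` with `D` messages is at most about
`2 D L / K * 2 ^ (- l S(A))`. -/
lemma mergingFidelity_sourceVec_le {ψ : (A × B) × E → ℂ} (hψ : ∑ x, ‖ψ x‖ ^ 2 = 1) :
    ∃ V : ℝ, 0 ≤ V ∧ ∀ (l : ℕ) (ε : ℝ), 0 < l → 0 < ε → ∀ (K L D : ℕ)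
      (M : SuperOp ((Fin K × (Fin l → A)) × (Fin K × (Fin l → B)))
        (Fin L × (Fin L × ((Fin K × (Fin l → A)) × (Fin K × (Fin l → B)))))),
      0 < K → IsLMerging L M → IsOneWayLOCC D M →
      mergingFidelity L M (sourceVec K l ψ)
        ≤ 2 * (D * L * (2 ^ (-((l : ℝ) * (entropy (traceSnd (traceSnd (pureState ψ))) - ε))) / K))
          + 2 * (V / (l * ε ^ 2)) := by
  obtain ⟨V, hV, hT⟩ := (isState_traceSnd_traceSnd hψ).exists_typicalSubspace
  refine ⟨V, hV, fun l ε hl hε K L D M hK hM hD => ?_⟩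
  obtain ⟨r, Y, hY⟩ := hT l ε hl hε
  have hY' := hY.maxMixed hK
  rw [← toMatA_powVec_mul_conjTranspose, ← toMatA_withMaxEnt_mul_conjTranspose,
    ← sourceVec_eq_withMaxEnt] at hY'
  set Ψ := toMatA (sourceVec K l ψ) with hΨ
  set Q := (1 : Matrix (Fin K) (Fin K) ℂ) ⊗ₖ Y
  let ψ₁ : ((Fin K × (Fin l → A)) × (Fin K × (Fin l → B))) × (Fin l → E) → ℂ :=
    fun x => (Q * Qᴴ * Ψ) x.1.1 (x.1.2, x.2)
  have h1 : toMatA ψ₁ = Q * Qᴴ * Ψ := rfl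
  have h2 : toMatA (sourceVec K l ψ - ψ₁) = Ψ - Q * Qᴴ * Ψ := rfl
  refine (mergingFidelity_le hM hD (sum_sq_sourceVec hK l hψ)
    (add_sub_cancel ψ₁ (sourceVec K l ψ)).symm).trans ?_
  have h3 := hY'.norm_sq_le rfl
  have h4 := hY'.hsSq_sub_le rfl
  rw [← h2, hsSq_toMatA] at h4
  rw [h1]
  gcongr

/-- One state bounds the classical communication of a protocol from below. -/
lemma le_classicalRate {ι : Type*} [Finite ι] {ψ : ι → (A × B) × E → ℂ}
    (hψ : ∀ i, ∑ x, ‖ψ i x‖ ^ 2 = 1) {K L D : ℕ → ℕ}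
    {M : ∀ l : ℕ, SuperOp ((Fin (K l) × (Fin l → A)) × (Fin (K l) × (Fin l → B)))
      (Fin (L l) × (Fin (L l) × ((Fin (K l) × (Fin l → A)) × (Fin (K l) × (Fin l → B)))))}
    (hM : IsLMergingProtocol ψ K L D M) {r : ℝ} (hr : entanglementRate K L = (r : EReal)) (i : ι) :
    ((entropy (traceSnd (traceSnd (pureState (ψ i)))) + r : ℝ) : EReal) ≤ classicalRate D := by
  set S := entropy (traceSnd (traceSnd (pureState (ψ i)))) with hS
  obtain ⟨V, hV, hF⟩ := mergingFidelity_sourceVec_le (hψ i)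
  by_contra! hlt
  obtain ⟨x, hx1, hx2⟩ := EReal.lt_iff_exists_real_btwn.1 hlt
  rw [EReal.coe_lt_coe_iff] at hx2
  set ε := (S + r - x) / 4 with hε
  have hε0 : 0 < ε := by rw [hε]; linarith
  have hev1 : ∀ᶠ l : ℕ in atTop, 1 / 2 <
      ⨅ i, mergingFidelity (L l) (M l) (sourceVec (K l) l (ψ i)) :=
    hM.fidelity_tendsto.eventually (lt_mem_nhds (by norm_num))
  have hev2 : ∀ᶠ l : ℕ in atTop, 2 * (V / (l * ε ^ 2)) < 1 / 4 := by
    have h1 : Tendsto (fun l : ℕ => 2 * (V / ε ^ 2) / (l : ℝ)) atTop (𝓝 0) :=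
      tendsto_const_div_atTop_nhds_zero_nat _
    filter_upwards [h1.eventually (gt_mem_nhds (show (0 : ℝ) < 1 / 4 by norm_num))] with l hl
    refine lt_of_le_of_lt (le_of_eq ?_) hl
    rw [mul_comm (l : ℝ), ← div_div, mul_div_assoc]
  have hev3 : ∀ᶠ l : ℕ in atTop, 3 / (l : ℝ) < ε :=
    (tendsto_const_div_atTop_nhds_zero_nat 3).eventually (gt_mem_nhds hε0)
  have hfreq : ∃ᶠ l : ℕ in atTop,
      ((r - ε : ℝ) : EReal) < ((1 / (l : ℝ) * Real.logb 2 ((K l : ℝ) / (L l : ℝ)) : ℝ) : EReal) := by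
    refine frequently_lt_of_lt_limsup (by isBoundedDefault) ?_
    have : ((r - ε : ℝ) : EReal) < entanglementRate K L := by
      rw [hr, EReal.coe_lt_coe_iff]; linarith
    exact this
  have hle : (x : EReal) ≤ classicalRate D := by
    refine le_limsup_of_frequently_le ?_ (by isBoundedDefault)
    refine (hfreq.and_eventually (((hev1.and hev2).and hev3).and (eventually_gt_atTop 0))).mono ?_
    rintro l ⟨h0, ⟨⟨h1, h2⟩, h3⟩, hl⟩
    rw [EReal.coe_lt_coe_iff] at h0
    rw [EReal.coe_le_coe_iff]
    have hl' : (0 : ℝ) < l := by exact_mod_cast hl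
    have hK : (0 : ℝ) < K l := by exact_mod_cast hM.K_pos l hl
    have hL : (0 : ℝ) < L l := by exact_mod_cast (hM.isLMerging l hl).1
    have h4 := hF l ε hl hε0 (K l) (L l) (D l) (M l) (hM.K_pos l hl) (hM.isLMerging l hl)
      (hM.isOneWayLOCC l hl)
    have h5 : (⨅ i, mergingFidelity (L l) (M l) (sourceVec (K l) l (ψ i)))
        ≤ mergingFidelity (L l) (M l) (sourceVec (K l) l (ψ i)) :=
      ciInf_le (Set.finite_range _).bddBelow i
    set p : ℝ := 2 ^ (-((l : ℝ) * (S - ε))) with hp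
    have hp0 : 0 < p := Real.rpow_pos_of_pos two_pos _
    have h6 : 2⁻¹ ^ 3 < D l * (L l * (p / K l)) := by
      have : (D l : ℝ) * L l * (p / K l) = D l * (L l * (p / K l)) := by ring
      rw [← this]
      norm_num
      linarith
    have hLp : 0 < L l * (p / K l) := by positivity
    have hD : (0 : ℝ) < D l := by
      by_contra hD
      have : (D l : ℝ) * (L l * (p / K l)) ≤ 0 :=
        mul_nonpos_of_nonpos_of_nonneg (not_lt.1 hD) hLp.le
      norm_num at h6
      linarith
    have h7 := Real.logb_lt_logb one_lt_two (by positivity) h6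
    rw [Real.logb_mul hD.ne' hLp.ne', Real.logb_mul hL.ne' (by positivity),
      Real.logb_div hp0.ne' hK.ne', hp, Real.logb_rpow two_pos (by norm_num), Real.logb_pow,
      Real.logb_inv, Real.logb_self_eq_one one_lt_two] at h7
    rw [Real.logb_div hK.ne' hL.ne', one_div, inv_mul_eq_div, lt_div_iff₀ hl'] at h0
    rw [one_div, inv_mul_eq_div, le_div_iff₀ hl']
    rw [div_lt_iff₀ hl'] at h3
    push_cast at h7
    have h8 : x = S + r - 4 * ε := by rw [hε]; ring
    rw [h8]
    nlinarith
  exact absurd hle (not_le.2 hx1)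

end Asymptotics

/-! ### Compression to typical subspaces -/

section Compression

open scoped Matrix.Norms.L2Operator

variable {A B E : Type*} [Fintype A] [Fintype B] [Fintype E]

/-- The vector `(P ⊗ 1 ⊗ 1) ψ`. -/
def actA {B E : Type*} (P : Matrix A A ℂ) (ψ : (A × B) × E → ℂ) : (A × B) × E → ℂ :=
  fun x => (P * toMatA ψ) x.1.1 (x.1.2, x.2)

/-- The vector `(1 ⊗ P ⊗ 1) ψ`. -/
def actB {A E : Type*} (P : Matrix B B ℂ) (ψ : (A × B) × E → ℂ) : (A × B) × E → ℂ :=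
  fun x => (P * toMatB ψ) x.1.2 (x.1.1, x.2)

/-- The vector `(1 ⊗ 1 ⊗ P) ψ`. -/
def actE {A B : Type*} (P : Matrix E E ℂ) (ψ : (A × B) × E → ℂ) : (A × B) × E → ℂ :=
  fun x => (P * toMatE ψ) x.2 x.1

lemma toMatB_actA {B : Type*} [DecidableEq E] (P : Matrix A A ℂ) (ψ : (A × B) × E → ℂ) :
    toMatB (actA P ψ) = toMatB ψ * (Pᵀ ⊗ₖ (1 : Matrix E E ℂ)) := by
  ext β ⟨a, e⟩
  simp [toMatB, actA, toMatA, Matrix.mul_apply, Fintype.sum_prod_type, Matrix.one_apply, mul_comm]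

lemma toMatB_actE {B : Type*} [DecidableEq A] (P : Matrix E E ℂ) (ψ : (A × B) × E → ℂ) :
    toMatB (actE P ψ) = toMatB ψ * ((1 : Matrix A A ℂ) ⊗ₖ Pᵀ) := by
  ext β ⟨a, e⟩
  simp [toMatB, actE, toMatE, Matrix.mul_apply, Fintype.sum_prod_type, Matrix.one_apply, mul_comm]

lemma toMatE_actA {E : Type*} [DecidableEq B] (P : Matrix A A ℂ) (ψ : (A × B) × E → ℂ) :
    toMatE (actA P ψ) = toMatE ψ * (Pᵀ ⊗ₖ (1 : Matrix B B ℂ)) := by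
  ext e ⟨a, β⟩
  simp [toMatE, actA, toMatA, Matrix.mul_apply, Fintype.sum_prod_type, Matrix.one_apply, mul_comm]

lemma hsSq_transpose {m n : Type*} [Fintype m] [Fintype n] (M : Matrix m n ℂ) :
    hsSq Mᵀ = hsSq M :=
  Finset.sum_comm

lemma mul_conjTranspose_isProj {X R : Type*} [Fintype X] [Fintype R] [DecidableEq R]
    {Y : Matrix X R ℂ} (hY : Yᴴ * Y = 1) : Y * Yᴴ * (Y * Yᴴ) = Y * Yᴴ := by
  rw [Matrix.mul_assoc, ← Matrix.mul_assoc Yᴴ, hY, Matrix.one_mul]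

lemma l2_opNorm_mul_conjTranspose_le_one {X R : Type*} [Fintype X] [DecidableEq X] [Fintype R]
    [DecidableEq R] {Y : Matrix X R ℂ} (hY : Yᴴ * Y = 1) :
    ‖Y * Yᴴ‖ ≤ 1 := by
  refine l2_opNorm_le_one_of_proj ?_
  rw [Matrix.conjTranspose_mul, Matrix.conjTranspose_conjTranspose, mul_conjTranspose_isProj hY,
    mul_conjTranspose_isProj hY]

lemma l2_opNorm_transpose_mul_conjTranspose_le_one {X R : Type*} [Fintype X] [DecidableEq X]
    [Fintype R] [DecidableEq R] {Y : Matrix X R ℂ} (hY : Yᴴ * Y = 1) :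
    ‖(Y * Yᴴ)ᵀ‖ ≤ 1 := by
  refine l2_opNorm_le_one_of_proj ?_
  have h : ((Y * Yᴴ)ᵀ)ᴴ = (Y * Yᴴ)ᵀ := by
    rw [show ((Y * Yᴴ)ᵀ)ᴴ = ((Y * Yᴴ)ᴴ)ᵀ from rfl, Matrix.conjTranspose_mul,
      Matrix.conjTranspose_conjTranspose]
  rw [h, ← Matrix.transpose_mul, mul_conjTranspose_isProj hY, ← Matrix.transpose_mul,
    mul_conjTranspose_isProj hY]

lemma hsSq_mul_conjTranspose_of_isometry {X R : Type*} [Fintype X] [Fintype R]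
    [DecidableEq R] {Y : Matrix X R ℂ} (hY : Yᴴ * Y = 1) : hsSq (Y * Yᴴ) = Fintype.card R := by
  have h := trace_conjTranspose_mul_self Y
  rw [hY, Matrix.trace_one] at h
  rw [hsSq_isometry_mul hY, hsSq_conjTranspose]
  exact_mod_cast h.symm

/-- The vector `Ψ` can be compressed at `B` and `E` to typical subspaces, and at `A` to any subspace
that contains a typical subspace. -/
lemma exists_compression [DecidableEq A] [DecidableEq B] [DecidableEq E]
    {Ψ : (A × B) × E → ℂ} (hΨ : ∑ x, ‖Ψ x‖ ^ 2 = 1)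
    {RA RB RE R : Type*} [Fintype RA] [DecidableEq RA] [Fintype RB] [DecidableEq RB] [Fintype RE]
    [DecidableEq RE] [Fintype R] [DecidableEq R] {YA : Matrix A RA ℂ} {YB : Matrix B RB ℂ}
    {YE : Matrix E RE ℂ} {W : Matrix A R ℂ} {dA μA dB μ d μE η : ℝ}
    (hA : IsTypicalSubspace (toMatA Ψ * (toMatA Ψ)ᴴ) YA dA μA η)
    (hB : IsTypicalSubspace (toMatB Ψ * (toMatB Ψ)ᴴ) YB dB μ η)
    (hE : IsTypicalSubspace (toMatE Ψ * (toMatE Ψ)ᴴ) YE d μE η)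
    (hW : Wᴴ * W = 1) (hWY : W * (Wᴴ * YA) = YA) :
    ∃ φ : (A × B) × E → ℂ, ∑ x, ‖φ x‖ ^ 2 ≤ 1 ∧ ∑ x, ‖(Ψ - φ) x‖ ^ 2 ≤ 10 * η ∧
      W * (Wᴴ * toMatA φ) = toMatA φ ∧ YE * YEᴴ * toMatE φ = toMatE φ ∧
      ‖toMatB φ‖ ^ 2 ≤ μ ∧ ∑ x, ‖φ x‖ ^ 2 ≤ μ * (Fintype.card R * d) := by
  set PB := YB * YBᴴ with hPB
  set PE := YE * YEᴴ with hPE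
  set PA := W * Wᴴ with hPA
  have hPBn : ‖PB‖ ≤ 1 := l2_opNorm_mul_conjTranspose_le_one hB.isometry
  have hPEn : ‖PE‖ ≤ 1 := l2_opNorm_mul_conjTranspose_le_one hE.isometry
  have hPAn : ‖PA‖ ≤ 1 := l2_opNorm_mul_conjTranspose_le_one hW
  set φ₁ := actB PB Ψ with hφ₁
  set φ₂ := actE PE φ₁ with hφ₂
  set φ := actA PA φ₂ with hφ
  have hBn : ‖toMatB φ‖ ≤ ‖toMatB φ₁‖ := by
    rw [hφ, toMatB_actA, hφ₂, toMatB_actE]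
    refine (Matrix.l2_opNorm_mul _ _).trans ((mul_le_of_le_one_right (norm_nonneg _) ?_).trans
      ((Matrix.l2_opNorm_mul _ _).trans (mul_le_of_le_one_right (norm_nonneg _) ?_)))
    · exact (l2_opNorm_kronecker_one_le _).trans (l2_opNorm_transpose_mul_conjTranspose_le_one hW)
    · exact (l2_opNorm_one_kronecker_le _).trans
        (l2_opNorm_transpose_mul_conjTranspose_le_one hE.isometry)
  have hBμ : ‖toMatB φ‖ ^ 2 ≤ μ :=
    (pow_le_pow_left₀ (norm_nonneg _) hBn 2).trans (hB.norm_sq_le rfl)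
  have hφA : PA * toMatA φ = toMatA φ := by
    change PA * (PA * toMatA φ₂) = PA * toMatA φ₂
    rw [← Matrix.mul_assoc, mul_conjTranspose_isProj hW]
  have hφ₂E : PE * toMatE φ₂ = toMatE φ₂ := by
    change PE * (PE * toMatE φ₁) = PE * toMatE φ₁
    rw [← Matrix.mul_assoc, mul_conjTranspose_isProj hE.isometry]
  refine ⟨φ, ?_, ?_, by rw [← Matrix.mul_assoc]; exact hφA, ?_, hBμ, ?_⟩
  · have h1 : ∑ x, ‖φ₁ x‖ ^ 2 ≤ 1 := by
      rw [← hΨ, ← hsSq_toMatB, ← hsSq_toMatB]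
      exact hsSq_mul_le_of_contraction hPBn _
    have h2 : ∑ x, ‖φ₂ x‖ ^ 2 ≤ ∑ x, ‖φ₁ x‖ ^ 2 := by
      rw [← hsSq_toMatE, ← hsSq_toMatE]
      exact hsSq_mul_le_of_contraction hPEn _
    have h3 : ∑ x, ‖φ x‖ ^ 2 ≤ ∑ x, ‖φ₂ x‖ ^ 2 := by
      rw [← hsSq_toMatA, ← hsSq_toMatA]
      exact hsSq_mul_le_of_contraction hPAn _
    exact h3.trans (h2.trans h1)
  · have h1 : ∑ x, ‖(Ψ - φ₁) x‖ ^ 2 ≤ η := by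
      rw [← hsSq_toMatB]
      exact hB.hsSq_sub_le rfl
    have h2 : ∑ x, ‖(Ψ - φ₂) x‖ ^ 2 ≤ 2 * η + 2 * η := by
      have e : toMatE (Ψ - φ₂) = (toMatE Ψ - PE * toMatE Ψ) + PE * toMatE (Ψ - φ₁) := by
        have e1 : toMatE (Ψ - φ₁) = toMatE Ψ - toMatE φ₁ := rfl
        have e2 : toMatE (Ψ - φ₂) = toMatE Ψ - PE * toMatE φ₁ := rfl
        rw [e1, e2, Matrix.mul_sub]
        abel
      rw [← hsSq_toMatE, e]
      refine (hsSq_add_le _ _).trans (add_le_add ?_ ?_)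
      · exact mul_le_mul_of_nonneg_left (hE.hsSq_sub_le rfl) zero_le_two
      · refine mul_le_mul_of_nonneg_left ?_ zero_le_two
        refine (hsSq_mul_le_of_contraction hPEn _).trans ?_
        rwa [hsSq_toMatE]
    have h3 : hsSq (toMatA Ψ - PA * toMatA Ψ) ≤ η := by
      have e : toMatA Ψ - PA * toMatA Ψ
          = (1 - PA) * (toMatA Ψ - YA * YAᴴ * toMatA Ψ) := by
        have e1 : PA * (YA * YAᴴ * toMatA Ψ) = YA * YAᴴ * toMatA Ψ := by
          rw [hPA, Matrix.mul_assoc, Matrix.mul_assoc YA, ← Matrix.mul_assoc Wᴴ YA,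
            ← Matrix.mul_assoc W, hWY]
        simp only [Matrix.sub_mul, Matrix.mul_sub, e1, Matrix.one_mul]
        abel
      have hproj : ‖1 - PA‖ ≤ 1 := by
        refine l2_opNorm_le_one_of_proj ?_
        have e1 : (1 - PA)ᴴ = 1 - PA := by
          rw [Matrix.conjTranspose_sub, Matrix.conjTranspose_one, hPA, Matrix.conjTranspose_mul,
            Matrix.conjTranspose_conjTranspose]
        have e2 : (1 - PA) * (1 - PA) = 1 - PA := by
          have e3 : PA * PA = PA := mul_conjTranspose_isProj hW
          simp only [Matrix.sub_mul, Matrix.mul_sub, Matrix.one_mul, Matrix.mul_one, e3]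
          abel
        rw [e1, e2, e2]
      rw [e]
      exact (hsSq_mul_le_of_contraction hproj _).trans (hA.hsSq_sub_le rfl)
    have e : toMatA (Ψ - φ) = (toMatA Ψ - PA * toMatA Ψ) + PA * toMatA (Ψ - φ₂) := by
      have e1 : toMatA (Ψ - φ₂) = toMatA Ψ - toMatA φ₂ := rfl
      have e2 : toMatA (Ψ - φ) = toMatA Ψ - PA * toMatA φ₂ := rfl
      rw [e1, e2, Matrix.mul_sub]
      abel
    rw [← hsSq_toMatA, e]
    have h4 : hsSq (PA * toMatA (Ψ - φ₂)) ≤ 2 * η + 2 * η := by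
      refine (hsSq_mul_le_of_contraction hPAn _).trans ?_
      rwa [hsSq_toMatA]
    linarith [hsSq_add_le (toMatA Ψ - PA * toMatA Ψ) (PA * toMatA (Ψ - φ₂))]
  · rw [hφ, toMatE_actA, ← Matrix.mul_assoc, hφ₂E]
  · -- `φ` is supported on a subspace of dimension `card R * d` of `AE`
    have hPAt : (PAᵀ : Matrix A A ℂ) * PAᵀ = PAᵀ := by
      rw [← Matrix.transpose_mul, mul_conjTranspose_isProj hW]
    have hPEt : (PEᵀ : Matrix E E ℂ) * PEᵀ = PEᵀ := by
      rw [← Matrix.transpose_mul, mul_conjTranspose_isProj hE.isometry]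
    have h1 : toMatB φ = toMatB φ * (PAᵀ ⊗ₖ PEᵀ) := by
      rw [hφ, toMatB_actA, hφ₂, toMatB_actE, Matrix.mul_assoc, Matrix.mul_assoc, Matrix.mul_assoc,
        ← Matrix.mul_kronecker_mul, ← Matrix.mul_kronecker_mul, ← Matrix.mul_kronecker_mul]
      simp only [Matrix.one_mul, Matrix.mul_one, hPAt, hPEt]
    have h2 : hsSq (PAᵀ ⊗ₖ PEᵀ) = Fintype.card R * Fintype.card RE := by
      rw [hsSq_kronecker, hsSq_transpose, hsSq_transpose, hsSq_mul_conjTranspose_of_isometry hW,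
        hsSq_mul_conjTranspose_of_isometry hE.isometry]
    rw [← hsSq_toMatB, h1]
    refine (hsSq_mul_le _ _).trans ?_
    rw [h2]
    have hμ0 : 0 ≤ μ := (sq_nonneg _).trans hBμ
    exact mul_le_mul hBμ (mul_le_mul_of_nonneg_left hE.card_le (Nat.cast_nonneg _))
      (by positivity) hμ0

/-- Finitely many subspaces lie in a subspace whose dimension is at most the sum of theirs. -/
lemma exists_common_subspace {ι X : Type*} [Fintype ι] [Fintype X] [DecidableEq X] {r : ι → ℕ}
    (Y : ∀ i, Matrix X (Fin (r i)) ℂ) :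
    ∃ (v : ℕ) (W : Matrix X (Fin v) ℂ), v ≤ ∑ i, r i ∧ Wᴴ * W = 1 ∧
      ∀ i, W * (Wᴴ * Y i) = Y i := by
  let f : (Σ i, Fin (r i)) → EuclideanSpace ℂ X := fun p => WithLp.toLp 2 fun x => Y p.1 x p.2
  let S := Submodule.span ℂ (Set.range f)
  let o := stdOrthonormalBasis ℂ S
  refine ⟨Module.finrank ℂ S, Matrix.of fun x k => (o k : EuclideanSpace ℂ X) x, ?_, ?_, ?_⟩
  · refine (finrank_range_le_card f).trans (le_of_eq ?_)
    simp
  · ext k k'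
    have h := orthonormal_iff_ite.1 o.orthonormal k k'
    rw [Matrix.one_apply, ← h, Submodule.coe_inner, PiLp.inner_apply, Matrix.mul_apply]
    refine Finset.sum_congr rfl fun x _ => ?_
    simp [mul_comm]
  · intro i
    ext x c
    have hmem : f ⟨i, c⟩ ∈ S := Submodule.subset_span ⟨_, rfl⟩
    have h := o.sum_repr' ⟨f ⟨i, c⟩, hmem⟩
    have h' := congrArg (fun y : S => (y : EuclideanSpace ℂ X) x) h
    simp only [Submodule.coe_sum, Submodule.coe_smul, WithLp.ofLp_sum, Finset.sum_apply] at h'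
    refine Eq.trans ?_ h'
    rw [Matrix.mul_apply]
    refine Finset.sum_congr rfl fun k _ => ?_
    rw [Submodule.coe_inner, PiLp.inner_apply, Matrix.mul_apply]
    rw [PiLp.smul_apply, smul_eq_mul, mul_comm]
    congr 1
    refine Finset.sum_congr rfl fun x _ => ?_
    simp [f, mul_comm]

end Compression

/-! ### The asymptotic direct part -/

section Achievability

open scoped Matrix.Norms.L2Operator

lemma IsTypicalSubspace.mono_tail {X R : Type*} [Fintype X] [Fintype R] [DecidableEq R]
    {σ : Matrix X X ℂ} {Y : Matrix X R ℂ} {d μ η η' : ℝ} (h : IsTypicalSubspace σ Y d μ η)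
    (hη : η ≤ η') : IsTypicalSubspace σ Y d μ η' :=
  ⟨h.isometry, h.card_le, h.norm_le, h.tail_le.trans hη⟩

variable {ι A B E : Type*} [Fintype ι] [DecidableEq ι] [Fintype A] [DecidableEq A] [Fintype B]
  [DecidableEq B] [Fintype E] [DecidableEq E]

/-- Mergings of `φ_K ⊗ ψ_i^{⊗ l}`, and the dimension `v` of the subspace of `A` that they use, which
contains the typical subspaces of all the marginals at `A`. -/
lemma exists_merging_sourceVec {ψ : ι → (A × B) × E → ℂ} (hψ : ∀ i, ∑ x, ‖ψ i x‖ ^ 2 = 1) :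
    ∃ V : ℝ, 0 ≤ V ∧ ∀ (l : ℕ) (ε : ℝ), 0 < l → 0 < ε → ∃ v : ℕ,
      (v : ℝ) ≤ ∑ i, 2 ^ ((l : ℝ) * (entropy (traceSnd (traceSnd (pureState (ψ i)))) + ε)) ∧
      ∀ K : ℕ, 0 < K →
        (∀ i, 1 - 2 * √(10 * (V / (l * ε ^ 2)))
          ≤ v * 2 ^ ((l : ℝ) * (condEntropy (traceSnd (pureState (ψ i))) + 2 * ε))) ∧
        ∀ L : ℕ, 0 < L → L ≤ K * v →
          ∃ M : SuperOp ((Fin K × (Fin l → A)) × (Fin K × (Fin l → B)))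
              (Fin L × (Fin L × ((Fin K × (Fin l → A)) × (Fin K × (Fin l → B))))),
            IsLMerging L M ∧ IsOneWayLOCC (K * v / L + 1) M ∧
            ∀ i, 1 - 2 * (Fintype.card ι * (L / (K * v) : ℝ)
                + 4 * Fintype.card ι * √(10 * (V / (l * ε ^ 2)))
                + ∑ k, √(L / K * 2 ^ ((l : ℝ) *
                    (condEntropy (traceSnd (pureState (ψ k))) + 2 * ε)) * Fintype.card ι))
              ≤ mergingFidelity L M (sourceVec K l (ψ i)) := by
  have hSA : ∀ i, IsState (traceSnd (traceSnd (pureState (ψ i)))) := fun i =>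
    isState_traceSnd_traceSnd (hψ i)
  have hSB : ∀ i, IsState (traceFst (traceSnd (pureState (ψ i)))) := fun i => by
    rw [← toMatB_mul_conjTranspose]
    exact IsState.of_mul_conjTranspose (by rw [hsSq_toMatB, hψ])
  have hSE : ∀ i, IsState (traceFst (pureState (ψ i))) := fun i => by
    rw [← toMatE_mul_conjTranspose]
    exact IsState.of_mul_conjTranspose (by rw [hsSq_toMatE, hψ])
  choose VA hVA hA using fun i => (hSA i).exists_typicalSubspace
  choose VB hVB hB using fun i => (hSB i).exists_typicalSubspace
  choose VE hVE hE using fun i => (hSE i).exists_typicalSubspace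
  set V := ∑ i, (VA i + VB i + VE i) with hV
  have hVi : ∀ i, VA i + VB i + VE i ≤ V := fun i =>
    Finset.single_le_sum (f := fun i => VA i + VB i + VE i)
      (fun j _ => add_nonneg (add_nonneg (hVA j) (hVB j)) (hVE j)) (Finset.mem_univ i)
  refine ⟨V, Finset.sum_nonneg fun j _ => add_nonneg (add_nonneg (hVA j) (hVB j)) (hVE j),
    fun l ε hl hε => ?_⟩
  have hl' : (0 : ℝ) < l := by exact_mod_cast hl
  have hη : ∀ {x}, x ≤ V → x / (l * ε ^ 2) ≤ V / (l * ε ^ 2) := fun hx => by gcongr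
  choose rA YA hYA using fun i => hA i l ε hl hε
  choose rB YB hYB using fun i => hB i l ε hl hε
  choose rE YE hYE using fun i => hE i l ε hl hε
  obtain ⟨v, W₀, hv, hW₀, hWY⟩ := exists_common_subspace YA
  refine ⟨v, ?_, fun K hK => ?_⟩
  · calc (v : ℝ) ≤ ∑ i, (rA i : ℝ) := by exact_mod_cast hv
      _ ≤ _ := Finset.sum_le_sum fun i _ => by simpa using (hYA i).card_le
  have hK' : (0 : ℝ) < K := by exact_mod_cast hK
  set W : Matrix (Fin K × (Fin l → A)) (Fin K × Fin v) ℂ :=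
    (1 : Matrix (Fin K) (Fin K) ℂ) ⊗ₖ W₀ with hWdef
  have hW : Wᴴ * W = 1 := by
    rw [hWdef, Matrix.conjTranspose_kronecker, ← Matrix.mul_kronecker_mul, hW₀,
      Matrix.conjTranspose_one, Matrix.one_mul, Matrix.one_kronecker_one]
  have hWW : ∀ i, W * (Wᴴ * ((1 : Matrix (Fin K) (Fin K) ℂ) ⊗ₖ YA i))
      = (1 : Matrix (Fin K) (Fin K) ℂ) ⊗ₖ YA i := fun i => by
    rw [hWdef, Matrix.conjTranspose_kronecker, ← Matrix.mul_kronecker_mul,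
      ← Matrix.mul_kronecker_mul, hWY, Matrix.conjTranspose_one, Matrix.one_mul, Matrix.one_mul]
  have hcA : ∀ i, IsTypicalSubspace
      (toMatA (sourceVec K l (ψ i)) * (toMatA (sourceVec K l (ψ i)))ᴴ)
      ((1 : Matrix (Fin K) (Fin K) ℂ) ⊗ₖ YA i) _ _ (V / (l * ε ^ 2)) := fun i => by
    rw [sourceVec_eq_withMaxEnt, toMatA_withMaxEnt_mul_conjTranspose,
      toMatA_powVec_mul_conjTranspose]
    exact ((hYA i).mono_tail (hη (by linarith [hVi i, hVB i, hVE i]))).maxMixed hK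
  have hcB : ∀ i, IsTypicalSubspace
      (toMatB (sourceVec K l (ψ i)) * (toMatB (sourceVec K l (ψ i)))ᴴ)
      ((1 : Matrix (Fin K) (Fin K) ℂ) ⊗ₖ YB i) _ _ (V / (l * ε ^ 2)) := fun i => by
    rw [sourceVec_eq_withMaxEnt, toMatB_withMaxEnt_mul_conjTranspose,
      toMatB_powVec_mul_conjTranspose]
    exact ((hYB i).mono_tail (hη (by linarith [hVi i, hVA i, hVE i]))).maxMixed hK
  have hcE : ∀ i, IsTypicalSubspace
      (toMatE (sourceVec K l (ψ i)) * (toMatE (sourceVec K l (ψ i)))ᴴ)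
      (YE i) _ _ (V / (l * ε ^ 2)) := fun i => by
    rw [sourceVec_eq_withMaxEnt, toMatE_withMaxEnt_mul_conjTranspose hK,
      toMatE_powVec_mul_conjTranspose]
    exact (hYE i).mono_tail (hη (by linarith [hVi i, hVA i, hVB i]))
  have hΨ : ∀ i, ∑ x, ‖sourceVec K l (ψ i) x‖ ^ 2 = 1 := fun i => sum_sq_sourceVec hK l (hψ i)
  choose φ hφ1 hφs hφA hφE hφB hφv using fun i =>
    exists_compression (hΨ i) (hcA i) (hcB i) (hcE i) hW (hWW i)
  set s := √(10 * (V / (l * ε ^ 2))) with hs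
  have hs2 : ∀ i, ∑ x, ‖(sourceVec K l (ψ i) - φ i) x‖ ^ 2 ≤ s ^ 2 := fun i => by
    have h0 : 0 ≤ 10 * (V / (l * ε ^ 2)) :=
      (Finset.sum_nonneg fun _ _ => sq_nonneg _).trans (hφs i)
    rw [hs, Real.sq_sqrt h0]
    exact hφs i
  -- the dimension at `E` and the Schmidt coefficients at `B` combine to the conditional entropy
  have hexp : ∀ i, (2 : ℝ) ^ ((l : ℝ) * (entropy (traceFst (pureState (ψ i))) + ε))
      * 2 ^ (-((l : ℝ) * (entropy (traceFst (traceSnd (pureState (ψ i)))) - ε)))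
      = 2 ^ ((l : ℝ) * (condEntropy (traceSnd (pureState (ψ i))) + 2 * ε)) := fun i => by
    rw [← Real.rpow_add two_pos, entropy_traceFst_pureState, condEntropy]
    congr 1
    ring
  have hR : (Fintype.card (Fin K × Fin v) : ℝ) = K * v := by
    rw [Fintype.card_prod, Fintype.card_fin, Fintype.card_fin, Nat.cast_mul]
  refine ⟨fun i => ?_, fun L hL hLv => ?_⟩
  · refine (one_sub_le_sum_sq (hΨ i) (Real.sqrt_nonneg _) (hs2 i)).trans ((hφv i).trans
      (le_of_eq ?_))
    rw [hR, ← hexp i]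
    field_simp
  · obtain ⟨M, hM, hMD, hMF⟩ := exists_merging_fidelity_ge hL
      (by rwa [Fintype.card_prod, Fintype.card_fin, Fintype.card_fin]) hW hΨ hφ1
      (Real.sqrt_nonneg _) hs2 hφA hφE
      (d := fun i => 2 ^ ((l : ℝ) * (entropy (traceFst (pureState (ψ i))) + ε)))
      (fun i => by
        rw [hsSq_mul_conjTranspose_of_isometry (hYE i).isometry]
        exact (hYE i).card_le) hφB
    refine ⟨M, hM, ?_, fun i => ?_⟩
    · rwa [Fintype.card_prod, Fintype.card_fin, Fintype.card_fin] at hMD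
    · refine le_trans (le_of_eq ?_) (hMF i)
      rw [hR]
      congr 4
      ext k
      congr 1
      rw [← hexp k]
      ring

end Achievability

/-! ### Protocols with optimal rates -/

section Protocol

variable {ι A B E : Type*} [Fintype A] [DecidableEq A] [Fintype B]
  [DecidableEq B] [Fintype E] [DecidableEq E]

lemma exists_trivial_merging {A' B' : Type*} [Fintype A'] [DecidableEq A'] [Fintype B']
    [DecidableEq B'] [Nonempty A'] :
    ∃ M : SuperOp (A' × B') (Fin 1 × (Fin 1 × (A' × B'))), IsLMerging 1 M ∧ IsOneWayLOCC 1 M := by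
  obtain ⟨M, hM, hD, -⟩ := exists_merging (A := A') (B := B') Unit (L := 1) (J := 0) one_pos
    Fintype.card_pos (fun j => j.elim0) (fun j => j.elim0) (fun j => j.elim0) (fun j => j.elim0)
  exact ⟨M, hM, hD⟩

/-- The width of the typical subspaces for block length `l`. -/
noncomputable def width (l : ℕ) : ℝ := (l : ℝ) ^ (-(1 / 4) : ℝ)

lemma width_pos {l : ℕ} (hl : 0 < l) : 0 < width l :=
  Real.rpow_pos_of_pos (by exact_mod_cast hl) _

lemma tendsto_width : Tendsto width atTop (𝓝 0) :=
  (tendsto_rpow_neg_atTop (by norm_num)).comp tendsto_natCast_atTop_atTop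

lemma tendsto_div_mul_width_sq (V : ℝ) :
    Tendsto (fun l : ℕ => V / (l * width l ^ 2)) atTop (𝓝 0) := by
  have h : Tendsto (fun l : ℕ => (l : ℝ) ^ (1 / 2 : ℝ)) atTop atTop :=
    (tendsto_rpow_atTop (by norm_num)).comp tendsto_natCast_atTop_atTop
  refine (h.const_div_atTop V).congr' ?_
  filter_upwards [eventually_gt_atTop 0] with l hl
  have hl' : (0 : ℝ) < l := by exact_mod_cast hl
  congr 1
  rw [width, ← Real.rpow_natCast, ← Real.rpow_mul hl'.le]
  nth_rewrite 2 [← Real.rpow_one (l : ℝ)]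
  rw [← Real.rpow_add hl']
  norm_num

lemma tendsto_two_rpow_neg_mul {δ : ℝ} (hδ : 0 < δ) :
    Tendsto (fun l : ℕ => (2 : ℝ) ^ (-((l : ℝ) * (δ - 2 * width l)))) atTop (𝓝 0) := by
  have h1 : Tendsto (fun l : ℕ => (l : ℝ) * (δ - 2 * width l)) atTop atTop := by
    refine Tendsto.atTop_mul_pos hδ tendsto_natCast_atTop_atTop ?_
    simpa using tendsto_const_nhds.sub (tendsto_width.const_mul 2)
  exact (tendsto_rpow_atBot_of_base_gt_one 2 one_lt_two).comp (tendsto_neg_atTop_atBot.comp h1)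

/-- A real sequence that converges has its limit as its upper limit in the extended reals. -/
lemma limsup_coe_eq {x : ℕ → ℝ} {a : ℝ} (h : Tendsto x atTop (𝓝 a)) :
    limsup (fun l => (x l : EReal)) atTop = (a : EReal) :=
  ((continuous_coe_real_ereal.tendsto a).comp h).limsup_eq

/-- The ranks `L = 2 ^ (l C₀)` and `K ≈ 2 ^ (l (C₀ + r))`, and a subspace of dimension `v`, give a
merging that satisfies the requirements for block length `l`, provided that `l` is so large that
the bounds make sense.  Here `c` and `S` bound the conditional entropies and the entropies at `A`. -/
lemma exists_merging_of_rates [Fintype ι] [DecidableEq ι] [Nonempty ι] {ψ : ι → (A × B) × E → ℂ}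
    (hψ : ∀ i, ∑ x, ‖ψ i x‖ ^ 2 = 1) {c S δ : ℝ}
    (hc : ∀ i, condEntropy (traceSnd (pureState (ψ i))) ≤ c)
    (hS : ∀ i, entropy (traceSnd (traceSnd (pureState (ψ i)))) ≤ S) :
    ∃ V : ℝ, 0 ≤ V ∧ ∀ (l : ℕ) (C₀ : ℕ) (ε : ℝ), 0 < l → 0 < ε → 0 ≤ C₀ + (c + δ) →
      √(10 * (V / (l * ε ^ 2))) ≤ 1 / 4 →
      (2 : ℝ) ^ (-((l : ℝ) * (δ - 2 * ε))) ≤ 1 / 2 →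
      ∃ (K L D : ℕ) (M : SuperOp ((Fin K × (Fin l → A)) × (Fin K × (Fin l → B)))
          (Fin L × (Fin L × ((Fin K × (Fin l → A)) × (Fin K × (Fin l → B)))))),
        0 < K ∧ (L : ℝ) = 2 ^ ((l : ℝ) * C₀) ∧ L * 2 ^ ((l : ℝ) * (c + δ)) ≤ (K : ℝ) ∧
        (K : ℝ) ≤ 2 * (L * 2 ^ ((l : ℝ) * (c + δ))) ∧
        0 < D ∧ (D : ℝ) ≤ 4 * Fintype.card ι * 2 ^ ((l : ℝ) * (S + (c + δ) + ε)) ∧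
        IsLMerging L M ∧ IsOneWayLOCC D M ∧
        ∀ i, 1 - 2 * (Fintype.card ι * (2 * 2 ^ (-((l : ℝ) * (δ - 2 * ε))))
            + 4 * Fintype.card ι * √(10 * (V / (l * ε ^ 2)))
            + Fintype.card ι * √(2 ^ (-((l : ℝ) * (δ - 2 * ε))) * Fintype.card ι))
          ≤ mergingFidelity L M (sourceVec K l (ψ i)) := by
  obtain ⟨V, hV, hM⟩ := exists_merging_sourceVec hψ
  refine ⟨V, hV, fun l C₀ ε hl hε hC₀ hT hθ => ?_⟩
  obtain ⟨v, hv, hM⟩ := hM l ε hl hε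
  have hl' : (0 : ℝ) < l := by exact_mod_cast hl
  set N : ℝ := (Fintype.card ι : ℝ) with hN
  set θ : ℝ := 2 ^ (-((l : ℝ) * (δ - 2 * ε))) with hθdef
  set T : ℝ := √(10 * (V / (l * ε ^ 2))) with hTdef
  set w : ℝ := 2 ^ ((l : ℝ) * (c + δ)) with hw
  have hw0 : 0 < w := Real.rpow_pos_of_pos two_pos _
  have hθ0 : 0 < θ := Real.rpow_pos_of_pos two_pos _
  set L : ℕ := 2 ^ (l * C₀) with hLdef
  have hL : 0 < L := pow_pos two_pos _
  have hL' : (0 : ℝ) < L := by exact_mod_cast hL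
  have hLr : (L : ℝ) = 2 ^ ((l : ℝ) * C₀) := by
    rw [hLdef, ← Nat.cast_mul, Real.rpow_natCast]
    push_cast; rfl
  have hLw : 1 ≤ L * w := by
    rw [hLr, hw, ← Real.rpow_add two_pos, ← mul_add]
    exact Real.one_le_rpow one_le_two (mul_nonneg hl'.le hC₀)
  set K : ℕ := ⌈(L : ℝ) * w⌉₊ with hKdef
  have hK1 : L * w ≤ (K : ℝ) := Nat.le_ceil _
  have hK2 : (K : ℝ) ≤ 2 * (L * w) := by
    have := (Nat.ceil_lt_add_one (by positivity : 0 ≤ (L : ℝ) * w)).le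
    linarith
  have hK' : (0 : ℝ) < K := by linarith
  have hK : 0 < K := by exact_mod_cast hK'
  obtain ⟨hvc, hM⟩ := hM K hK
  have hLK : (L : ℝ) / K ≤ w⁻¹ := by
    rw [div_le_iff₀ hK', inv_mul_eq_div, le_div_iff₀ hw0]
    exact hK1
  have hwθ : ∀ i, w⁻¹ * 2 ^ ((l : ℝ) * (condEntropy (traceSnd (pureState (ψ i))) + 2 * ε)) ≤ θ := by
    intro i
    rw [hw, ← Real.rpow_neg two_pos.le, ← Real.rpow_add two_pos, hθdef]
    refine Real.rpow_le_rpow_of_exponent_le one_le_two ?_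
    have := mul_le_mul_of_nonneg_left (hc i) hl'.le
    linarith
  obtain ⟨i₀⟩ := ‹Nonempty ι›
  have hv0 : (0 : ℝ) < v := by
    have h1 := hvc i₀
    by_contra h
    have h2 : (v : ℝ) * 2 ^ ((l : ℝ) * (condEntropy (traceSnd (pureState (ψ i₀))) + 2 * ε)) ≤ 0 :=
      mul_nonpos_of_nonpos_of_nonneg (not_lt.1 h) (Real.rpow_nonneg two_pos.le _)
    linarith
  have hq : (L : ℝ) / (K * v) ≤ 2 * θ := by
    rw [← div_div, div_le_iff₀ hv0]
    have h1 := hvc i₀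
    have h2 := hwθ i₀
    have h3 : w⁻¹ * (1 / 2) ≤ w⁻¹ * (v * 2 ^ ((l : ℝ) *
        (condEntropy (traceSnd (pureState (ψ i₀))) + 2 * ε))) :=
      mul_le_mul_of_nonneg_left (by linarith) (inv_pos.2 hw0).le
    have h4 := mul_le_mul_of_nonneg_left h2 hv0.le
    linarith
  have hLv' : (L : ℝ) ≤ K * v := by
    rw [← div_le_one (by positivity)]
    linarith
  have hLv : L ≤ K * v := by exact_mod_cast hLv'
  obtain ⟨M, hML, hMD, hMF⟩ := hM L hL hLv
  refine ⟨K, L, K * v / L + 1, M, hK, hLr, hK1, hK2, Nat.succ_pos _, ?_, hML, hMD, fun i => ?_⟩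
  · have h1 : ((K * v / L : ℕ) : ℝ) ≤ K * v / L := by
      have := Nat.cast_div_le (α := ℝ) (m := K * v) (n := L)
      rwa [Nat.cast_mul] at this
    have h2 : 1 ≤ (K : ℝ) * v / L := (one_le_div hL').2 hLv'
    have h3 : (K : ℝ) * v / L ≤ 2 * w * v := by
      rw [div_le_iff₀ hL']
      nlinarith
    have h4 : (v : ℝ) ≤ N * 2 ^ ((l : ℝ) * (S + ε)) := by
      refine hv.trans ?_
      rw [hN, ← nsmul_eq_mul, ← Finset.card_univ, ← Finset.sum_const]
      refine Finset.sum_le_sum fun i _ => Real.rpow_le_rpow_of_exponent_le one_le_two ?_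
      exact mul_le_mul_of_nonneg_left (by linarith [hS i]) hl'.le
    have h5 : w * 2 ^ ((l : ℝ) * (S + ε)) = 2 ^ ((l : ℝ) * (S + (c + δ) + ε)) := by
      rw [hw, ← Real.rpow_add two_pos]
      congr 1
      ring
    push_cast
    calc ((K * v / L : ℕ) : ℝ) + 1 ≤ 2 * (2 * w * v) := by linarith
      _ = 4 * (w * v) := by ring
      _ ≤ 4 * (w * (N * 2 ^ ((l : ℝ) * (S + ε)))) := by gcongr
      _ = 4 * N * (w * 2 ^ ((l : ℝ) * (S + ε))) := by ring
      _ = _ := by rw [h5]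
  · refine le_trans ?_ (hMF i)
    have h1 : ∑ k, √(L / K * 2 ^ ((l : ℝ) * (condEntropy (traceSnd (pureState (ψ k))) + 2 * ε)) * N)
        ≤ N * √(θ * N) := by
      rw [hN, ← nsmul_eq_mul, ← Finset.card_univ, ← Finset.sum_const]
      refine Finset.sum_le_sum fun k _ => Real.sqrt_le_sqrt ?_
      refine mul_le_mul_of_nonneg_right (le_trans ?_ (hwθ k)) (Nat.cast_nonneg _)
      exact mul_le_mul_of_nonneg_right hLK (Real.rpow_nonneg two_pos.le _)
    have h2 : N * (L / (K * v) : ℝ) ≤ N * (2 * θ) :=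
      mul_le_mul_of_nonneg_left hq (Nat.cast_nonneg _)
    linarith

/-- There are protocols with entanglement rate exactly `c + δ` and classical communication rate at
most `S + c + δ`, for upper bounds `c` and `S` on the conditional entropies and on the entropies
at `A`. -/
theorem exists_protocol [Finite ι] [Nonempty ι] {ψ : ι → (A × B) × E → ℂ}
    (hψ : ∀ i, ∑ x, ‖ψ i x‖ ^ 2 = 1) {c S δ : ℝ}
    (hc : ∀ i, condEntropy (traceSnd (pureState (ψ i))) ≤ c)
    (hS : ∀ i, entropy (traceSnd (traceSnd (pureState (ψ i)))) ≤ S) (hδ : 0 < δ) :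
    ∃ (K L D : ℕ → ℕ) (M : ∀ l : ℕ, SuperOp
        ((Fin (K l) × (Fin l → A)) × (Fin (K l) × (Fin l → B)))
        (Fin (L l) × (Fin (L l) × ((Fin (K l) × (Fin l → A)) × (Fin (K l) × (Fin l → B)))))),
      IsLMergingProtocol ψ K L D M ∧ entanglementRate K L = ((c + δ : ℝ) : EReal) ∧
      classicalRate D ≤ ((S + c + δ : ℝ) : EReal) := by
  classical
  have := Fintype.ofFinite ι
  obtain ⟨V, hV, hM⟩ := exists_merging_of_rates (δ := δ) hψ hc hS
  have hA : Nonempty A := by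
    by_contra hA
    rw [not_nonempty_iff] at hA
    obtain ⟨i⟩ := ‹Nonempty ι›
    have := hψ i
    simp at this
  set N : ℝ := (Fintype.card ι : ℝ) with hN
  have hN0 : 0 < N := by rw [hN]; exact_mod_cast Fintype.card_pos (α := ι)
  obtain ⟨C₀, hC₀⟩ := exists_nat_ge (-(c + δ))
  have hC₀' : 0 ≤ C₀ + (c + δ) := by linarith
  set T : ℕ → ℝ := fun l => √(10 * (V / (l * width l ^ 2))) with hT
  set θ : ℕ → ℝ := fun l => 2 ^ (-((l : ℝ) * (δ - 2 * width l))) with hθ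
  set err : ℕ → ℝ := fun l => 2 * (N * (2 * θ l) + 4 * N * T l + N * √(θ l * N)) with herr
  have hT0 : Tendsto T atTop (𝓝 0) := by
    have := ((tendsto_div_mul_width_sq V).const_mul 10).sqrt
    rwa [mul_zero, Real.sqrt_zero] at this
  have hθ0 : Tendsto θ atTop (𝓝 0) := tendsto_two_rpow_neg_mul hδ
  have herr0 : Tendsto err atTop (𝓝 0) := by
    have h1 := (((hθ0.const_mul 2).const_mul N).add (hT0.const_mul (4 * N))).add
      ((hθ0.mul_const N).sqrt.const_mul N)
    have h2 := h1.const_mul 2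
    simpa using h2
  obtain ⟨l₀, hl₀⟩ := eventually_atTop.1 (((hT0.eventually (ge_mem_nhds
    (show (0 : ℝ) < 1 / 4 by norm_num))).and (hθ0.eventually (ge_mem_nhds
    (show (0 : ℝ) < 1 / 2 by norm_num)))).and (eventually_gt_atTop 0))
  set C : ℝ := C₀ + |c + δ| + 1 with hC
  have hC0 : 0 < C := by positivity
  have hex : ∀ l : ℕ, ∃ (K L D : ℕ) (M : SuperOp ((Fin K × (Fin l → A)) × (Fin K × (Fin l → B)))
      (Fin L × (Fin L × ((Fin K × (Fin l → A)) × (Fin K × (Fin l → B)))))),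
      0 < K ∧ IsLMerging L M ∧ IsOneWayLOCC D M ∧
      (0 < l → (K : ℝ) ≤ 2 ^ ((l : ℝ) * C) ∧ (L : ℝ) ≤ 2 ^ ((l : ℝ) * C)) ∧
      (l₀ ≤ l → (L * 2 ^ ((l : ℝ) * (c + δ)) ≤ (K : ℝ) ∧
        (K : ℝ) ≤ 2 * (L * 2 ^ ((l : ℝ) * (c + δ)))) ∧
        (0 < D ∧ (D : ℝ) ≤ 4 * N * 2 ^ ((l : ℝ) * (S + (c + δ) + width l))) ∧
        ∀ i, 1 - err l ≤ mergingFidelity L M (sourceVec K l (ψ i))) := by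
    intro l
    by_cases hl : l₀ ≤ l
    · obtain ⟨⟨h1, h2⟩, h3⟩ := hl₀ l hl
      obtain ⟨K, L, D, M, hK, hL, hK1, hK2, hD, hD2, hML, hMD, hMF⟩ :=
        hM l C₀ (width l) h3 (width_pos h3) hC₀' h1 h2
      have hl1 : (1 : ℝ) ≤ l := by exact_mod_cast h3
      refine ⟨K, L, D, M, hK, hML, hMD, fun _ => ⟨?_, ?_⟩, fun _ => ⟨⟨hK1, hK2⟩, ⟨hD, hD2⟩, hMF⟩⟩
      · rw [hL, ← Real.rpow_add two_pos] at hK2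
        refine hK2.trans ?_
        nth_rewrite 1 [← Real.rpow_one 2]
        rw [← Real.rpow_add two_pos]
        refine Real.rpow_le_rpow_of_exponent_le one_le_two ?_
        have := mul_le_mul_of_nonneg_left (le_abs_self (c + δ)) (zero_le_one.trans hl1)
        rw [hC]
        linarith
      · rw [hL]
        refine Real.rpow_le_rpow_of_exponent_le one_le_two ?_
        refine mul_le_mul_of_nonneg_left ?_ (zero_le_one.trans hl1)
        linarith [abs_nonneg (c + δ)]
    · obtain ⟨M, hM1, hM2⟩ := exists_trivial_merging (A' := Fin 1 × (Fin l → A))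
        (B' := Fin 1 × (Fin l → B))
      refine ⟨1, 1, 1, M, one_pos, hM1, hM2, fun _ => ?_, fun h => absurd h hl⟩
      rw [Nat.cast_one]
      have := Real.one_le_rpow one_le_two (mul_nonneg (Nat.cast_nonneg (α := ℝ) l) hC0.le)
      exact ⟨this, this⟩
  choose K L D M hK hML hMD hgrowth hgood using hex
  refine ⟨K, L, D, M, ⟨fun l _ => hK l, fun l _ => hML l, fun l _ => hMD l,
    ⟨C, hC0, hgrowth⟩, ?_⟩, ?_, ?_⟩
  · refine tendsto_of_tendsto_of_tendsto_of_le_of_le' (g := fun l => 1 - err l)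
      (h := fun _ => 1) (by simpa using tendsto_const_nhds.sub herr0) tendsto_const_nhds ?_ ?_
    · filter_upwards [eventually_ge_atTop l₀] with l hl
      exact le_ciInf fun i => (hgood l hl).2.2 i
    · refine Eventually.of_forall fun l => ?_
      obtain ⟨i⟩ := ‹Nonempty ι›
      exact (ciInf_le (Set.finite_range _).bddBelow i).trans
        (mergingFidelity_le_one (hML l) (sum_sq_sourceVec (hK l) l (hψ i)))
  · refine limsup_coe_eq ?_
    have h1 : Tendsto (fun l : ℕ => (c + δ) + 1 / (l : ℝ)) atTop (𝓝 (c + δ)) := by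
      simpa using (tendsto_const_nhds (x := c + δ)).add
        (tendsto_const_div_atTop_nhds_zero_nat (1 : ℝ))
    refine tendsto_of_tendsto_of_tendsto_of_le_of_le' tendsto_const_nhds h1 ?_ ?_ <;>
    filter_upwards [eventually_ge_atTop l₀, eventually_gt_atTop 0] with l hl hl0
    all_goals
      obtain ⟨h2, h3⟩ := (hgood l hl).1
      have hl' : (0 : ℝ) < l := by exact_mod_cast hl0
      have hL' : (0 : ℝ) < L l := by exact_mod_cast (hML l).1
      have hK' : (0 : ℝ) < K l := by exact_mod_cast hK l
    · rw [one_div, inv_mul_eq_div, le_div_iff₀ hl', Real.le_logb_iff_rpow_le one_lt_two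
        (by positivity), le_div_iff₀ hL', mul_comm (c + δ), mul_comm _ (L l : ℝ)]
      exact h2
    · rw [one_div, inv_mul_eq_div, div_le_iff₀ hl', Real.logb_le_iff_le_rpow one_lt_two
        (by positivity), div_le_iff₀ hL', add_mul, inv_mul_cancel₀ hl'.ne',
        Real.rpow_add two_pos, Real.rpow_one, mul_comm (c + δ)]
      linarith
  · have h1 : Tendsto (fun l : ℕ => Real.logb 2 (4 * N) / (l : ℝ) + (S + (c + δ) + width l)) atTop
        (𝓝 (S + c + δ)) := by
      have := (tendsto_const_div_atTop_nhds_zero_nat (Real.logb 2 (4 * N))).add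
        (tendsto_const_nhds (x := S + (c + δ)) |>.add tendsto_width)
      rw [add_assoc S c δ]
      rwa [zero_add, add_zero] at this
    rw [← limsup_coe_eq h1]
    refine limsup_le_limsup ?_
    filter_upwards [eventually_ge_atTop l₀, eventually_gt_atTop 0] with l hl hl0
    obtain ⟨h2, h3⟩ := (hgood l hl).2.1
    have hl' : (0 : ℝ) < l := by exact_mod_cast hl0
    have hD' : (0 : ℝ) < D l := by exact_mod_cast h2
    rw [EReal.coe_le_coe_iff, one_div, inv_mul_eq_div, div_le_iff₀ hl',
      Real.logb_le_iff_le_rpow one_lt_two hD', add_mul, div_mul_cancel₀ _ hl'.ne',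
      Real.rpow_add two_pos, Real.rpow_logb two_pos (by norm_num) (by positivity),
      mul_comm _ (l : ℝ)]
    exact h3

end Protocol

end StateMerging

theorem mainTheorem4 {ι A B E : Type*} [Fintype ι] [Nonempty ι]
    [Fintype A] [DecidableEq A] [Fintype B] [DecidableEq B] [Fintype E] [DecidableEq E]
    (ρ : ι → Matrix (A × B) (A × B) ℂ) (hρ : ∀ i, StateMerging.IsState (ρ i))
    (ψ : ι → (A × B) × E → ℂ) (hψ : ∀ i, StateMerging.IsPurification (ψ i) (ρ i))
    (δ : ℝ) (hδ : 0 < δ) :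
    IsLeast
      {r : EReal | ∃ (K L D : ℕ → ℕ)
        (M : ∀ l : ℕ, StateMerging.SuperOp
          ((Fin (K l) × (Fin l → A)) × (Fin (K l) × (Fin l → B)))
          (Fin (L l) × (Fin (L l) ×
            ((Fin (K l) × (Fin l → A)) × (Fin (K l) × (Fin l → B)))))),
        StateMerging.IsLMergingProtocol ψ K L D M ∧
        StateMerging.entanglementRate K L =
          (((⨆ i, StateMerging.condEntropy (ρ i)) + δ : ℝ) : EReal) ∧
        StateMerging.classicalRate D = r}
      (((⨆ i, StateMerging.entropy (StateMerging.traceSnd (ρ i))) +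
        (⨆ i, StateMerging.condEntropy (ρ i)) + δ : ℝ) : EReal) := by
  obtain rfl : ρ = fun i => StateMerging.traceSnd (StateMerging.pureState (ψ i)) :=
    funext fun i => (hψ i).symm
  have hψ1 : ∀ i, ∑ x, ‖ψ i x‖ ^ 2 = 1 := fun i => (hψ i).sum_sq (hρ i)
  have hc := fun i => le_ciSup (Set.finite_range fun i =>
    StateMerging.condEntropy (StateMerging.traceSnd (StateMerging.pureState (ψ i)))).bddAbove i
  have hS := fun i => le_ciSup (Set.finite_range fun i => StateMerging.entropy
    (StateMerging.traceSnd (StateMerging.traceSnd (StateMerging.pureState (ψ i))))).bddAbove i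
  obtain ⟨i₀, hi₀⟩ := exists_eq_ciSup_of_finite (f := fun i => StateMerging.entropy
    (StateMerging.traceSnd (StateMerging.traceSnd (StateMerging.pureState (ψ i)))))
  constructor
  · obtain ⟨K, L, D, M, hM, hE, hD⟩ := StateMerging.exists_protocol hψ1 hc hS hδ
    refine ⟨K, L, D, M, hM, hE, le_antisymm hD ?_⟩
    have h := StateMerging.le_classicalRate hψ1 hM hE i₀
    rwa [hi₀, ← add_assoc] at h
  · rintro _ ⟨K, L, D, M, hM, hE, rfl⟩
    have h := StateMerging.le_classicalRate hψ1 hM hE i₀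
    rwa [hi₀, ← add_assoc] at h
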